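/- For $u:\mathbb{R}\to\mathbb{C}$ let $L^{2,1}(\mathbb{R})=\{f:\langle x\rangle f\in L^2(\mathbb{R})\}$ with $\langle x\rangle=(1+x^2)^{1/2}$ and $\|f\|_{L^{2,1}}=\|\langle x\rangle f\|_{L^2}$, let $H^{1,1}(\mathbb{R})=\{u: u,u_x\in L^{2,1}(\mathbb{R})\}$ with $\|u\|_{H^{1,1}}=\|u\|_{L^{2,1}}+\|u_x\|_{L^{2,1}}$ (weak derivatives), and equip $H^2\cap H^{1,1}$ with the sum of the two norms. For $u\in H^{1,1}(\mathbb{R})$ put $w=-iu_x+2u-\frac12|u|^2u$, $$Q_1=\begin{pmatrix}0&\frac u2\\ \overline w&0\end{pmatrix},\qquad Q_2=\begin{pmatrix}0&w\\ \frac{\overline u}2&0\end{pmatrix},$$ $e_1=(1,0)^T$, $e_2=(0,1)^T$, and for each sign $\pm$ and $z\in\mathbb{R}$ let the Jost functions $m_\pm(\cdot;z),n_\pm(\cdot;z):\mathbb{R}\to\mathbb{C}^2$ be the bounded solutions of the Volterra equations $$m_\pm(x;z)=e_1+\int_{\pm\infty}^x\begin{pmatrix}1&0\\0&e^{2i(z+1)(x-y)}\end{pmatrix}Q_1(y)m_\pm(y;z)\,dy,$$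 $$n_\pm(x;z)=e_2+\int_{\pm\infty}^x\begin{pmatrix}e^{-2i(z+1)(x-y)}&0\\0&1\end{pmatrix}Q_2(y)n_\pm(y;z)\,dy,$$ which exist and are unique. Put $q_\pm(x)=\frac12\int_{\pm\infty}^x u(y)\overline{w(y)}\,dy$ and $$m_\pm^{\langle2\rangle}=2iz[m_\pm-e_1]+q_\pm e_1+\overline w\,e_2,\qquad n_\pm^{\langle2\rangle}=2iz[n_\pm-e_2]-w\,e_1-\overline{q_\pm}\,e_2 .$$ Let $\mathbb{R}^+=(0,\infty)$ and $\mathbb{R}^-=(-\infty,0)$. (i) The map $u\mapsto[m_\pm-e_1,\,n_\pm-e_2]$ takes $H^{1,1}(\mathbb{R})$ into $L^\infty(\mathbb{R}^\pm;H^1_z(\mathbb{R}))$ and is Lipschitz continuous on bounded sets: for every $B\ge0$ there is a constant $C(B)$ such that for all $u,\tilde u\in H^{1,1}(\mathbb{R})$ with norms at most $B$, $$\|m_\pm-\tilde m_\pm\|_{L^\infty(\mathbb{R}^\pm;H^1_z)}+\|n_\pm-\tilde n_\pm\|_{L^\infty(\mathbb{R}^\pm;H^1_z)}\le C(B)\,\|u-\tilde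 u\|_{H^{1,1}} .$$ (ii) The map $u\mapsto[m_\pm^{\langle2\rangle},\,n_\pm^{\langle2\rangle}]$ takes $H^2(\mathbb{R})\cap H^{1,1}(\mathbb{R})$ into $L^\infty(\mathbb{R}^\pm;L^2_z(\mathbb{R}))$ and is Lipschitz continuous on bounded sets: for every $B\ge0$ there is a constant $C(B)$ such that for all $u,\tilde u\in H^2(\mathbb{R})\cap H^{1,1}(\mathbb{R})$ with norms at most $B$, $$\|m_\pm^{\langle2\rangle}-\tilde m_\pm^{\langle2\rangle}\|_{L^\infty(\mathbb{R}^\pm;L^2_z)}+\|n_\pm^{\langle2\rangle}-\tilde n_\pm^{\langle2\rangle}\|_{L^\infty(\mathbb{R}^\pm;L^2_z)}\le C(B)\,\|u-\tilde u\|_{H^2\cap H^{1,1}} .$$ -/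

import Mathlib

open MeasureTheory Set
open scoped ContDiff ENNReal NNReal ComplexConjugate

namespace NLSGI

/-! ## Weak derivatives and function spaces on the line -/

section Spaces

variable {E : Type*} [NormedAddCommGroup E] [NormedSpace ℝ E]

/-- `g` is a weak derivative of `f` on `ℝ`: both are locally integrable and
`∫ φ' f = - ∫ φ g` for every smooth compactly supported test function `φ`. -/
def IsWeakDeriv (f g : ℝ → E) : Prop :=
  LocallyIntegrable f volume ∧ LocallyIntegrable g volume ∧
    ∀ φ : ℝ → ℝ, ContDiff ℝ ∞ φ → HasCompactSupport φ →
      ∫ x, deriv φ x • f x = - ∫ x, φ x • g x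

/-- `f` has a weak derivative. -/
def HasWeakDeriv (f : ℝ → E) : Prop := ∃ g, IsWeakDeriv f g

open Classical in
/-- The weak derivative (determined up to a null set); zero if there is none. -/
noncomputable def weakDeriv (f : ℝ → E) : ℝ → E :=
  if h : HasWeakDeriv f then h.choose else 0

/-- The function `x ↦ ⟨x⟩ f(x)`, where `⟨x⟩ = (1 + x²)^{1/2}`. -/
noncomputable def weighted (f : ℝ → E) : ℝ → E := fun x => Real.sqrt (1 + x ^ 2) • f x

/-- `f ∈ L^{2,1}(ℝ)`, that is `⟨x⟩ f ∈ L²(ℝ)`. -/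
def MemL21 (f : ℝ → E) : Prop := MemLp (weighted f) 2 volume

/-- The norm of `L^{2,1}(ℝ)`. -/
noncomputable def l21Norm (f : ℝ → E) : ℝ≥0∞ := eLpNorm (weighted f) 2 volume

/-- `f ∈ H^{1,1}(ℝ)`: `f` and its weak derivative belong to `L^{2,1}(ℝ)`. -/
def MemH11 (f : ℝ → E) : Prop := HasWeakDeriv f ∧ MemL21 f ∧ MemL21 (weakDeriv f)

/-- The norm of `H^{1,1}(ℝ)`. -/
noncomputable def h11Norm (f : ℝ → E) : ℝ≥0∞ := l21Norm f + l21Norm (weakDeriv f)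

/-- `f ∈ H²(ℝ)`: `f`, `f'`, `f''` (weak derivatives) belong to `L²(ℝ)`. -/
def MemH2 (f : ℝ → E) : Prop :=
  HasWeakDeriv f ∧ HasWeakDeriv (weakDeriv f) ∧
    MemLp f 2 volume ∧ MemLp (weakDeriv f) 2 volume ∧ MemLp (weakDeriv (weakDeriv f)) 2 volume

/-- The norm of `H²(ℝ)`. -/
noncomputable def h2Norm (f : ℝ → E) : ℝ≥0∞ :=
  eLpNorm f 2 volume + eLpNorm (weakDeriv f) 2 volume +
    eLpNorm (weakDeriv (weakDeriv f)) 2 volume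

open Classical in
/-- The norm of `H¹(ℝ)`; it is `∞` for a function without a weak derivative. -/
noncomputable def h1Norm (f : ℝ → E) : ℝ≥0∞ :=
  if HasWeakDeriv f then eLpNorm f 2 volume + eLpNorm (weakDeriv f) 2 volume else (⊤ : ℝ≥0∞)

end Spaces

/-! ## The two half lines and integration from the corresponding infinity -/

/-- The sign `±`. -/
inductive Sgn
  | plus
  | minus

/-- `ℝ⁺ = (0, ∞)` and `ℝ⁻ = (-∞, 0)`. -/
def Sgn.halfLine : Sgn → Set ℝ
  | .plus => Ioi 0
  | .minus => Iio 0

/-- `∫_{±∞}^x f(y) dy`. -/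
noncomputable def Sgn.integralTo : Sgn → ℝ → (ℝ → ℂ) → ℂ
  | .plus, x, f => - ∫ y in Ioi x, f y
  | .minus, x, f => ∫ y in Iic x, f y

/-- `ℂ²` with its Euclidean norm. -/
abbrev C2 : Type := EuclideanSpace ℂ (Fin 2)

noncomputable def e₁ : C2 := !₂[1, 0]

noncomputable def e₂ : C2 := !₂[0, 1]

/-- The norm of `L^∞(ℝ^±; L²_z(ℝ))` of a function `f(x; z)`. -/
noncomputable def linftyL2Norm (s : Sgn) (f : ℝ → ℝ → C2) : ℝ≥0∞ :=
  essSup (fun x => eLpNorm (f x) 2 volume) (volume.restrict s.halfLine)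

/-- The norm of `L^∞(ℝ^±; H¹_z(ℝ))` of a function `f(x; z)`. -/
noncomputable def linftyH1Norm (s : Sgn) (f : ℝ → ℝ → C2) : ℝ≥0∞ :=
  essSup (fun x => h1Norm (f x)) (volume.restrict s.halfLine)

/-- `f(x; z)` is (jointly) measurable on `ℝ^± × ℝ`. -/
def MeasurableOn (s : Sgn) (f : ℝ → ℝ → C2) : Prop :=
  AEStronglyMeasurable (Function.uncurry f)
    ((volume.restrict s.halfLine).prod (volume : Measure ℝ))

/-- `f ∈ L^∞(ℝ^±; L²_z(ℝ))`. -/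
def MemLinftyL2 (s : Sgn) (f : ℝ → ℝ → C2) : Prop :=
  MeasurableOn s f ∧ linftyL2Norm s f < ⊤

/-- `f ∈ L^∞(ℝ^±; H¹_z(ℝ))`. -/
def MemLinftyH1 (s : Sgn) (f : ℝ → ℝ → C2) : Prop :=
  MeasurableOn s f ∧ linftyH1Norm s f < ⊤

/-! ## Jost functions -/

/-- `w = -i u_x + 2 u - |u|² u / 2`. -/
noncomputable def w (u : ℝ → ℂ) (x : ℝ) : ℂ :=
  - Complex.I * weakDeriv u x + 2 * u x - (1 / 2) * (‖u x‖ : ℂ) ^ 2 * u x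

noncomputable def Q₁ (u : ℝ → ℂ) (y : ℝ) : Matrix (Fin 2) (Fin 2) ℂ :=
  !![0, u y / 2; conj (w u y), 0]

noncomputable def Q₂ (u : ℝ → ℂ) (y : ℝ) : Matrix (Fin 2) (Fin 2) ℂ :=
  !![0, w u y; conj (u y) / 2, 0]

/-- `diag(1, e^{2i(z+1)t})`. -/
noncomputable def D₁ (z t : ℝ) : Matrix (Fin 2) (Fin 2) ℂ :=
  !![1, 0; 0, Complex.exp (2 * Complex.I * (z + 1) * t)]

/-- `diag(e^{-2i(z+1)t}, 1)`. -/
noncomputable def D₂ (z t : ℝ) : Matrix (Fin 2) (Fin 2) ℂ :=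
  !![Complex.exp (-2 * Complex.I * (z + 1) * t), 0; 0, 1]

/-- `m = m_±` is the Jost function of the first kind of the potential `u`: for every real `z`,
`x ↦ m(x; z)` is bounded and measurable, and it solves the Volterra equation
`m(x; z) = e₁ + ∫_{±∞}^x diag(1, e^{2i(z+1)(x-y)}) Q₁(y) m(y; z) dy`, componentwise. -/
def IsJostM (s : Sgn) (u : ℝ → ℂ) (m : ℝ → ℝ → C2) : Prop :=
  ∀ z : ℝ, AEStronglyMeasurable (fun x => m x z) volume ∧ (∃ M : ℝ, ∀ x, ‖m x z‖ ≤ M) ∧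
    ∀ (x : ℝ) (i : Fin 2), m x z i =
      e₁ i + s.integralTo x (fun y => ((D₁ z (x - y) * Q₁ u y).mulVec (m y z)) i)

/-- `n = n_±` is the Jost function of the second kind of the potential `u`: for every real `z`,
`x ↦ n(x; z)` is bounded and measurable, and it solves the Volterra equation
`n(x; z) = e₂ + ∫_{±∞}^x diag(e^{-2i(z+1)(x-y)}, 1) Q₂(y) n(y; z) dy`, componentwise. -/
def IsJostN (s : Sgn) (u : ℝ → ℂ) (n : ℝ → ℝ → C2) : Prop :=
  ∀ z : ℝ, AEStronglyMeasurable (fun x => n x z) volume ∧ (∃ M : ℝ, ∀ x, ‖n x z‖ ≤ M) ∧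
    ∀ (x : ℝ) (i : Fin 2), n x z i =
      e₂ i + s.integralTo x (fun y => ((D₂ z (x - y) * Q₂ u y).mulVec (n y z)) i)

open Classical in
/-- The Jost function `m_±(x; z)` of `u`. -/
noncomputable def jostM (s : Sgn) (u : ℝ → ℂ) : ℝ → ℝ → C2 :=
  if h : ∃ m, IsJostM s u m then h.choose else 0

open Classical in
/-- The Jost function `n_±(x; z)` of `u`. -/
noncomputable def jostN (s : Sgn) (u : ℝ → ℂ) : ℝ → ℝ → C2 :=
  if h : ∃ n, IsJostN s u n then h.choose else 0

/-- `m_±(x; z) - e₁`. -/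
noncomputable def mDiff (s : Sgn) (u : ℝ → ℂ) : ℝ → ℝ → C2 := fun x z => jostM s u x z - e₁

/-- `n_±(x; z) - e₂`. -/
noncomputable def nDiff (s : Sgn) (u : ℝ → ℂ) : ℝ → ℝ → C2 := fun x z => jostN s u x z - e₂

/-- `q_±(x) = (1/2) ∫_{±∞}^x u(y) conj(w(y)) dy`. -/
noncomputable def q (s : Sgn) (u : ℝ → ℂ) (x : ℝ) : ℂ :=
  (1 / 2) * s.integralTo x (fun y => u y * conj (w u y))

/-- `m_±^{⟨2⟩}(x; z) = 2iz [m_±(x; z) - e₁] + q_±(x) e₁ + conj(w(x)) e₂`. -/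
noncomputable def mTwo (s : Sgn) (u : ℝ → ℂ) : ℝ → ℝ → C2 := fun x z =>
  (2 * Complex.I * z) • (jostM s u x z - e₁) + q s u x • e₁ + conj (w u x) • e₂

/-- `n_±^{⟨2⟩}(x; z) = 2iz [n_±(x; z) - e₂] - w(x) e₁ - conj(q_±(x)) e₂`. -/
noncomputable def nTwo (s : Sgn) (u : ℝ → ℂ) : ℝ → ℝ → C2 := fun x z =>
  (2 * Complex.I * z) • (jostN s u x z - e₂) - w u x • e₁ - conj (q s u x) • e₂

end NLSGI

/-!
After the reflection `x ↦ -x` for the sign `-` and up to the order of the components, each of the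
four Jost functions is a pair `(A, B)` with
`A(x; z) = 1 + ∫_x^∞ a(y) B(y; z) dy`, `B(x; z) = ∫_x^∞ e^{iκ(z+1)(x-y)} b(y) A(y; z) dy`,
where `κ = ±2` and the coefficients are, up to signs, conjugation and the factor `1/2`, the
potential `u` and the function `w`, both in `L^{2,1} ⊆ L¹` (`IsJostPair`, `volterra_m_iff`,
`volterra_n_iff`). The operator of this system is a contraction for a suitable weighted supremum
norm, which gives existence; uniqueness follows from Grönwall's inequality (`exists_isJostPair`,
`volterra_unique`).

All bounds in `z` rest on three facts. Minkowski's integral inequality turns the system into a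
system of scalar inequalities for the `L²_z` norms of `A` and `B` at the point `x`, to which
Grönwall's inequality applies (`eLpNorm_volterra_le`). By Plancherel the inhomogeneous term
`∫_x^∞ e^{iκ(z+1)(x-y)} b(y) dy` has `L²_z` norm at most a constant times the `L²(x, ∞)` norm of
`b`, hence at most `C ⟨x⟩⁻¹` for `b` in `L^{2,1}`. Finally a function in `L²` whose translates by
`t` differ from it by at most `C |t|` has a weak derivative of norm at most `C`
(`exists_isWeakDeriv_of_eLpNorm_translate_le`), so that the `H¹_z` bounds reduce to bounds on the
difference of a solution and its translate in `z`. That difference solves the same system with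
inhomogeneous terms containing `e^{iκh(x-y)} - 1`, which is at most `2|h||y|` in modulus for
`0 ≤ x ≤ y`; the weight of `L^{2,1}`, or the decay `⟨y⟩⁻¹` of `A - 1` and `B`, absorbs the factor
`y`. The same comparison for two pairs of coefficients gives the Lipschitz bounds
(`exists_lipschitz_bound`).

For the second order terms, integration by parts shows that `iκ(z+1)B - bA` is the improper integral
of `e^{iκ(z+1)(x-y)} (b'A - abB)`. Here `b'` is only in `L²`: Plancherel handles `b'` itself, and
`b'(A - 1)` is integrable in `y` with values in `L²_z` because of the decay of `A - 1`. This gives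
`iκzB - b` in `L²_z`, and
`iκz(A - 1) - ∫_x^∞ ab = ∫_x^∞ a (iκzB - b)` follows (`exists_second_bound`).
The Lipschitz dependence of the coefficients on the potential is elementary once `u`, and `u_x` in
the case of `H²`, are replaced by their absolutely continuous representatives, which are bounded
(`exists_coeff`, `exists_smoothCoeff`).
-/

namespace NLSGI

/-! ### Primitives of locally integrable functions -/

section Primitive

variable {E : Type*} [NormedAddCommGroup E]

lemma intervalIntegrable_of_locallyIntegrable {f : ℝ → E} (hf : LocallyIntegrable f volume)
    (x y : ℝ) : IntervalIntegrable f volume x y :=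
  intervalIntegrable_iff.mpr
    ((hf.integrableOn_isCompact isCompact_uIcc).mono_set uIoc_subset_uIcc)

variable [NormedSpace ℝ E]

/-- `f` is, at every point, a primitive of the locally integrable function `f'`; equivalently, `f`
is locally absolutely continuous with derivative `f'` almost everywhere. -/
def IsPrimitive (f f' : ℝ → E) : Prop :=
  LocallyIntegrable f' volume ∧ ∀ x y, ∫ t in x..y, f' t = f y - f x

lemma absolutelyContinuousOnInterval_of_dist_le {X Y : Type*} [PseudoMetricSpace X]
    [PseudoMetricSpace Y] {f : ℝ → X} {g : ℝ → Y} (C : ℝ) {a b : ℝ}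
    (h : ∀ x y : ℝ, dist (f x) (f y) ≤ C * dist (g x) (g y))
    (hg : AbsolutelyContinuousOnInterval g a b) : AbsolutelyContinuousOnInterval f a b := by
  have h0 := Filter.Tendsto.const_mul C hg
  rw [mul_zero] at h0
  refine squeeze_zero (fun _ => Finset.sum_nonneg fun _ _ => dist_nonneg) (fun t => ?_) h0
  rw [Finset.mul_sum]
  exact Finset.sum_le_sum fun i _ => h _ _

lemma IsPrimitive.absolutelyContinuousOnInterval {f f' : ℝ → E} (h : IsPrimitive f f') (a b : ℝ) :
    AbsolutelyContinuousOnInterval f a b := by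
  have hi := intervalIntegrable_of_locallyIntegrable h.1
  refine absolutelyContinuousOnInterval_of_dist_le 1 (fun x y => ?_)
    (((hi a b).norm).absolutelyContinuousOnInterval_intervalIntegral
      (c := a) left_mem_uIcc)
  rw [one_mul, dist_comm, dist_comm (∫ v in a..x, ‖f' v‖), dist_eq_norm, dist_eq_norm, ← h.2 x y,
    intervalIntegral.integral_interval_sub_left (hi a y).norm (hi a x).norm, Real.norm_eq_abs]
  exact intervalIntegral.norm_integral_le_abs_integral_norm

lemma IsPrimitive.eq_add {f f' : ℝ → E} (h : IsPrimitive f f') (a : ℝ) :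
    f = fun x => f a + ∫ t in a..x, f' t := by
  funext x; rw [h.2]; abel

lemma IsPrimitive.continuous {f f' : ℝ → E} (h : IsPrimitive f f') : Continuous f := by
  rw [h.eq_add 0]
  exact continuous_const.add
    (intervalIntegral.continuous_primitive (intervalIntegrable_of_locallyIntegrable h.1) 0)

lemma IsPrimitive.add {f f' g g' : ℝ → E} (hf : IsPrimitive f f') (hg : IsPrimitive g g') :
    IsPrimitive (fun x => f x + g x) (fun x => f' x + g' x) := by
  refine ⟨hf.1.add hg.1, fun x y => ?_⟩
  rw [intervalIntegral.integral_add (intervalIntegrable_of_locallyIntegrable hf.1 _ _)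
    (intervalIntegrable_of_locallyIntegrable hg.1 _ _), hf.2, hg.2,
    add_sub_add_comm]

lemma IsPrimitive.sub {f f' g g' : ℝ → E} (hf : IsPrimitive f f') (hg : IsPrimitive g g') :
    IsPrimitive (fun x => f x - g x) (fun x => f' x - g' x) := by
  refine ⟨hf.1.sub hg.1, fun x y => ?_⟩
  rw [intervalIntegral.integral_sub (intervalIntegrable_of_locallyIntegrable hf.1 _ _)
    (intervalIntegrable_of_locallyIntegrable hg.1 _ _), hf.2, hg.2,
    sub_sub_sub_comm]

variable [CompleteSpace E]

lemma IsPrimitive.ae_hasDerivAt {f f' : ℝ → E} (h : IsPrimitive f f') :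
    ∀ᵐ x, HasDerivAt f (f' x) x := by
  filter_upwards [_root_.LocallyIntegrable.ae_hasDerivAt_integral h.1] with x hx
  rw [h.eq_add 0]
  exact (hx 0).const_add _

lemma IsPrimitive.of_absolutelyContinuousOnInterval {f f' : ℝ → E}
    (hf : ∀ a b, AbsolutelyContinuousOnInterval f a b) (hf' : LocallyIntegrable f' volume)
    (hd : ∀ᵐ x, HasDerivAt f (f' x) x) : IsPrimitive f f' := by
  refine ⟨hf', fun a b => ?_⟩
  have hP : IsPrimitive (fun x => ∫ t in a..x, f' t) f' := by
    refine ⟨hf', fun x y => ?_⟩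
    rw [intervalIntegral.integral_interval_sub_left] <;>
      exact intervalIntegrable_of_locallyIntegrable hf' _ _
  obtain ⟨c, hc⟩ :=
    ((hf a b).sub (hP.absolutelyContinuousOnInterval a b)).const_of_ae_hasDerivAt_zero (by
      filter_upwards [hd, hP.ae_hasDerivAt] with x h1 h2 _
      simpa using h1.sub h2)
  have h1 := hc a left_mem_uIcc
  have h2 := hc b right_mem_uIcc
  simp only [Pi.sub_apply, intervalIntegral.integral_same, sub_zero] at h1 h2
  rw [h1, ← h2]; abel

lemma IsPrimitive.clm_comp {F : Type*} [NormedAddCommGroup F] [NormedSpace ℝ F] [CompleteSpace F]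
    {f f' : ℝ → E} (hf : IsPrimitive f f') (l : E →L[ℝ] F) :
    IsPrimitive (fun x => l (f x)) (fun x => l (f' x)) := by
  refine ⟨fun x => ?_, fun x y => ?_⟩
  · obtain ⟨s, hs, h⟩ := hf.1 x
    exact ⟨s, hs, l.integrable_comp h⟩
  · rw [l.intervalIntegral_comp_comm (intervalIntegrable_of_locallyIntegrable hf.1 _ _), hf.2,
      map_sub]

lemma IsPrimitive.smul {𝕜 : Type*} [RCLike 𝕜] [NormedSpace 𝕜 E]
    {f f' : ℝ → 𝕜} {g g' : ℝ → E} (hf : IsPrimitive f f') (hg : IsPrimitive g g') :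
    IsPrimitive (fun x => f x • g x) (fun x => f x • g' x + f' x • g x) := by
  refine .of_absolutelyContinuousOnInterval (fun a b =>
    (hf.absolutelyContinuousOnInterval a b).smul (hg.absolutelyContinuousOnInterval a b)) ?_ ?_
  · refine LocallyIntegrable.add ?_ ?_
    · rw [locallyIntegrable_iff]
      intro k hk
      exact (hg.1.integrableOn_isCompact hk).continuousOn_smul hf.continuous.continuousOn hk
    · rw [locallyIntegrable_iff]
      intro k hk
      exact (hf.1.integrableOn_isCompact hk).smul_continuousOn hg.continuous.continuousOn hk
  · filter_upwards [hf.ae_hasDerivAt, hg.ae_hasDerivAt] with x h1 h2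
    exact h1.smul h2

lemma IsPrimitive.mul {f f' g g' : ℝ → ℂ} (hf : IsPrimitive f f') (hg : IsPrimitive g g') :
    IsPrimitive (fun x => f x * g x) (fun x => f x * g' x + f' x * g x) := by
  simpa only [smul_eq_mul] using hf.smul hg

lemma IsPrimitive.const_mul {f f' : ℝ → ℂ} (hf : IsPrimitive f f') (c : ℂ) :
    IsPrimitive (fun x => c * f x) (fun x => c * f' x) := by
  have h : IsPrimitive (fun _ : ℝ => c) (fun _ => (0 : ℂ)) :=
    ⟨(continuous_const).locallyIntegrable, by simp⟩
  simpa using h.mul hf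

lemma IsPrimitive.conj {f f' : ℝ → ℂ} (hf : IsPrimitive f f') :
    IsPrimitive (fun x => conj (f x)) (fun x => conj (f' x)) := by
  simpa using hf.clm_comp Complex.conjCLE.toContinuousLinearMap

omit [CompleteSpace E] in
lemma IsPrimitive.comp_mul_left {f f' : ℝ → E} (hf : IsPrimitive f f') {ε : ℝ} (hε : |ε| = 1) :
    IsPrimitive (fun x => f (ε * x)) (fun x => ε • f' (ε * x)) := by
  rcases eq_or_eq_neg_of_abs_eq hε with rfl | rfl
  · simpa using hf
  · refine ⟨?_, fun x y => ?_⟩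
    · have := (locallyIntegrable_map_homeomorph (Homeomorph.neg ℝ) (f := f') (μ := volume)).1
        (by simpa [Measure.map_neg_eq_self] using hf.1)
      have h2 : LocallyIntegrable (fun x => -f' (-x)) volume := this.neg
      simpa only [neg_mul, one_mul, neg_smul, one_smul] using h2
    · simp [hf.2]

lemma IsPrimitive.of_hasDerivAt {f f' : ℝ → E} (h : ∀ x, HasDerivAt f (f' x) x)
    (hc : Continuous f') : IsPrimitive f f' :=
  ⟨hc.locallyIntegrable, fun _ _ =>
    intervalIntegral.integral_eq_sub_of_hasDerivAt (fun t _ => h t) (hc.intervalIntegrable _ _)⟩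

end Primitive

/-! ### Weak derivatives on the line -/

section WeakDerivative

variable {E : Type*} [NormedAddCommGroup E] [NormedSpace ℝ E] [CompleteSpace E]

lemma exists_forall_abs_ge_eq_zero {F : Type*} [Zero F] {φ : ℝ → F} (h : HasCompactSupport φ) :
    ∃ R : ℝ, 0 < R ∧ ∀ x, R ≤ |x| → φ x = 0 := by
  obtain ⟨R, hR, hs⟩ := h.isBounded.subset_closedBall_lt 0 0
  refine ⟨R + 1, by positivity, fun x hx => ?_⟩
  by_contra hne
  have := hs (subset_tsupport _ hne)
  simp only [Metric.mem_closedBall, dist_zero_right, Real.norm_eq_abs] at this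
  linarith

lemma IsPrimitive.isWeakDeriv {f f' : ℝ → E} (h : IsPrimitive f f') : IsWeakDeriv f f' := by
  refine ⟨h.continuous.locallyIntegrable, h.1, fun φ hφ hc => ?_⟩
  have hd : IsPrimitive φ (deriv φ) := .of_hasDerivAt
    (fun x => (hφ.differentiable (by simp) x).hasDerivAt) (hφ.continuous_deriv (by simp))
  have hcd : HasCompactSupport (deriv φ) := hc.deriv
  obtain ⟨R, hR, h1⟩ := exists_forall_abs_ge_eq_zero hc
  obtain ⟨R', hR', h2⟩ := exists_forall_abs_ge_eq_zero hcd
  have i1 : Integrable (fun x => φ x • f' x) volume :=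
    h.1.integrable_smul_left_of_hasCompactSupport hφ.continuous hc
  have i2 : Integrable (fun x => deriv φ x • f x) volume :=
    h.continuous.locallyIntegrable.integrable_smul_left_of_hasCompactSupport
      (hφ.continuous_deriv (by simp)) hcd
  have key := (hd.smul h).2 (-(max R R')) (max R R')
  beta_reduce at key
  have e1 : φ (max R R') = 0 := h1 _ (le_trans (le_max_left _ _) (le_abs_self _))
  have e2 : φ (-(max R R')) = 0 :=
    h1 _ (by rw [abs_neg]; exact le_trans (le_max_left _ _) (le_abs_self _))
  rw [e1, e2, zero_smul, zero_smul, sub_zero,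
    intervalIntegral.integral_eq_integral_of_support_subset, integral_add i1 i2] at key
  · exact eq_neg_of_add_eq_zero_right key
  · intro x hx
    by_contra hn
    apply hx
    have hx' : max R R' ≤ |x| := by
      rw [mem_Ioc, not_and_or, not_lt, not_le] at hn
      rcases hn with hn | hn
      · exact le_trans (by linarith) (neg_le_abs x)
      · exact hn.le.trans (le_abs_self x)
    simp [h1 x ((le_max_left _ _).trans hx'), h2 x ((le_max_right _ _).trans hx')]

/-- A test function of integral zero is the derivative of a test function. -/
lemma exists_testFunction_deriv_eq {η : ℝ → ℝ} (hη : ContDiff ℝ ∞ η) (hc : HasCompactSupport η)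
    (h0 : ∫ x, η x = 0) :
    ∃ ψ : ℝ → ℝ, ContDiff ℝ ∞ ψ ∧ HasCompactSupport ψ ∧ deriv ψ = η := by
  obtain ⟨R, hR, h1⟩ := exists_forall_abs_ge_eq_zero hc
  have hd : ∀ x, HasDerivAt (fun x => ∫ t in (-R)..x, η t) (η x) x := fun x =>
    intervalIntegral.integral_hasDerivAt_right (hη.continuous.intervalIntegrable _ _)
      (hη.continuous.stronglyMeasurableAtFilter _ _) hη.continuous.continuousAt
  have hder : deriv (fun x => ∫ t in (-R)..x, η t) = η := funext fun x => (hd x).deriv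
  refine ⟨fun x => ∫ t in (-R)..x, η t, ?_, ?_, hder⟩
  · rw [contDiff_infty_iff_deriv, hder]
    exact ⟨fun x => (hd x).differentiableAt, hη⟩
  · refine HasCompactSupport.of_support_subset_isCompact (isCompact_Icc (a := -R) (b := R)) ?_
    intro x hx
    by_contra hn
    apply hx
    rw [mem_Icc, not_and_or, not_le, not_le] at hn
    rcases hn with hn | hn
    · refine (intervalIntegral.integral_congr fun t ht => ?_).trans
        intervalIntegral.integral_zero
      rw [uIcc_of_ge hn.le] at ht
      exact h1 t (le_trans (by linarith [ht.2]) (neg_le_abs t))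
    · change ∫ t in (-R)..x, η t = 0
      rw [intervalIntegral.integral_eq_integral_of_support_subset, h0]
      intro t ht
      by_contra hn'
      apply ht
      rw [mem_Ioc, not_and_or, not_lt, not_le] at hn'
      rcases hn' with hn' | hn'
      · exact h1 t (le_trans (by linarith) (neg_le_abs t))
      · exact h1 t ((hn.trans hn').le.trans (le_abs_self t))

/-- A locally integrable function whose weak derivative vanishes is almost everywhere constant. -/
lemma ae_eq_const_of_integral_deriv_smul {d : ℝ → E} (hd : LocallyIntegrable d volume)
    (h : ∀ φ : ℝ → ℝ, ContDiff ℝ ∞ φ → HasCompactSupport φ → ∫ x, deriv φ x • d x = 0) :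
    ∃ c : E, d =ᵐ[volume] fun _ => c := by
  let β : ContDiffBump (0 : ℝ) := ⟨1, 2, one_pos, one_lt_two⟩
  let ρ : ℝ → ℝ := β.normed volume
  have hρ : ContDiff ℝ ∞ ρ := β.contDiff_normed
  have hρc : HasCompactSupport ρ := β.hasCompactSupport_normed
  have hρ1 : ∫ x, ρ x = 1 := β.integral_normed
  refine ⟨∫ x, ρ x • d x, ?_⟩
  have hconst : LocallyIntegrable (fun _ : ℝ => ∫ x, ρ x • d x) volume :=
    continuous_const.locallyIntegrable
  refine ae_eq_of_integral_contDiff_smul_eq hd hconst fun φ hφ hφc => ?_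
  have hρi : Integrable (fun x => ρ x • d x) volume :=
    hd.integrable_smul_left_of_hasCompactSupport hρ.continuous hρc
  have hφi : Integrable (fun x => φ x • d x) volume :=
    hd.integrable_smul_left_of_hasCompactSupport hφ.continuous hφc
  -- `φ - (∫ φ) ρ` has integral zero, hence is the derivative of a test function
  obtain ⟨ψ, hψ, hψc, hψd⟩ := exists_testFunction_deriv_eq
    (η := fun x => φ x - (∫ y, φ y) * ρ x) (hφ.sub (contDiff_const.mul hρ))
    (by exact hφc.sub (hρc.mul_left (f := fun _ => ∫ y, φ y))) (by
      rw [integral_sub (hφ.continuous.integrable_of_hasCompactSupport hφc)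
        ((hρ.continuous.integrable_of_hasCompactSupport hρc).const_mul _), integral_const_mul, hρ1]
      simp)
  have key := h ψ hψ hψc
  rw [hψd] at key
  simp only [sub_smul, mul_smul] at key
  rw [integral_sub hφi (hρi.fun_smul _), integral_smul, sub_eq_zero] at key
  rw [key, integral_smul_const]

/-- One-dimensional functions with a weak derivative are almost everywhere equal to a primitive of
it. -/
lemma IsWeakDeriv.exists_isPrimitive {f g : ℝ → E} (h : IsWeakDeriv f g) :
    ∃ F, IsPrimitive F g ∧ f =ᵐ[volume] F := by
  have hi := intervalIntegrable_of_locallyIntegrable h.2.1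
  have hP : IsPrimitive (fun x => ∫ t in (0 : ℝ)..x, g t) g := by
    refine ⟨h.2.1, fun x y => ?_⟩
    rw [intervalIntegral.integral_interval_sub_left] <;> exact hi _ _
  have hl := hP.continuous.locallyIntegrable (μ := volume)
  obtain ⟨c, hc⟩ := ae_eq_const_of_integral_deriv_smul (h.1.sub hl)
    (fun φ hφ hφc => by
      have hcont := hφ.continuous_deriv (n := ∞) (by simp)
      simp only [Pi.sub_apply, smul_sub]
      rw [integral_sub (h.1.integrable_smul_left_of_hasCompactSupport hcont hφc.deriv)
        (hl.integrable_smul_left_of_hasCompactSupport hcont hφc.deriv), h.2.2 φ hφ hφc,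
        hP.isWeakDeriv.2.2 φ hφ hφc, sub_self])
  refine ⟨fun x => c + ∫ t in (0 : ℝ)..x, g t, ⟨h.2.1, fun x y => ?_⟩, ?_⟩
  · rw [hP.2, add_sub_add_left_eq_sub]
  · filter_upwards [hc] with x hx
    rw [← hx]; simp

omit [CompleteSpace E] in
lemma IsWeakDeriv.congr {f f₁ g g₁ : ℝ → E} (h : IsWeakDeriv f g) (hf : f =ᵐ[volume] f₁)
    (hg : g =ᵐ[volume] g₁) : IsWeakDeriv f₁ g₁ := by
  refine ⟨h.1.congr hf, h.2.1.congr hg, fun φ hφ hc => ?_⟩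
  have h1 : ∫ x, deriv φ x • f₁ x = ∫ x, deriv φ x • f x :=
    integral_congr_ae (by filter_upwards [hf] with x hx; rw [hx])
  have h2 : ∫ x, φ x • g₁ x = ∫ x, φ x • g x :=
    integral_congr_ae (by filter_upwards [hg] with x hx; rw [hx])
  rw [h1, h2, h.2.2 φ hφ hc]

omit [CompleteSpace E] in
lemma HasWeakDeriv.isWeakDeriv {f : ℝ → E} (h : HasWeakDeriv f) :
    IsWeakDeriv f (weakDeriv f) := by
  rw [weakDeriv, dif_pos h]; exact h.choose_spec

lemma IsWeakDeriv.ae_eq {f g g' : ℝ → E} (h : IsWeakDeriv f g) (h' : IsWeakDeriv f g') :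
    g =ᵐ[volume] g' :=
  ae_eq_of_integral_contDiff_smul_eq h.2.1 h'.2.1 fun φ hφ hc => by
    rw [← neg_inj, ← h.2.2 φ hφ hc, h'.2.2 φ hφ hc]

lemma IsWeakDeriv.weakDeriv_ae_eq {f g : ℝ → E} (h : IsWeakDeriv f g) :
    weakDeriv f =ᵐ[volume] g :=
  (HasWeakDeriv.isWeakDeriv ⟨g, h⟩).ae_eq h

end WeakDerivative

/-! ### Difference quotients and weak derivatives -/

section DifferenceQuotient

open SchwartzMap Filter Topology

variable {E : Type*} [NormedAddCommGroup E] [InnerProductSpace ℂ E]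

lemma integrable_inner_of_memLp_two {u v : ℝ → E} (hu : MemLp u 2 volume) (hv : MemLp v 2 volume) :
    Integrable (fun x => inner ℂ (u x) (v x)) volume := by
  have := L2.integrable_inner (𝕜 := ℂ) (hu.toLp u) (hv.toLp v)
  refine this.congr ?_
  filter_upwards [hu.coeFn_toLp, hv.coeFn_toLp] with x h1 h2
  rw [h1, h2]

lemma integral_inner_eq_inner_toLp {u v : ℝ → E} (hu : MemLp u 2 volume)
    (hv : MemLp v 2 volume) :
    ∫ x, inner ℂ (u x) (v x) = inner ℂ (hu.toLp u) (hv.toLp v) := by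
  rw [L2.inner_def]
  refine integral_congr_ae ?_
  filter_upwards [hu.coeFn_toLp, hv.coeFn_toLp] with x h1 h2
  rw [h1, h2]

lemma norm_integral_inner_le {u v : ℝ → E} (hu : MemLp u 2 volume) (hv : MemLp v 2 volume) :
    ‖∫ x, inner ℂ (u x) (v x)‖ ≤ (eLpNorm u 2 volume).toReal * (eLpNorm v 2 volume).toReal := by
  rw [integral_inner_eq_inner_toLp hu hv, ← Lp.norm_toLp u hu, ← Lp.norm_toLp v hv]
  exact norm_inner_le_norm _ _

lemma memLp_inv_one_add_abs : MemLp (fun x : ℝ => (1 + |x|)⁻¹) 2 volume := by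
  have hc : Continuous fun x : ℝ => (1 + |x|)⁻¹ :=
    (continuous_const.add continuous_abs).inv₀ fun x => (by positivity : 0 < 1 + |x|).ne'
  rw [memLp_two_iff_integrable_sq hc.aestronglyMeasurable]
  have := integrable_one_add_norm (E := ℝ) (μ := volume) (r := 2) (by simp)
  refine this.congr (.of_forall fun x => ?_)
  have h0 : 0 < 1 + |x| := by positivity
  simp only [Real.norm_eq_abs]
  rw [Real.rpow_neg h0.le, inv_pow]
  norm_cast

/-- The difference quotients of a Schwartz function are dominated by a fixed function in `L²`. -/
lemma schwartz_norm_add_sub_le (φ : 𝓢(ℝ, E)) :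
    ∃ K : ℝ, ∀ x t : ℝ, |t| ≤ 1 → ‖φ (x + t) - φ x‖ ≤ |t| * (K * (1 + |x|)⁻¹) := by
  set K := 2 ^ 1 * ((Finset.Iic (1, 1)).sup fun m => SchwartzMap.seminorm ℂ m.1 m.2) φ
  refine ⟨2 * K, fun x t ht => ?_⟩
  have hd : ∀ s, ‖deriv φ s‖ ≤ K * (1 + |s|)⁻¹ := fun s => by
    have := SchwartzMap.one_add_le_sup_seminorm_apply (𝕜 := ℂ) (m := (1, 1)) (k := 1) (n := 1)
      le_rfl le_rfl φ s
    rw [norm_iteratedFDeriv_eq_norm_iteratedDeriv, iteratedDeriv_one, pow_one, Real.norm_eq_abs,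
      mul_comm] at this
    rw [← div_eq_mul_inv, le_div_iff₀ (by positivity)]
    exact this
  have hK : 0 ≤ K := by
    have := (norm_nonneg _).trans (hd 0)
    simpa using this
  have := (convex_uIcc x (x + t)).norm_image_sub_le_of_norm_deriv_le (f := φ)
    (C := 2 * K * (1 + |x|)⁻¹) (fun s _ => φ.differentiableAt) (fun s hs => ?_)
    left_mem_uIcc right_mem_uIcc
  · rw [add_sub_cancel_left, Real.norm_eq_abs] at this
    linarith
  · refine (hd s).trans ?_
    have h1 : |x| ≤ |s| + 1 := by
      have h2 : |s - x| ≤ |t| := by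
        have := abs_sub_left_of_mem_uIcc hs
        simpa using this
      have := abs_sub_abs_le_abs_sub x s
      rw [abs_sub_comm] at this
      linarith
    have h3 : (1 + |s|)⁻¹ ≤ 2 * (1 + |x|)⁻¹ := by
      rw [← div_eq_mul_inv, inv_eq_one_div, div_le_div_iff₀ (by positivity) (by positivity)]
      linarith [abs_nonneg s]
    calc K * (1 + |s|)⁻¹ ≤ K * (2 * (1 + |x|)⁻¹) := mul_le_mul_of_nonneg_left h3 hK
      _ = 2 * K * (1 + |x|)⁻¹ := by ring

lemma norm_integral_inner_deriv_le {f : ℝ → E} (hf : MemLp f 2 volume) (C : ℝ≥0)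
    (h : ∀ t, eLpNorm (fun x => f (x + t) - f x) 2 volume ≤ C * ‖t‖ₑ) (φ : 𝓢(ℝ, E)) :
    ‖∫ x, inner ℂ (f x) (deriv φ x)‖ ≤ C * (eLpNorm φ 2 volume).toReal := by
  obtain ⟨K, hK⟩ := schwartz_norm_add_sub_le φ
  have hφ : MemLp φ 2 volume := φ.memLp 2
  let t : ℕ → ℝ := fun n => 1 / ((n : ℝ) + 1)
  have ht0 : ∀ n, 0 < t n := fun n => by positivity
  have ht1 : ∀ n, |t n| ≤ 1 := fun n => by
    rw [abs_of_pos (ht0 n)]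
    exact (div_le_one (by positivity)).2 (by linarith [(Nat.cast_nonneg n : (0 : ℝ) ≤ n)])
  have hlim : Tendsto t atTop (𝓝 0) := tendsto_one_div_add_atTop_nhds_zero_nat
  have hlim' : Tendsto t atTop (𝓝[≠] 0) :=
    tendsto_nhdsWithin_iff.2 ⟨hlim, .of_forall fun n => (ht0 n).ne'⟩
  have htr : ∀ (g : ℝ → E) (s : ℝ), MemLp g 2 volume → MemLp (fun x => g (x + s)) 2 volume :=
    fun g s hg => hg.comp_measurePreserving (measurePreserving_add_right volume s)
  have hconv : Tendsto (fun n => ∫ x, inner ℂ (f x) ((t n)⁻¹ • (φ (x + t n) - φ x))) atTop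
      (𝓝 (∫ x, inner ℂ (f x) (deriv φ x))) := by
    refine tendsto_integral_of_dominated_convergence (fun x => ‖f x‖ * (K * (1 + |x|)⁻¹))
      (fun n => ?_) ?_ (fun n => ?_) ?_
    · exact hf.1.inner ((((htr φ (t n) hφ).1).sub hφ.1).const_smul _)
    · exact hf.norm.integrable_mul (memLp_inv_one_add_abs.const_mul K)
    · filter_upwards with x
      refine (norm_inner_le_norm _ _).trans (mul_le_mul_of_nonneg_left ?_ (norm_nonneg _))
      rw [norm_smul, norm_inv, Real.norm_eq_abs, inv_mul_le_iff₀ (abs_pos.2 (ht0 n).ne')]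
      exact hK x _ (ht1 n)
    · filter_upwards with x
      refine Filter.Tendsto.inner tendsto_const_nhds ?_
      exact (hasDerivAt_iff_tendsto_slope_zero.1 (φ.differentiableAt (x := x)).hasDerivAt).comp
        hlim'
  -- the difference quotient is moved from `φ` to `f` by translation invariance
  refine le_of_tendsto hconv.norm (.of_forall fun n => ?_)
  have hsh := htr f (-t n) hf
  have e1 : ∫ x, inner ℂ (f x) ((t n)⁻¹ • (φ (x + t n) - φ x)) =
      (t n)⁻¹ • ∫ x, inner ℂ (f (x + -t n) - f x) (φ x) := by
    have h1 : ∫ x, inner ℂ (f (x + -t n)) (φ x) = ∫ x, inner ℂ (f x) (φ (x + t n)) := by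
      rw [← integral_add_right_eq_self _ (t n)]
      simp
    simp_rw [inner_sub_left]
    rw [integral_sub (integrable_inner_of_memLp_two hsh hφ) (integrable_inner_of_memLp_two hf hφ),
      h1, ← integral_sub (integrable_inner_of_memLp_two hf (htr φ (t n) hφ))
        (integrable_inner_of_memLp_two hf hφ), ← integral_smul]
    simp_rw [← inner_sub_right, inner_smul_right_eq_smul]
  rw [e1, norm_smul, norm_inv, Real.norm_eq_abs, abs_of_pos (ht0 n),
    inv_mul_le_iff₀ (ht0 n)]
  refine (norm_integral_inner_le (hsh.sub hf) hφ).trans ?_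
  rw [← mul_assoc]
  refine mul_le_mul_of_nonneg_right ?_ ENNReal.toReal_nonneg
  have := ENNReal.toReal_mono (by finiteness) (h (-t n))
  rw [enorm_neg, ENNReal.toReal_mul, toReal_enorm, Real.norm_eq_abs, abs_of_pos (ht0 n),
    ENNReal.coe_toReal] at this
  rw [mul_comm (t n)]
  exact this

/-- A square integrable function whose translations are Lipschitz in `L²` has a weak derivative in
`L²`, with the Lipschitz constant as a bound for its norm. -/
theorem exists_isWeakDeriv_of_eLpNorm_translate_le [CompleteSpace E] [SecondCountableTopology E]
    {f : ℝ → E} (hf : MemLp f 2 volume) (C : ℝ≥0)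
    (h : ∀ t, eLpNorm (fun x => f (x + t) - f x) 2 volume ≤ C * ‖t‖ₑ) :
    ∃ g, IsWeakDeriv f g ∧ eLpNorm g 2 volume ≤ C := by
  -- Riesz representation of the functional `φ ↦ ∫ ⟪f, φ'⟫` on `L²`
  let e : 𝓢(ℝ, E) →ₗ[ℂ] Lp E 2 (volume : Measure ℝ) := (toLpCLM ℂ E 2 volume).toLinearMap
  let l : 𝓢(ℝ, E) →ₗ[ℂ] ℂ :=
    (innerSL ℂ (hf.toLp f)).toLinearMap ∘ₗ e ∘ₗ (derivCLM ℂ E).toLinearMap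
  have he : ∀ φ : 𝓢(ℝ, E), e φ = (φ.memLp 2).toLp φ := fun φ => rfl
  have hl : ∀ φ : 𝓢(ℝ, E), l φ = ∫ x, inner ℂ (f x) (deriv φ x) := fun φ => by
    have : l φ = inner ℂ (hf.toLp f) (((derivCLM ℂ E φ).memLp 2).toLp _) := rfl
    rw [this, ← integral_inner_eq_inner_toLp]
    rfl
  have hdense : DenseRange e := SchwartzMap.denseRange_toLpCLM (F := E) (p := 2) (by simp)
  have hbd : ∀ φ, ‖l φ‖ ≤ C * ‖e φ‖ := fun φ => by
    rw [hl, he, Lp.norm_toLp]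
    exact norm_integral_inner_deriv_le hf C h φ
  let L : Lp E 2 (volume : Measure ℝ) →L[ℂ] ℂ := l.extendOfNorm e
  have hL : ∀ φ, L (e φ) = l φ := LinearMap.extendOfNorm_eq hdense ⟨C, hbd⟩
  have hLn : ‖L‖ ≤ C := by
    refine L.opNorm_le_bound C.2 fun u => ?_
    refine hdense.induction_on (p := fun u => ‖L u‖ ≤ C * ‖u‖) u
      (isClosed_le L.continuous.norm (continuous_const.mul continuous_norm)) fun φ => ?_
    rw [hL]; exact hbd φ
  let g := (InnerProductSpace.toDual ℂ (Lp E 2 (volume : Measure ℝ))).symm L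
  have hg : MemLp (-(g : ℝ → E)) 2 volume := (Lp.memLp g).neg
  refine ⟨-(g : ℝ → E), ⟨hf.locallyIntegrable one_le_two, hg.locallyIntegrable one_le_two,
    fun φ hφ hc => ?_⟩, ?_⟩
  · have hc1 : MemLp φ 2 volume := hφ.continuous.memLp_of_hasCompactSupport hc
    have hc2 : MemLp (deriv φ) 2 volume :=
      (hφ.continuous_deriv (by simp)).memLp_of_hasCompactSupport hc.deriv
    have i1 : Integrable (fun x => φ x • (g : ℝ → E) x) volume :=
      (Lp.memLp g).locallyIntegrable one_le_two |>.integrable_smul_left_of_hasCompactSupport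
        hφ.continuous hc
    have i2 : Integrable (fun x => deriv φ x • f x) volume :=
      (hf.locallyIntegrable one_le_two).integrable_smul_left_of_hasCompactSupport
        (hφ.continuous_deriv (by simp)) hc.deriv
    simp only [Pi.neg_apply, smul_neg, integral_neg, neg_neg]
    refine ext_inner_left ℂ fun v => ?_
    have hs : HasCompactSupport fun x => φ x • v := hc.smul_right
    let Φ : 𝓢(ℝ, E) := hs.toSchwartzMap (hφ.smul contDiff_const)
    have hΦ : ∀ x, Φ x = φ x • v := fun x => rfl
    have hΦd : ∀ x, deriv Φ x = deriv φ x • v := fun x =>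
      (((hφ.differentiable (by simp) x).hasDerivAt.smul_const v)).deriv
    have k1 : L (e Φ) = inner ℂ g (e Φ) := by
      rw [InnerProductSpace.toDual_symm_apply]
    rw [hL, hl, he, L2.inner_def] at k1
    have k2 : ∫ x, inner ℂ (f x) (deriv Φ x) = conj (inner ℂ v (∫ x, deriv φ x • f x)) := by
      rw [← integral_inner i2, ← integral_conj]
      refine integral_congr_ae (.of_forall fun x => ?_)
      simp only [hΦd, inner_smul_right_eq_smul, Complex.real_smul, map_mul, Complex.conj_ofReal,
        inner_conj_symm]
    have k3 : ∫ x, inner ℂ ((g : ℝ → E) x) (((Φ.memLp 2).toLp Φ : ℝ → E) x) =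
        conj (inner ℂ v (∫ x, φ x • (g : ℝ → E) x)) := by
      rw [← integral_inner i1, ← integral_conj]
      refine integral_congr_ae ?_
      filter_upwards [(Φ.memLp 2 (volume : Measure ℝ)).coeFn_toLp] with x hx
      simp only [hx, hΦ, inner_smul_right_eq_smul, Complex.real_smul, map_mul, Complex.conj_ofReal,
        inner_conj_symm]
    rw [k2, k3] at k1
    exact (starRingEnd ℂ).injective k1
  · rw [eLpNorm_neg, ← Lp.enorm_def, ← ofReal_norm, LinearIsometryEquiv.norm_map]
    exact (ENNReal.ofReal_le_ofReal hLn).trans (by simp)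

end DifferenceQuotient

/-! ### Minkowski's inequality and Plancherel's theorem -/

section L2

lemma eLpNorm_two_eq {α F : Type*} [MeasurableSpace α] [NormedAddCommGroup F] (f : α → F)
    (μ : Measure α) : eLpNorm f 2 μ = (∫⁻ x, ‖f x‖ₑ ^ 2 ∂μ) ^ (1 / 2 : ℝ) := by
  rw [eLpNorm_eq_lintegral_rpow_enorm_toReal (by simp) (by simp)]
  simp

lemma lintegral_mul_le_sqrt {α : Type*} [MeasurableSpace α] {μ : Measure α} {f g : α → ℝ≥0∞}
    (hf : AEMeasurable f μ) (hg : AEMeasurable g μ) :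
    ∫⁻ x, f x * g x ∂μ ≤
      (∫⁻ x, f x ^ 2 ∂μ) ^ (1 / 2 : ℝ) * (∫⁻ x, g x ^ 2 ∂μ) ^ (1 / 2 : ℝ) := by
  have := ENNReal.lintegral_mul_le_Lp_mul_Lq μ Real.HolderConjugate.two_two hf hg
  simpa using this

/-- Minkowski's integral inequality in `L²`. -/
lemma eLpNorm_integral_le {μ ν : Measure ℝ} [SFinite μ] [SFinite ν] {F : Type*}
    [NormedAddCommGroup F] [NormedSpace ℝ F] {f : ℝ → ℝ → F}
    (hf : StronglyMeasurable (Function.uncurry f)) :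
    eLpNorm (fun z => ∫ y, f y z ∂ν) 2 μ ≤ ∫⁻ y, eLpNorm (f y) 2 μ ∂ν := by
  have hm : Measurable (Function.uncurry fun y z => ‖f y z‖ₑ) := hf.enorm
  have hy : ∀ y, Measurable fun z => ‖f y z‖ₑ := fun y => hm.comp measurable_prodMk_left
  have hz : ∀ z, Measurable fun y => ‖f y z‖ₑ := fun z => hm.comp measurable_prodMk_right
  simp_rw [eLpNorm_two_eq]
  set n : ℝ → ℝ≥0∞ := fun y => (∫⁻ z, ‖f y z‖ₑ ^ 2 ∂μ) ^ (1 / 2 : ℝ) with hn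
  have key : ∫⁻ z, ‖∫ y, f y z ∂ν‖ₑ ^ 2 ∂μ ≤ (∫⁻ y, n y ∂ν) ^ 2 := by
    calc ∫⁻ z, ‖∫ y, f y z ∂ν‖ₑ ^ 2 ∂μ
        ≤ ∫⁻ z, (∫⁻ y, ‖f y z‖ₑ ∂ν) * (∫⁻ y, ‖f y z‖ₑ ∂ν) ∂μ := by
          refine lintegral_mono fun z => ?_
          rw [sq]
          gcongr <;> exact enorm_integral_le_lintegral_enorm _
      _ = ∫⁻ z, ∫⁻ y, ∫⁻ y', ‖f y z‖ₑ * ‖f y' z‖ₑ ∂ν ∂ν ∂μ := by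
          refine lintegral_congr fun z => ?_
          rw [← lintegral_mul_const _ (hz z)]
          refine lintegral_congr fun y => ?_
          rw [← lintegral_const_mul _ (hz z)]
      _ = ∫⁻ y, ∫⁻ z, ∫⁻ y', ‖f y z‖ₑ * ‖f y' z‖ₑ ∂ν ∂μ ∂ν := by
          refine lintegral_lintegral_swap (Measurable.aemeasurable ?_)
          refine Measurable.lintegral_prod_right'
            (f := fun q : (ℝ × ℝ) × ℝ => ‖f q.1.2 q.1.1‖ₑ * ‖f q.2 q.1.1‖ₑ) ?_
          exact (hm.comp (measurable_fst.snd.prodMk measurable_fst.fst)).mul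
            (hm.comp (measurable_snd.prodMk measurable_fst.fst))
      _ = ∫⁻ y, ∫⁻ y', ∫⁻ z, ‖f y z‖ₑ * ‖f y' z‖ₑ ∂μ ∂ν ∂ν := by
          refine lintegral_congr fun y => lintegral_lintegral_swap (Measurable.aemeasurable ?_)
          exact ((hy y).comp measurable_fst).mul (hm.comp measurable_swap)
      _ ≤ ∫⁻ y, ∫⁻ y', n y * n y' ∂ν ∂ν := by
          gcongr with y y'
          exact lintegral_mul_le_sqrt (hy y).aemeasurable (hy y').aemeasurable
      _ = (∫⁻ y, n y ∂ν) ^ 2 := by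
          have hnm : Measurable n :=
            (Measurable.lintegral_prod_right' (f := fun q : ℝ × ℝ => ‖f q.1 q.2‖ₑ ^ 2)
              (hm.pow_const 2)).pow_const _
          simp_rw [lintegral_const_mul _ hnm]
          rw [lintegral_mul_const _ hnm, sq]
  refine (ENNReal.rpow_le_rpow key (by norm_num)).trans ?_
  rw [← ENNReal.rpow_natCast, ← ENNReal.rpow_mul]
  norm_num

open FourierTransform in
/-- Plancherel's theorem for functions in `L¹ ∩ L²`. -/
theorem eLpNorm_fourier_eq {c : ℝ → ℂ} (h1 : Integrable c volume) (h2 : MemLp c 2 volume) :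
    eLpNorm (𝓕 c) 2 volume = eLpNorm c 2 volume := by
  have hae : ((𝓕 (h2.toLp c) : Lp ℂ 2 (volume : Measure ℝ)) : ℝ → ℂ) =ᵐ[volume] 𝓕 c := by
    have hcont : Continuous (𝓕 c) :=
      VectorFourier.fourierIntegral_continuous Real.continuous_fourierChar
        (by fun_prop) h1
    refine ae_eq_of_integral_contDiff_smul_eq
      ((Lp.memLp _).locallyIntegrable one_le_two) hcont.locallyIntegrable fun φ hφ hc => ?_
    have hs : HasCompactSupport (Complex.ofRealCLM ∘ φ) := hc.comp_left rfl
    let Φ : SchwartzMap ℝ ℂ := hs.toSchwartzMap (by fun_prop)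
    have hΦ : ∀ x, Φ x = (φ x : ℂ) := fun x => rfl
    have k := congrArg (fun T => T Φ) (Lp.fourier_toTemperedDistribution_eq (h2.toLp c))
    simp only [TemperedDistribution.fourier_apply, Lp.toTemperedDistribution_apply] at k
    have e1 : ∫ x, (𝓕 Φ : SchwartzMap ℝ ℂ) x • (h2.toLp c : ℝ → ℂ) x = ∫ x, Φ x • 𝓕 c x := by
      have := VectorFourier.integral_fourierIntegral_smul_eq_flip (μ := volume) (ν := volume)
        (L := innerₗ ℝ) (f := Φ) (g := c) Real.continuous_fourierChar
        (by fun_prop) Φ.integrable h1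
      rw [flip_innerₗ] at this
      refine Eq.trans ?_ this
      refine integral_congr_ae ?_
      filter_upwards [h2.coeFn_toLp] with x hx
      rw [hx, SchwartzMap.fourier_coe]; rfl
    rw [e1] at k
    simpa [hΦ] using k.symm
  rw [← eLpNorm_congr_ae hae, ← Lp.enorm_def, ← ofReal_norm, Lp.norm_fourier_eq, ofReal_norm,
    Lp.enorm_def, eLpNorm_congr_ae h2.coeFn_toLp]

/-- The oscillating factor `e^{iκ(z+1)t}`; the Jost functions involve `κ = 2` and `κ = -2`. -/
noncomputable def phase (κ z t : ℝ) : ℂ := Complex.exp ((κ * (z + 1) * t : ℝ) * Complex.I)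

lemma norm_phase (κ z t : ℝ) : ‖phase κ z t‖ = 1 := Complex.norm_exp_ofReal_mul_I _

lemma continuous_phase (κ : ℝ) : Continuous fun p : ℝ × ℝ => phase κ p.1 p.2 := by
  unfold phase; fun_prop

lemma phase_add (κ z s t : ℝ) : phase κ z (s + t) = phase κ z s * phase κ z t := by
  rw [phase, phase, phase, ← Complex.exp_add]; push_cast; ring_nf

lemma sqrt_pi_le_two : ENNReal.ofReal Real.pi ^ (1 / 2 : ℝ) ≤ 2 := by
  have h : ENNReal.ofReal Real.pi ≤ 2 ^ 2 := by
    rw [ENNReal.ofReal_le_iff_le_toReal (by simp)]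
    simpa using by linarith [Real.pi_le_four]
  refine (ENNReal.rpow_le_rpow h (by norm_num)).trans ?_
  rw [← ENNReal.rpow_natCast, ← ENNReal.rpow_mul]
  norm_num

/-- Plancherel's theorem for the oscillatory integrals of the Volterra equations, as functions of
the spectral parameter `z`. -/
lemma eLpNorm_integral_phase_le {κ : ℝ} (hκ : |κ| = 2) (x : ℝ) {c : ℝ → ℂ}
    (h1 : Integrable c volume) (h2 : MemLp c 2 volume) :
    eLpNorm (fun z => ∫ y, phase κ z (x - y) * c y) 2 volume ≤ 2 * eLpNorm c 2 volume := by
  have hκ0 : κ ≠ 0 := by rintro rfl; simp at hκ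
  set a := κ / (2 * Real.pi) with ha
  have ha0 : a ≠ 0 := div_ne_zero hκ0 (by positivity)
  have hcont : Continuous (FourierTransform.fourier c) :=
      VectorFourier.fourierIntegral_continuous Real.continuous_fourierChar
        (by fun_prop) h1
  have e : ∀ z, ‖∫ y, phase κ z (x - y) * c y‖ = ‖FourierTransform.fourier c (a * (z + 1))‖ := by
    intro z
    have : ∫ y, phase κ z (x - y) * c y =
        phase κ z x * FourierTransform.fourier c (a * (z + 1)) := by
      rw [Real.fourier_real_eq_integral_exp_smul, ← integral_const_mul]
      congr 1; funext y
      rw [sub_eq_add_neg, phase_add, mul_assoc, smul_eq_mul, phase, phase]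
      congr 4
      rw [ha]; field_simp
    rw [this, norm_mul, norm_phase, one_mul]
  rw [eLpNorm_congr_norm_ae (g := fun z => FourierTransform.fourier c (a * (z + 1)))
    (.of_forall e)]
  have e2 : eLpNorm (fun z => FourierTransform.fourier c (a * (z + 1))) 2 volume =
      eLpNorm (fun z => FourierTransform.fourier c (a * z)) 2 volume :=
    eLpNorm_comp_measurePreserving (g := fun z => FourierTransform.fourier c (a * z))
      (hcont.comp (continuous_const.mul continuous_id)).aestronglyMeasurable
      (measurePreserving_add_right volume (1 : ℝ))
  rw [e2]
  have e3 : eLpNorm (FourierTransform.fourier c) 2 (Measure.map (a * ·) volume) =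
      eLpNorm (fun z => FourierTransform.fourier c (a * z)) 2 volume :=
    eLpNorm_map_measure hcont.aestronglyMeasurable (measurable_const_mul a).aemeasurable
  rw [← e3, Real.map_volume_mul_left ha0, eLpNorm_smul_measure_of_ne_top (by simp),
    eLpNorm_fourier_eq h1 h2, smul_eq_mul]
  gcongr
  have : |a⁻¹| = Real.pi := by
    rw [ha, inv_div, abs_div, hκ, abs_of_pos (by positivity)]; ring
  rw [this]
  simpa using sqrt_pi_le_two

end L2

/-! ### The weighted space -/

section Weighted

variable {F : Type*} [NormedAddCommGroup F] [NormedSpace ℝ F]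

/-- The inverse weight `⟨x⟩⁻¹ = (1 + x²)^{-1/2}`, as an extended nonnegative real. -/
noncomputable def invWeight (x : ℝ) : ℝ≥0∞ := ENNReal.ofReal (Real.sqrt (1 + x ^ 2))⁻¹

lemma sqrt_one_add_sq_pos (x : ℝ) : 0 < Real.sqrt (1 + x ^ 2) := Real.sqrt_pos.2 (by positivity)

lemma one_le_sqrt_one_add_sq (x : ℝ) : 1 ≤ Real.sqrt (1 + x ^ 2) :=
  Real.one_le_sqrt.2 (by nlinarith [sq_nonneg x])

lemma abs_le_sqrt_one_add_sq (x : ℝ) : |x| ≤ Real.sqrt (1 + x ^ 2) :=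
  Real.abs_le_sqrt (by linarith)

lemma continuous_sqrt_one_add_sq : Continuous fun x : ℝ => Real.sqrt (1 + x ^ 2) := by fun_prop

lemma measurable_invWeight : Measurable invWeight :=
  (continuous_sqrt_one_add_sq.inv₀ fun x => (sqrt_one_add_sq_pos x).ne').measurable.ennreal_ofReal

lemma invWeight_le_one (x : ℝ) : invWeight x ≤ 1 := by
  rw [invWeight, ENNReal.ofReal_le_one]
  exact inv_le_one_of_one_le₀ (one_le_sqrt_one_add_sq x)

lemma invWeight_anti {x y : ℝ} (hx : 0 ≤ x) (hxy : x ≤ y) : invWeight y ≤ invWeight x := by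
  unfold invWeight
  have := sqrt_one_add_sq_pos x
  gcongr

lemma enorm_mul_invWeight_le_one (x : ℝ) : ‖x‖ₑ * invWeight x ≤ 1 := by
  rw [invWeight, Real.enorm_eq_ofReal_abs, ← ENNReal.ofReal_mul (abs_nonneg x),
    ENNReal.ofReal_le_one, ← div_eq_mul_inv, div_le_one (sqrt_one_add_sq_pos x)]
  exact abs_le_sqrt_one_add_sq x

lemma lintegral_invWeight_sq : ∫⁻ x, invWeight x ^ 2 = ENNReal.ofReal Real.pi := by
  rw [← integral_univ_inv_one_add_sq, ofReal_integral_eq_lintegral_ofReal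
    integrable_inv_one_add_sq (.of_forall fun x => by positivity)]
  refine lintegral_congr fun x => ?_
  rw [invWeight, ← ENNReal.ofReal_pow (by positivity), inv_pow, Real.sq_sqrt (by positivity)]

lemma enorm_weighted (f : ℝ → F) (x : ℝ) :
    ‖weighted f x‖ₑ = ENNReal.ofReal (Real.sqrt (1 + x ^ 2)) * ‖f x‖ₑ := by
  rw [weighted, enorm_smul, Real.enorm_of_nonneg (Real.sqrt_nonneg _)]

lemma enorm_eq_invWeight_mul (f : ℝ → F) (x : ℝ) : ‖f x‖ₑ = invWeight x * ‖weighted f x‖ₑ := by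
  rw [enorm_weighted, invWeight, ← mul_assoc, ← ENNReal.ofReal_mul (by positivity),
    inv_mul_cancel₀ (sqrt_one_add_sq_pos x).ne', ENNReal.ofReal_one, one_mul]

lemma aestronglyMeasurable_weighted_iff {f : ℝ → F} :
    AEStronglyMeasurable (weighted f) volume ↔ AEStronglyMeasurable f volume := by
  constructor <;> intro h
  · have := ((continuous_sqrt_one_add_sq.inv₀
      fun x => (sqrt_one_add_sq_pos x).ne').aestronglyMeasurable (μ := volume)).smul h
    refine this.congr (.of_forall fun x => ?_)
    simp only [Pi.smul_apply', weighted, smul_smul]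
    rw [Pi.inv_apply, inv_mul_cancel₀ (sqrt_one_add_sq_pos x).ne', one_smul]
  · exact continuous_sqrt_one_add_sq.aestronglyMeasurable.smul h

lemma MemL21.aestronglyMeasurable {f : ℝ → F} (h : MemL21 f) : AEStronglyMeasurable f volume :=
  aestronglyMeasurable_weighted_iff.1 h.1

lemma eLpNorm_le_l21Norm (f : ℝ → F) : eLpNorm f 2 volume ≤ l21Norm f := by
  refine eLpNorm_mono fun x => ?_
  rw [weighted, norm_smul, Real.norm_of_nonneg (Real.sqrt_nonneg _)]
  exact le_mul_of_one_le_left (norm_nonneg _) (one_le_sqrt_one_add_sq x)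

lemma MemL21.memLp {f : ℝ → F} (h : MemL21 f) : MemLp f 2 volume :=
  ⟨h.aestronglyMeasurable, (eLpNorm_le_l21Norm f).trans_lt h.2⟩

omit [NormedSpace ℝ F] in
lemma lintegral_invWeight_mul_enorm_le {f : ℝ → F} (h : AEStronglyMeasurable f volume) :
    ∫⁻ x, invWeight x * ‖f x‖ₑ ≤ 2 * eLpNorm f 2 volume := by
  refine (lintegral_mul_le_sqrt measurable_invWeight.aemeasurable h.enorm).trans ?_
  rw [eLpNorm_two_eq, lintegral_invWeight_sq]
  gcongr
  exact sqrt_pi_le_two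

lemma lintegral_enorm_le {f : ℝ → F} (h : AEStronglyMeasurable f volume) :
    ∫⁻ x, ‖f x‖ₑ ≤ 2 * l21Norm f := by
  simp_rw [enorm_eq_invWeight_mul f]
  exact lintegral_invWeight_mul_enorm_le (aestronglyMeasurable_weighted_iff.2 h)

lemma MemL21.integrable {f : ℝ → F} (h : MemL21 f) : Integrable f volume :=
  ⟨h.aestronglyMeasurable, (lintegral_enorm_le h.aestronglyMeasurable).trans_lt
    (ENNReal.mul_lt_top (by simp) h.2)⟩

lemma enorm_weighted_mul_invWeight_le {x y : ℝ} (hx : 0 ≤ x) (hxy : x ≤ y) (f : ℝ → F) :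
    ‖f y‖ₑ ≤ invWeight x * ‖weighted f y‖ₑ := by
  rw [enorm_eq_invWeight_mul f]
  gcongr
  exact invWeight_anti hx hxy

/-- The tails of a function in the weighted space decay like the inverse weight. -/
lemma eLpNorm_indicator_Ioi_le {x : ℝ} (hx : 0 ≤ x) (f : ℝ → F) :
    eLpNorm ((Ioi x).indicator f) 2 volume ≤ invWeight x * l21Norm f := by
  have h : ∀ y, ‖(Ioi x).indicator f y‖ₑ ≤ ‖(Real.sqrt (1 + x ^ 2))⁻¹ • weighted f y‖ₑ := by
    intro y
    by_cases hy : y ∈ Ioi x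
    · rw [indicator_of_mem hy, enorm_smul, Real.enorm_of_nonneg (by positivity)]
      exact enorm_weighted_mul_invWeight_le hx (le_of_lt hy) f
    · rw [indicator_of_notMem hy]; simp
  refine (eLpNorm_mono_enorm h).trans ?_
  rw [← Pi.smul_def, eLpNorm_const_smul, Real.enorm_of_nonneg (by positivity)]
  rfl

lemma l21Norm_congr {f g : ℝ → F} (h : f =ᵐ[volume] g) : l21Norm f = l21Norm g :=
  eLpNorm_congr_ae (by filter_upwards [h] with x hx; rw [weighted, weighted, hx])

lemma l21Norm_mono {G : Type*} [NormedAddCommGroup G] [NormedSpace ℝ G] {f : ℝ → F} {g : ℝ → G}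
    (h : ∀ᵐ x, ‖f x‖ ≤ ‖g x‖) : l21Norm f ≤ l21Norm g :=
  eLpNorm_mono_ae (by
    filter_upwards [h] with x hx
    rw [weighted, weighted, norm_smul, norm_smul]
    gcongr)

lemma l21Norm_add_le {f g : ℝ → F} (hf : AEStronglyMeasurable f volume)
    (hg : AEStronglyMeasurable g volume) : l21Norm (f + g) ≤ l21Norm f + l21Norm g := by
  have : weighted (f + g) = weighted f + weighted g := by funext x; simp [weighted]
  rw [l21Norm, this]
  exact eLpNorm_add_le (aestronglyMeasurable_weighted_iff.2 hf)
    (aestronglyMeasurable_weighted_iff.2 hg) one_le_two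

lemma l21Norm_const_mul (c : ℂ) (f : ℝ → ℂ) : l21Norm (fun x => c * f x) = ‖c‖ₑ * l21Norm f := by
  have : weighted (fun x => c * f x) = c • weighted f := by
    funext x; simp only [weighted, Pi.smul_apply, smul_eq_mul, Complex.real_smul]; ring
  rw [l21Norm, this, eLpNorm_const_smul, l21Norm]

lemma l21Norm_comp_mul_left {ε : ℝ} (hε : |ε| = 1) (f : ℝ → F) :
    l21Norm (fun x => f (ε * x)) = l21Norm f := by
  have e : weighted (fun x => f (ε * x)) = fun x => weighted f (ε * x) := by
    funext x
    rw [weighted, weighted, mul_pow, ← sq_abs ε, hε, one_pow, one_mul]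
  rw [l21Norm, e]
  rcases eq_or_eq_neg_of_abs_eq hε with rfl | rfl
  · simp [l21Norm]
  · simp only [neg_mul, one_mul]
    rw [l21Norm, eLpNorm_two_eq, eLpNorm_two_eq,
      lintegral_neg_eq_self (fun x => ‖weighted f x‖ₑ ^ 2)]

end Weighted

/-! ### Grönwall's inequality -/

section Gronwall

open Filter Topology

/-- The mass `∫_x^∞ h` of a function to the right of `x`. -/
noncomputable def tailMass (h : ℝ → ℝ) (x : ℝ) : ℝ := ∫ y in Ioi x, h y

variable {h : ℝ → ℝ} (hi : Integrable h volume) (h0 : ∀ y, 0 ≤ h y)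

include h0 in
lemma tailMass_nonneg (x : ℝ) : 0 ≤ tailMass h x := integral_nonneg fun y => h0 y

include hi h0 in
lemma tailMass_le (x : ℝ) : tailMass h x ≤ ∫ y, h y :=
  setIntegral_le_integral hi (.of_forall h0)

include hi in
lemma isPrimitive_tailMass : IsPrimitive (tailMass h) (fun y => -h y) := by
  refine ⟨hi.neg.locallyIntegrable, fun x y => ?_⟩
  rw [intervalIntegral.integral_neg, tailMass, tailMass,
    ← intervalIntegral.integral_interval_add_Ioi (a := x) (b := y) hi.integrableOn
      hi.integrableOn]
  ring

include hi h0 in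
lemma isPrimitive_exp_tailMass :
    IsPrimitive (fun x => Real.exp (2 * tailMass h x))
      (fun x => -(2 * (h x * Real.exp (2 * tailMass h x)))) := by
  have hp := isPrimitive_tailMass hi
  have hpb : ∀ x, Real.exp (2 * tailMass h x) ≤ Real.exp (2 * ∫ y, h y) := fun x =>
    Real.exp_le_exp.2 (by linarith [tailMass_le hi h0 x])
  have hcont : Continuous fun x => Real.exp (2 * tailMass h x) :=
    Real.continuous_exp.comp (continuous_const.mul hp.continuous)
  refine .of_absolutelyContinuousOnInterval (fun a b =>
    absolutelyContinuousOnInterval_of_dist_le (g := tailMass h) (2 * Real.exp (2 * ∫ y, h y))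
      (fun x y => ?_) (hp.absolutelyContinuousOnInterval a b)) ?_ ?_
  · have hd : ∀ s ∈ Iic (∫ y, h y), HasDerivWithinAt (fun s => Real.exp (2 * s))
        (2 * Real.exp (2 * s)) (Iic (∫ y, h y)) s := fun s _ => by
      have := ((hasDerivAt_id s).const_mul 2).exp.hasDerivWithinAt (s := Iic (∫ y, h y))
      simpa [mul_comm] using this
    have := (convex_Iic (∫ y, h y)).norm_image_sub_le_of_norm_hasDerivWithin_le
      (C := 2 * Real.exp (2 * ∫ y, h y)) hd (fun s hs => ?_) (tailMass_le hi h0 y)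
      (tailMass_le hi h0 x)
    · simpa only [dist_eq_norm] using this
    · rw [Real.norm_of_nonneg (by positivity)]
      have : s ≤ ∫ y, h y := hs
      gcongr
  · have : Integrable (fun x => h x * Real.exp (2 * tailMass h x)) volume :=
      hi.mul_bdd (c := Real.exp (2 * ∫ y, h y)) hcont.aestronglyMeasurable
        (.of_forall fun x => by rw [Real.norm_of_nonneg (Real.exp_pos _).le]; exact hpb x)
    exact (this.const_mul 2).neg.locallyIntegrable
  · filter_upwards [hp.ae_hasDerivAt] with x hx
    have := (hx.const_mul 2).exp
    convert! this using 1
    ring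

include hi h0 in
lemma integrable_mul_exp_tailMass :
    Integrable (fun x => h x * Real.exp (2 * tailMass h x)) volume :=
  hi.mul_bdd (c := Real.exp (2 * ∫ y, h y))
    (isPrimitive_exp_tailMass hi h0).continuous.aestronglyMeasurable
    (.of_forall fun x => by
      rw [Real.norm_of_nonneg (Real.exp_pos _).le]
      exact Real.exp_le_exp.2 (by linarith [tailMass_le hi h0 x]))

include hi h0 in
/-- The weight `e^{2 ∫_x^∞ h}` makes the Volterra operator with density `h` a contraction by the
factor `1/2`. -/
lemma setIntegral_mul_exp_tailMass_le (x : ℝ) :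
    ∫ y in Ioi x, h y * Real.exp (2 * tailMass h y) ≤ Real.exp (2 * tailMass h x) / 2 := by
  have hint := integrable_mul_exp_tailMass hi h0
  refine le_of_tendsto (intervalIntegral_tendsto_integral_Ioi x hint.integrableOn tendsto_id)
    (.of_forall fun T => ?_)
  have := (isPrimitive_exp_tailMass hi h0).2 x T
  rw [intervalIntegral.integral_neg, intervalIntegral.integral_const_mul] at this
  have hpos := Real.exp_pos (2 * tailMass h T)
  simp only [id]
  linarith

include hi h0 in
/-- **Grönwall's inequality** on a half line, for a density that is only integrable. -/
lemma gronwall_Ioi {F : ℝ → ℝ≥0∞} {M G : ℝ≥0∞} (hM : M ≠ ⊤) {x₀ : ℝ} (hF : ∀ x ≥ x₀, F x ≤ M)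
    (hG : ∀ x ≥ x₀, F x ≤ G + ∫⁻ y in Ioi x, ENNReal.ofReal (h y) * F y) :
    F x₀ ≤ 2 * ENNReal.ofReal (Real.exp (2 * ∫ y, h y)) * G := by
  set p := tailMass h
  let w : ℝ → ℝ≥0∞ := fun x => ENNReal.ofReal (Real.exp (2 * p x))
  let v : ℝ → ℝ≥0∞ := fun x => ENNReal.ofReal (Real.exp (-(2 * p x)))
  have hvw : ∀ x, v x * w x = 1 := fun x => by
    simp only [v, w]
    rw [← ENNReal.ofReal_mul (Real.exp_pos _).le, ← Real.exp_add, neg_add_cancel, Real.exp_zero,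
      ENNReal.ofReal_one]
  have hv1 : ∀ x, v x ≤ 1 := fun x => by
    simp only [v]
    rw [ENNReal.ofReal_le_one, Real.exp_le_one_iff]
    have : 0 ≤ p x := tailMass_nonneg h0 x
    linarith
  set S : ℝ≥0∞ := ⨆ x : Ici x₀, F x * v x with hS
  have hSM : S ≤ M := iSup_le fun x => (mul_le_mul' (hF x x.2) (hv1 x)).trans (by rw [mul_one])
  have hSt : S ≠ ⊤ := ne_top_of_le_ne_top hM hSM
  have hFS : ∀ x ≥ x₀, F x ≤ S * w x := fun x hx => by
    have : F x * v x ≤ S := le_iSup (fun x : Ici x₀ => F x * v x) ⟨x, hx⟩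
    calc F x = F x * v x * w x := by rw [mul_assoc, hvw, mul_one]
      _ ≤ S * w x := by gcongr
  have hstep : ∀ x ≥ x₀, F x * v x ≤ G + S / 2 := fun x hx => by
    have h1 : ∫⁻ y in Ioi x, ENNReal.ofReal (h y) * F y ≤ S * (w x / 2) := by
      calc ∫⁻ y in Ioi x, ENNReal.ofReal (h y) * F y
          ≤ ∫⁻ y in Ioi x, S * ENNReal.ofReal (h y * Real.exp (2 * p y)) := by
            refine setLIntegral_mono_ae' measurableSet_Ioi (.of_forall fun y hy => ?_)
            rw [ENNReal.ofReal_mul (h0 y), mul_left_comm]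
            gcongr
            exact hFS y (hx.le.trans (le_of_lt hy))
        _ = S * ENNReal.ofReal (∫ y in Ioi x, h y * Real.exp (2 * p y)) := by
            rw [lintegral_const_mul' _ _ hSt, ofReal_integral_eq_lintegral_ofReal
              (integrable_mul_exp_tailMass hi h0).integrableOn
              (.of_forall fun y => mul_nonneg (h0 y) (Real.exp_pos _).le)]
        _ ≤ S * (w x / 2) := by
            gcongr
            refine (ENNReal.ofReal_le_ofReal (setIntegral_mul_exp_tailMass_le hi h0 x)).trans ?_
            rw [ENNReal.ofReal_div_of_pos two_pos]
            simp [w, p]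
    calc F x * v x ≤ (G + S * (w x / 2)) * v x := by gcongr; exact (hG x hx).trans (by gcongr)
      _ = G * v x + S / 2 * (v x * w x) := by
          rw [add_mul, div_eq_mul_inv, div_eq_mul_inv]; ring
      _ ≤ G + S / 2 := by
          rw [hvw, mul_one]
          gcongr
          exact mul_le_of_le_one_right' (hv1 x)
  have hSG : S ≤ 2 * G := by
    have h1 : S ≤ G + S / 2 := iSup_le fun x => hstep x x.2
    have h2 : S / 2 + S / 2 ≤ G + S / 2 := by rwa [ENNReal.add_halves]
    have h3 : S / 2 ≤ G :=
      (ENNReal.add_le_add_iff_right (ENNReal.div_ne_top hSt (by simp))).1 h2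
    calc S = S / 2 + S / 2 := (ENNReal.add_halves S).symm
      _ ≤ G + G := by gcongr
      _ = 2 * G := (two_mul G).symm
  calc F x₀ ≤ S * w x₀ := hFS x₀ le_rfl
    _ ≤ 2 * G * ENNReal.ofReal (Real.exp (2 * ∫ y, h y)) := by
        gcongr
        exact ENNReal.ofReal_le_ofReal (Real.exp_le_exp.2 (by
          have := tailMass_le hi h0 x₀
          simp only [p]; linarith))
    _ = _ := by ring

end Gronwall

/-! ### The Volterra system: bounds in `L²` of the spectral parameter -/

section Bounds

lemma eLpNorm_setIntegral_le_of_norm_le {μ : Measure ℝ} [SFinite μ] {S : Set ℝ}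
    (hS : MeasurableSet S) {f X : ℝ → ℝ → ℂ} {c : ℝ → ℂ} (hf : Measurable (Function.uncurry f))
    (h : ∀ y ∈ S, ∀ z, ‖f y z‖ ≤ ‖c y‖ * ‖X y z‖) :
    eLpNorm (fun z => ∫ y in S, f y z) 2 μ ≤ ∫⁻ y in S, ‖c y‖ₑ * eLpNorm (X y) 2 μ := by
  refine (eLpNorm_integral_le hf.stronglyMeasurable).trans ?_
  refine setLIntegral_mono_ae' hS (.of_forall fun y hy => ?_)
  rw [← eLpNorm_const_smul]
  refine eLpNorm_mono fun z => ?_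
  rw [Pi.smul_apply, norm_smul]
  exact h y hy z

lemma eLpNorm_two_le_of_forall_Icc {f : ℝ → ℂ} (hf : Measurable f) {K : ℝ≥0∞}
    (h : ∀ n : ℕ, eLpNorm f 2 (volume.restrict (Icc (-(n : ℝ)) n)) ≤ K) :
    eLpNorm f 2 volume ≤ K := by
  refine (Lp.eLpNorm_lim_le_liminf_eLpNorm (f := fun n : ℕ => (Icc (-(n : ℝ)) n).indicator f)
    (fun n => (hf.indicator measurableSet_Icc).aestronglyMeasurable) f
    (.of_forall fun z => ?_)).trans ?_
  · refine tendsto_const_nhds.congr' ?_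
    filter_upwards [Filter.eventually_ge_atTop ⌈|z|⌉₊] with n hn
    have : |z| ≤ n := (Nat.le_ceil _).trans (by exact_mod_cast hn)
    rw [indicator_of_mem (by rw [mem_Icc]; exact abs_le.1 this)]
  · refine Filter.liminf_le_of_le (by isBoundedDefault) fun b hb => ?_
    obtain ⟨n, hn⟩ := hb.exists
    refine hn.trans ?_
    rw [eLpNorm_indicator_eq_eLpNorm_restrict measurableSet_Icc]
    exact h n

lemma measurable_phase_comp (κ x : ℝ) :
    Measurable (Function.uncurry fun y z : ℝ => phase κ z (x - y)) :=
  ((continuous_phase κ).comp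
    (continuous_snd.prodMk (continuous_const.sub continuous_fst))).measurable

/-- Solutions of an inhomogeneous Volterra system that are bounded, but not known to be square
integrable in `z`, are controlled in `L²_z` by the inhomogeneity. -/
lemma eLpNorm_volterra_le {κ : ℝ} {a b : ℝ → ℂ} (ha : Measurable a) (hb : Measurable b)
    (hai : Integrable a volume) (hbi : Integrable b volume) {A B α β : ℝ → ℝ → ℂ}
    (hA : Measurable (Function.uncurry A)) (hB : Measurable (Function.uncurry B)) {M : ℝ}
    (hAM : ∀ x z, ‖A x z‖ ≤ M) (hBM : ∀ x z, ‖B x z‖ ≤ M) {x₀ : ℝ} {G : ℝ≥0∞}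
    (hα : ∀ x, Measurable (α x)) (hβ : ∀ x, Measurable (β x))
    (eA : ∀ x ≥ x₀, ∀ z, A x z = α x z + ∫ y in Ioi x, a y * B y z)
    (eB : ∀ x ≥ x₀, ∀ z, B x z = β x z + ∫ y in Ioi x, phase κ z (x - y) * b y * A y z)
    (hG : ∀ x ≥ x₀, eLpNorm (α x) 2 volume + eLpNorm (β x) 2 volume ≤ G) :
    eLpNorm (A x₀) 2 volume + eLpNorm (B x₀) 2 volume ≤
      4 * ENNReal.ofReal (Real.exp (2 * ∫ y, (‖a y‖ + ‖b y‖))) * G := by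
  have hAx : ∀ x, Measurable (A x) := fun x => hA.comp measurable_prodMk_left
  have hBx : ∀ x, Measurable (B x) := fun x => hB.comp measurable_prodMk_left
  -- over `|z| ≤ n` the norms are finite, as Grönwall's inequality requires
  have key : ∀ n : ℕ, eLpNorm (A x₀) 2 (volume.restrict (Icc (-(n : ℝ)) n)) +
      eLpNorm (B x₀) 2 (volume.restrict (Icc (-(n : ℝ)) n)) ≤
      2 * ENNReal.ofReal (Real.exp (2 * ∫ y, (‖a y‖ + ‖b y‖))) * G := by
    intro n
    set μ := (volume : Measure ℝ).restrict (Icc (-(n : ℝ)) n) with hμ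
    have hbd : ∀ f : ℝ → ℂ, (∀ z, ‖f z‖ ≤ M) →
        eLpNorm f 2 μ ≤ μ univ ^ (2 : ℝ≥0∞).toReal⁻¹ * ENNReal.ofReal M := fun f hf =>
      eLpNorm_le_of_ae_bound (.of_forall hf)
    refine gronwall_Ioi (F := fun x => eLpNorm (A x) 2 μ + eLpNorm (B x) 2 μ)
      (h := fun y => ‖a y‖ + ‖b y‖) (hai.norm.add hbi.norm) (fun y => by positivity)
      (M := 2 * (μ univ ^ (2 : ℝ≥0∞).toReal⁻¹ * ENNReal.ofReal M)) ?_ ?_ ?_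
    · have : μ univ ≠ ⊤ := by simp [hμ]
      exact ENNReal.mul_ne_top (by simp) (ENNReal.mul_ne_top
        (ENNReal.rpow_ne_top_of_nonneg (by simp) this) ENNReal.ofReal_ne_top)
    · intro x _
      rw [two_mul]
      exact add_le_add (hbd _ (hAM x)) (hbd _ (hBM x))
    · intro x hx
      have fA : A x = α x + fun z => ∫ y in Ioi x, a y * B y z := funext fun z => eA x hx z
      have fB : B x = β x + fun z => ∫ y in Ioi x, phase κ z (x - y) * b y * A y z :=
        funext fun z => eB x hx z
      have mA : Measurable (Function.uncurry fun y z => a y * B y z) :=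
        (ha.comp measurable_fst).mul hB
      have mB : Measurable (Function.uncurry fun y z => phase κ z (x - y) * b y * A y z) :=
        ((measurable_phase_comp κ x).mul (hb.comp measurable_fst)).mul hA
      have iA : eLpNorm (fun z => ∫ y in Ioi x, a y * B y z) 2 μ ≤
          ∫⁻ y in Ioi x, ‖a y‖ₑ * eLpNorm (B y) 2 μ :=
        eLpNorm_setIntegral_le_of_norm_le measurableSet_Ioi mA fun y _ z => by rw [norm_mul]
      have iB : eLpNorm (fun z => ∫ y in Ioi x, phase κ z (x - y) * b y * A y z) 2 μ ≤
          ∫⁻ y in Ioi x, ‖b y‖ₑ * eLpNorm (A y) 2 μ :=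
        eLpNorm_setIntegral_le_of_norm_le measurableSet_Ioi mB fun y _ z => by
          rw [norm_mul, norm_mul, norm_phase, one_mul]
      have nA : eLpNorm (A x) 2 μ ≤
          eLpNorm (α x) 2 volume + ∫⁻ y in Ioi x, ‖a y‖ₑ * eLpNorm (B y) 2 μ := by
        rw [fA]
        refine (eLpNorm_add_le (hα x).aestronglyMeasurable ?_ one_le_two).trans
          (add_le_add (eLpNorm_mono_measure _ Measure.restrict_le_self) iA)
        exact (mA.stronglyMeasurable.integral_prod_left'
          (f := Function.uncurry fun y z => a y * B y z)).aestronglyMeasurable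
      have nB : eLpNorm (B x) 2 μ ≤
          eLpNorm (β x) 2 volume + ∫⁻ y in Ioi x, ‖b y‖ₑ * eLpNorm (A y) 2 μ := by
        rw [fB]
        refine (eLpNorm_add_le (hβ x).aestronglyMeasurable ?_ one_le_two).trans
          (add_le_add (eLpNorm_mono_measure _ Measure.restrict_le_self) iB)
        exact (mB.stronglyMeasurable.integral_prod_left'
          (f := Function.uncurry fun y z => phase κ z (x - y) * b y * A y z)).aestronglyMeasurable
      calc eLpNorm (A x) 2 μ + eLpNorm (B x) 2 μ
          ≤ (eLpNorm (α x) 2 volume + eLpNorm (β x) 2 volume) +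
            ((∫⁻ y in Ioi x, ‖a y‖ₑ * eLpNorm (B y) 2 μ) +
              ∫⁻ y in Ioi x, ‖b y‖ₑ * eLpNorm (A y) 2 μ) :=
            (add_le_add nA nB).trans_eq (add_add_add_comm _ _ _ _)
        _ ≤ G + ∫⁻ y in Ioi x, ENNReal.ofReal (‖a y‖ + ‖b y‖) *
              (eLpNorm (A y) 2 μ + eLpNorm (B y) 2 μ) := by
            gcongr
            · exact hG x hx
            · refine (le_lintegral_add _ _).trans (lintegral_mono fun y => ?_)
              rw [ENNReal.ofReal_add (norm_nonneg _) (norm_nonneg _), ofReal_norm, ofReal_norm,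
                mul_add, add_mul, add_mul]
              calc _ ≤ (‖a y‖ₑ * eLpNorm (B y) 2 μ + ‖b y‖ₑ * eLpNorm (A y) 2 μ) +
                    (‖a y‖ₑ * eLpNorm (A y) 2 μ + ‖b y‖ₑ * eLpNorm (B y) 2 μ) := le_self_add
                _ = _ := by ring
  calc _ ≤ 2 * ENNReal.ofReal (Real.exp (2 * ∫ y, (‖a y‖ + ‖b y‖))) * G +
        2 * ENNReal.ofReal (Real.exp (2 * ∫ y, (‖a y‖ + ‖b y‖))) * G :=
        add_le_add
          (eLpNorm_two_le_of_forall_Icc (hAx x₀) fun n => le_self_add.trans (key n))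
          (eLpNorm_two_le_of_forall_Icc (hBx x₀) fun n => le_add_self.trans (key n))
    _ = _ := by ring

end Bounds

/-! ### The Volterra system: existence and uniqueness -/

section Existence

open Filter Topology

/-- `(A, B)` is a bounded and jointly continuous solution of the scalar Volterra system
`A = 1 + ∫_x^∞ a B`, `B = ∫_x^∞ e^{iκ(z+1)(x-y)} b A`. All four Jost functions are of this form, up
to a reflection of the line and the order of the components. -/
structure IsJostPair (κ : ℝ) (a b : ℝ → ℂ) (A B : ℝ → ℝ → ℂ) : Prop where
  contA : Continuous (Function.uncurry A)
  contB : Continuous (Function.uncurry B)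
  bdd : ∃ M : ℝ, ∀ x z, ‖A x z‖ ≤ M ∧ ‖B x z‖ ≤ M
  eqA : ∀ x z, A x z = 1 + ∫ y in Ioi x, a y * B y z
  eqB : ∀ x z, B x z = ∫ y in Ioi x, phase κ z (x - y) * b y * A y z

lemma continuous_setIntegral_Ioi {f : ℝ → ℝ × ℝ → ℂ} {c : ℝ → ℝ}
    (hm : ∀ q, AEStronglyMeasurable (fun y => f y q) volume) (hc : ∀ y, Continuous (f y))
    (hb : ∀ y q, ‖f y q‖ ≤ c y) (hi : Integrable c volume) :
    Continuous fun q : ℝ × ℝ => ∫ y in Ioi q.1, f y q := by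
  simp_rw [← integral_indicator measurableSet_Ioi]
  refine continuous_iff_continuousAt.2 fun q₀ => ?_
  refine continuousAt_of_dominated (bound := c)
    (.of_forall fun q => (hm q).indicator measurableSet_Ioi)
    (.of_forall fun q => .of_forall fun y => ?_) hi ?_
  · exact (norm_indicator_le_norm_self _ _).trans (hb y q)
  · have : ∀ᵐ y ∂(volume : Measure ℝ), y ≠ q₀.1 := by simp [ae_iff, measure_singleton]
    filter_upwards [this] with y hy
    rcases lt_or_gt_of_ne hy with hlt | hgt
    · refine ContinuousAt.congr (f := fun _ => 0) continuousAt_const ?_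
      filter_upwards [continuousAt_fst.eventually_mem (Ioi_mem_nhds hlt)] with q hq
      rw [indicator_of_notMem]
      exact fun h => lt_asymm (mem_Ioi.1 h) (mem_Ioi.1 hq)
    · refine ContinuousAt.congr (f := f y) (hc y).continuousAt ?_
      filter_upwards [continuousAt_fst.eventually_mem (Iio_mem_nhds hgt)] with q hq
      rw [indicator_of_mem]
      exact hq

lemma exists_isJostPair (κ : ℝ) {a b : ℝ → ℂ} (ha : Integrable a volume)
    (hb : Integrable b volume) : ∃ A B, IsJostPair κ a b A B := by
  set h : ℝ → ℝ := fun y => ‖a y‖ + ‖b y‖ with hh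
  have hi : Integrable h volume := ha.norm.add hb.norm
  have h0 : ∀ y, 0 ≤ h y := fun y => by positivity
  let w : ℝ → ℝ := fun x => Real.exp (2 * tailMass h x)
  have hw0 : ∀ x, 0 < w x := fun x => Real.exp_pos _
  have hwc : Continuous w := (isPrimitive_exp_tailMass hi h0).continuous
  have hwi : Integrable (fun y => h y * w y) volume := integrable_mul_exp_tailMass hi h0
  have hkey : ∀ x, ∫ y in Ioi x, h y * w y ≤ w x / 2 := setIntegral_mul_exp_tailMass_le hi h0
  have hah : ∀ y, ‖a y‖ ≤ h y := fun y => le_add_of_nonneg_right (norm_nonneg _)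
  have hbh : ∀ y, ‖b y‖ ≤ h y := fun y => le_add_of_nonneg_left (norm_nonneg _)
  -- the integrands of the system for the unknown divided by the weight `w`
  let f₁ : (ℝ × ℝ → ℂ × ℂ) → ℝ → ℝ × ℝ → ℂ := fun F y q => a y * (w y * (F (y, q.2)).2)
  let f₂ : (ℝ × ℝ → ℂ × ℂ) → ℝ → ℝ × ℝ → ℂ := fun F y q =>
    phase κ q.2 (q.1 - y) * b y * (w y * (F (y, q.2)).1)
  have hf₁m : ∀ (F : BoundedContinuousFunction (ℝ × ℝ) (ℂ × ℂ)) q,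
      AEStronglyMeasurable (fun y => f₁ F y q) volume := fun F q =>
    ha.1.mul (by fun_prop : Continuous fun y => (w y : ℂ) * (F (y, q.2)).2).aestronglyMeasurable
  have hf₂m : ∀ (F : BoundedContinuousFunction (ℝ × ℝ) (ℂ × ℂ)) q,
      AEStronglyMeasurable (fun y => f₂ F y q) volume := fun F q => by
    refine AEStronglyMeasurable.mul (AEStronglyMeasurable.mul ?_ hb.1) ?_
    · exact ((continuous_phase κ).comp
        (continuous_const.prodMk (continuous_const.sub continuous_id))).aestronglyMeasurable
    · exact (by fun_prop : Continuous fun y => (w y : ℂ) * (F (y, q.2)).1).aestronglyMeasurable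
  have hn1 : ∀ (v : ℂ × ℂ), ‖v.1‖ ≤ ‖v‖ := fun v => norm_fst_le v
  have hn2 : ∀ (v : ℂ × ℂ), ‖v.2‖ ≤ ‖v‖ := fun v => norm_snd_le v
  have hf₁b : ∀ (F : ℝ × ℝ → ℂ × ℂ) (C : ℝ), (∀ q, ‖F q‖ ≤ C) → ∀ y q,
      ‖f₁ F y q‖ ≤ h y * w y * C := fun F C hF y q => by
    simp only [f₁]
    rw [norm_mul, norm_mul, Complex.norm_real, Real.norm_of_nonneg (hw0 y).le, ← mul_assoc]
    have := hw0 y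
    gcongr
    · exact hah y
    · exact (hn2 _).trans (hF _)
  have hf₂b : ∀ (F : ℝ × ℝ → ℂ × ℂ) (C : ℝ), (∀ q, ‖F q‖ ≤ C) → ∀ y q,
      ‖f₂ F y q‖ ≤ h y * w y * C := fun F C hF y q => by
    simp only [f₂]
    rw [norm_mul, norm_mul, norm_mul, norm_phase, one_mul, Complex.norm_real,
      Real.norm_of_nonneg (hw0 y).le, ← mul_assoc]
    have := hw0 y
    gcongr
    · exact hbh y
    · exact (hn1 _).trans (hF _)
  have hint : ∀ (g : ℝ → ℂ) (C : ℝ) (x : ℝ), 0 ≤ C → (∀ y, ‖g y‖ ≤ h y * w y * C) →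
      ‖((w x)⁻¹ : ℂ) * ∫ y in Ioi x, g y‖ ≤ C / 2 := fun g C x hC hg => by
    have h1 : ‖∫ y in Ioi x, g y‖ ≤ w x / 2 * C := by
      refine (norm_integral_le_of_norm_le (hwi.mul_const C).integrableOn
        (.of_forall hg)).trans ?_
      rw [integral_mul_const]
      exact mul_le_mul_of_nonneg_right (hkey x) hC
    rw [norm_mul, norm_inv, Complex.norm_real, Real.norm_of_nonneg (hw0 x).le,
      inv_mul_le_iff₀ (hw0 x)]
    linarith
  let T : (ℝ × ℝ → ℂ × ℂ) → ℝ × ℝ → ℂ × ℂ := fun F q =>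
    ((w q.1 : ℂ)⁻¹ * (1 + ∫ y in Ioi q.1, f₁ F y q), (w q.1 : ℂ)⁻¹ * ∫ y in Ioi q.1, f₂ F y q)
  have hw1 : ∀ x, ‖(w x : ℂ)⁻¹‖ ≤ 1 := fun x => by
    rw [norm_inv, Complex.norm_real, Real.norm_of_nonneg (hw0 x).le]
    exact inv_le_one_of_one_le₀ (Real.one_le_exp (by have := tailMass_nonneg h0 x; linarith))
  have hTc : ∀ F : BoundedContinuousFunction (ℝ × ℝ) (ℂ × ℂ), Continuous (T F) := fun F => by
    have hwinv : Continuous fun q : ℝ × ℝ => (w q.1 : ℂ)⁻¹ :=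
      (by fun_prop : Continuous fun q : ℝ × ℝ => (w q.1 : ℂ)).inv₀
        fun q => by exact_mod_cast (hw0 q.1).ne'
    refine (hwinv.mul (continuous_const.add ?_)).prodMk (hwinv.mul ?_)
    · refine continuous_setIntegral_Ioi (hf₁m F) (fun y => ?_)
        (hf₁b F ‖F‖ F.norm_coe_le_norm) (hwi.mul_const _)
      simp only [f₁]
      fun_prop
    · refine continuous_setIntegral_Ioi (hf₂m F) (fun y => ?_)
        (hf₂b F ‖F‖ F.norm_coe_le_norm) (hwi.mul_const _)
      have : Continuous fun q : ℝ × ℝ => phase κ q.2 (q.1 - y) :=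
        (continuous_phase κ).comp
          (continuous_snd.prodMk (continuous_fst.sub continuous_const))
      simp only [f₂]
      fun_prop
  have hTb : ∀ F : BoundedContinuousFunction (ℝ × ℝ) (ℂ × ℂ), ∀ q, ‖T F q‖ ≤ 1 + ‖F‖ / 2 :=
    fun F q => by
      have i1 := hint _ ‖F‖ q.1 (norm_nonneg _) fun y => hf₁b F ‖F‖ F.norm_coe_le_norm y q
      have i2 := hint _ ‖F‖ q.1 (norm_nonneg _) fun y => hf₂b F ‖F‖ F.norm_coe_le_norm y q
      refine norm_prod_le_iff.2 ⟨?_, i2.trans (by linarith)⟩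
      simp only [T]
      rw [mul_add, mul_one]
      exact (norm_add_le _ _).trans (add_le_add (hw1 _) i1)
  let 𝒯 : BoundedContinuousFunction (ℝ × ℝ) (ℂ × ℂ) →
      BoundedContinuousFunction (ℝ × ℝ) (ℂ × ℂ) := fun F =>
    BoundedContinuousFunction.ofNormedAddCommGroup (T F) (hTc F) _ (hTb F)
  have hcontr : ContractingWith (1 / 2) 𝒯 := by
    refine ⟨by norm_num, LipschitzWith.of_dist_le_mul fun F H => ?_⟩
    have hi₁ : ∀ (F : BoundedContinuousFunction (ℝ × ℝ) (ℂ × ℂ)) q,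
        IntegrableOn (fun y => f₁ F y q) (Ioi q.1) volume := fun F q =>
      ((hwi.mul_const _).mono' (hf₁m F q)
        (.of_forall fun y => hf₁b F ‖F‖ F.norm_coe_le_norm y q)).integrableOn
    have hi₂ : ∀ (F : BoundedContinuousFunction (ℝ × ℝ) (ℂ × ℂ)) q,
        IntegrableOn (fun y => f₂ F y q) (Ioi q.1) volume := fun F q =>
      ((hwi.mul_const _).mono' (hf₂m F q)
        (.of_forall fun y => hf₂b F ‖F‖ F.norm_coe_le_norm y q)).integrableOn
    have hFH : ∀ q, ‖(F - H) q‖ ≤ dist F H := fun q => by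
      rw [dist_eq_norm]; exact (F - H).norm_coe_le_norm q
    refine (BoundedContinuousFunction.dist_le (by positivity)).2 fun q => ?_
    have e : T F q - T H q = ((w q.1 : ℂ)⁻¹ * ∫ y in Ioi q.1, f₁ (⇑(F - H)) y q,
        (w q.1 : ℂ)⁻¹ * ∫ y in Ioi q.1, f₂ (⇑(F - H)) y q) := by
      have e1 : ∀ y, f₁ (⇑(F - H)) y q = f₁ F y q - f₁ H y q := fun y => by
        simp only [f₁, BoundedContinuousFunction.sub_apply, Prod.snd_sub]; ring
      have e2 : ∀ y, f₂ (⇑(F - H)) y q = f₂ F y q - f₂ H y q := fun y => by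
        simp only [f₂, BoundedContinuousFunction.sub_apply, Prod.fst_sub]; ring
      simp_rw [e1, e2]
      rw [integral_sub (hi₁ F q) (hi₁ H q), integral_sub (hi₂ F q) (hi₂ H q)]
      ext <;> simp only [T, Prod.fst_sub, Prod.snd_sub] <;> ring
    have e' : dist (𝒯 F q) (𝒯 H q) = ‖T F q - T H q‖ := dist_eq_norm _ _
    have hhalf : ((1 / 2 : ℝ≥0) : ℝ) * dist F H = dist F H / 2 := by push_cast; ring
    rw [e', e, hhalf]
    exact norm_prod_le_iff.2
      ⟨hint _ _ q.1 dist_nonneg fun y => hf₁b _ _ hFH y q,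
        hint _ _ q.1 dist_nonneg fun y => hf₂b _ _ hFH y q⟩
  obtain ⟨F, hF⟩ : ∃ F, 𝒯 F = F := ⟨hcontr.fixedPoint, hcontr.fixedPoint_isFixedPt⟩
  have hF1 : ∀ q, F q = T F q := fun q => by
    conv_lhs => rw [← hF]
    rfl
  have hwne : ∀ x, (w x : ℂ) ≠ 0 := fun x => by exact_mod_cast (hw0 x).ne'
  have hwM : ∀ x, w x ≤ Real.exp (2 * ∫ y, h y) := fun x =>
    Real.exp_le_exp.2 (by linarith [tailMass_le hi h0 x])
  refine ⟨fun x z => w x * (F (x, z)).1, fun x z => w x * (F (x, z)).2, ?_, ?_,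
    ⟨Real.exp (2 * ∫ y, h y) * ‖F‖, fun x z => ?_⟩, fun x z => ?_, fun x z => ?_⟩
  · simp only [Function.uncurry_def]; fun_prop
  · simp only [Function.uncurry_def]; fun_prop
  · rw [norm_mul, norm_mul, Complex.norm_real, Real.norm_of_nonneg (hw0 x).le]
    have := hw0 x
    constructor
    · gcongr
      · exact hwM x
      · exact (hn1 _).trans (F.norm_coe_le_norm _)
    · gcongr
      · exact hwM x
      · exact (hn2 _).trans (F.norm_coe_le_norm _)
  · rw [hF1]
    simp only [T]
    rw [mul_inv_cancel_left₀ (hwne x)]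
  · rw [hF1]
    simp only [T]
    rw [mul_inv_cancel_left₀ (hwne x)]

/-- For a fixed spectral parameter, bounded measurable solutions of a Volterra system are unique. -/
lemma volterra_unique {a b : ℝ → ℂ} (ha : Integrable a volume) (hb : Integrable b volume)
    {k : ℝ → ℝ → ℂ} (hk : ∀ x y, ‖k x y‖ = 1) (hkc : ∀ x, Continuous (k x)) {A B A' B' : ℝ → ℂ}
    (hA : AEStronglyMeasurable A volume) (hB : AEStronglyMeasurable B volume)
    (hA' : AEStronglyMeasurable A' volume) (hB' : AEStronglyMeasurable B' volume) {M : ℝ}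
    (bA : ∀ x, ‖A x‖ ≤ M) (bB : ∀ x, ‖B x‖ ≤ M) (bA' : ∀ x, ‖A' x‖ ≤ M) (bB' : ∀ x, ‖B' x‖ ≤ M)
    (eA : ∀ x, A x = 1 + ∫ y in Ioi x, a y * B y)
    (eB : ∀ x, B x = ∫ y in Ioi x, k x y * b y * A y)
    (eA' : ∀ x, A' x = 1 + ∫ y in Ioi x, a y * B' y)
    (eB' : ∀ x, B' x = ∫ y in Ioi x, k x y * b y * A' y) : A = A' ∧ B = B' := by
  have hz : ∀ x, ‖A x - A' x‖ₑ + ‖B x - B' x‖ₑ = 0 := by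
    intro x₀
    have i1 : ∀ (D : ℝ → ℂ), AEStronglyMeasurable D volume → (∀ x, ‖D x‖ ≤ M) →
        Integrable (fun y => a y * D y) volume := fun D hD bD =>
      ha.mul_bdd (c := M) hD (.of_forall bD)
    have i2 : ∀ (D : ℝ → ℂ) x, AEStronglyMeasurable D volume → (∀ x, ‖D x‖ ≤ M) →
        Integrable (fun y => k x y * b y * D y) volume := fun D x hD bD =>
      ((hb.bdd_mul (c := 1) (hkc x).aestronglyMeasurable
        (.of_forall fun y => (hk x y).le)).mul_bdd (c := M) hD (.of_forall bD))
    have := gronwall_Ioi (h := fun y => ‖a y‖ + ‖b y‖)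
      (F := fun x => ‖A x - A' x‖ₑ + ‖B x - B' x‖ₑ) (M := 4 * ENNReal.ofReal M) (G := 0)
      (x₀ := x₀) (ha.norm.add hb.norm) (fun y => by positivity)
      (ENNReal.mul_ne_top (by simp) ENNReal.ofReal_ne_top) (fun x _ => ?_) (fun x _ => ?_)
    · simpa using this
    · have : ∀ D : ℝ → ℂ, (∀ x, ‖D x‖ ≤ M) → ‖D x‖ₑ ≤ ENNReal.ofReal M := fun D hD => by
        rw [← ofReal_norm]; exact ENNReal.ofReal_le_ofReal (hD x)
      calc ‖A x - A' x‖ₑ + ‖B x - B' x‖ₑ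
          ≤ (‖A x‖ₑ + ‖A' x‖ₑ) + (‖B x‖ₑ + ‖B' x‖ₑ) := add_le_add enorm_sub_le enorm_sub_le
        _ ≤ (ENNReal.ofReal M + ENNReal.ofReal M) + (ENNReal.ofReal M + ENNReal.ofReal M) := by
          gcongr
          exacts [this _ bA, this _ bA', this _ bB, this _ bB']
        _ = 4 * ENNReal.ofReal M := by ring
    · have hd1 : A x - A' x = ∫ y in Ioi x, a y * (B y - B' y) := by
        rw [eA, eA', add_sub_add_left_eq_sub, ← integral_sub (i1 B hB bB).integrableOn
          (i1 B' hB' bB').integrableOn]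
        simp_rw [mul_sub]
      have hd2 : B x - B' x = ∫ y in Ioi x, k x y * b y * (A y - A' y) := by
        rw [eB, eB', ← integral_sub (i2 A x hA bA).integrableOn (i2 A' x hA' bA').integrableOn]
        simp_rw [mul_sub]
      rw [zero_add, hd1, hd2]
      refine (add_le_add (enorm_integral_le_lintegral_enorm _)
        (enorm_integral_le_lintegral_enorm _)).trans ((le_lintegral_add _ _).trans
          (lintegral_mono fun y => ?_))
      have hke : ‖k x y‖ₑ = 1 := by rw [← ofReal_norm, hk, ENNReal.ofReal_one]
      rw [enorm_mul, enorm_mul, enorm_mul, hke, one_mul, ENNReal.ofReal_add (norm_nonneg _)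
        (norm_nonneg _), ofReal_norm, ofReal_norm, mul_add, add_mul, add_mul]
      calc _ ≤ (‖a y‖ₑ * ‖B y - B' y‖ₑ + ‖b y‖ₑ * ‖A y - A' y‖ₑ) +
            (‖a y‖ₑ * ‖A y - A' y‖ₑ + ‖b y‖ₑ * ‖B y - B' y‖ₑ) := le_self_add
        _ = _ := by ring
  constructor <;> funext x <;> have h1 := hz x <;>
    simp only [add_eq_zero, enorm_eq_zero, sub_eq_zero] at h1
  exacts [h1.1, h1.2]

end Existence

/-! ### Lipschitz bounds for the Volterra system -/

section Estimates

/-- A measurable coefficient of the Volterra system with norm at most `R` in the weighted space. -/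
structure IsCoeff (R : ℝ≥0) (a : ℝ → ℂ) : Prop where
  meas : Measurable a
  bound : l21Norm a ≤ R

lemma IsCoeff.memL21 {R : ℝ≥0} {a : ℝ → ℂ} (h : IsCoeff R a) : MemL21 a :=
  ⟨aestronglyMeasurable_weighted_iff.2 h.meas.aestronglyMeasurable,
    h.bound.trans_lt ENNReal.coe_lt_top⟩

lemma IsCoeff.integrable {R : ℝ≥0} {a : ℝ → ℂ} (h : IsCoeff R a) : Integrable a volume :=
  h.memL21.integrable

lemma IsCoeff.sub {R : ℝ≥0} {a a' : ℝ → ℂ} (h : IsCoeff R a) (h' : IsCoeff R a') :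
    IsCoeff (R + R) (a - a') := by
  refine ⟨h.meas.sub h'.meas, ?_⟩
  rw [sub_eq_add_neg]
  refine (l21Norm_add_le h.meas.aestronglyMeasurable h'.meas.neg.aestronglyMeasurable).trans ?_
  rw [ENNReal.coe_add]
  refine add_le_add h.bound ((l21Norm_mono (g := a') (.of_forall fun x => ?_)).trans h'.bound)
  simp

lemma isCoeff_zero (R : ℝ≥0) : IsCoeff R 0 :=
  ⟨measurable_zero, by
    have : weighted (0 : ℝ → ℂ) = 0 := by funext x; simp [weighted]
    simp [l21Norm, this]⟩

/-- The solution of the Volterra system without coefficients. -/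
lemma isJostPair_zero (κ : ℝ) : IsJostPair κ 0 0 (fun _ _ => 1) (fun _ _ => 0) where
  contA := continuous_const
  contB := continuous_const
  bdd := ⟨1, fun x z => by simp⟩
  eqA x z := by simp
  eqB x z := by simp

/-- The constant of the Grönwall estimate for coefficients bounded by `R`. -/
noncomputable def gronwallConst (R : ℝ≥0) : ℝ≥0 := 4 * Real.toNNReal (Real.exp (8 * R))

lemma gronwallConst_ge {R : ℝ≥0} {a b : ℝ → ℂ} (ha : IsCoeff R a) (hb : IsCoeff R b) :
    4 * ENNReal.ofReal (Real.exp (2 * ∫ y, (‖a y‖ + ‖b y‖))) ≤ gronwallConst R := by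
  have h1 : ∀ {c : ℝ → ℂ}, IsCoeff R c → ∫ y, ‖c y‖ ≤ 2 * R := fun {c} hc => by
    rw [integral_norm_eq_lintegral_enorm hc.integrable.1]
    refine ENNReal.toReal_le_of_le_ofReal (by positivity)
      ((lintegral_enorm_le hc.integrable.1).trans ?_)
    rw [ENNReal.ofReal_mul two_pos.le, ENNReal.ofReal_coe_nnreal, ENNReal.ofReal_ofNat]
    gcongr
    exact hc.bound
  rw [gronwallConst, ENNReal.coe_mul]
  change 4 * _ ≤ 4 * ENNReal.ofReal (Real.exp (8 * R))
  have key : 2 * ∫ y, (‖a y‖ + ‖b y‖) ≤ 8 * R := by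
    rw [integral_add ha.integrable.norm hb.integrable.norm]
    linarith [h1 ha, h1 hb]
  exact mul_le_mul_right (ENNReal.ofReal_le_ofReal (Real.exp_le_exp.2 key)) _

lemma measurable_setIntegral {S : Set ℝ} {f : ℝ → ℝ → ℂ} (hf : Measurable (Function.uncurry f)) :
    Measurable fun z => ∫ y in S, f y z :=
  (hf.stronglyMeasurable.integral_prod_left' (f := Function.uncurry f)).measurable

lemma integrable_mul_bdd {c X : ℝ → ℂ} (hc : Integrable c volume) (hX : Measurable X) {M : ℝ}
    (hM : ∀ y, ‖X y‖ ≤ M) : Integrable (fun y => c y * X y) volume :=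
  hc.mul_bdd (c := M) hX.aestronglyMeasurable (.of_forall hM)

lemma integrable_phase_mul {c : ℝ → ℂ} (hc : Integrable c volume) (κ x z : ℝ) :
    Integrable (fun y => phase κ z (x - y) * c y) volume :=
  hc.bdd_mul (c := 1) ((continuous_phase κ).comp
    (continuous_const.prodMk (continuous_const.sub continuous_id))).aestronglyMeasurable
    (.of_forall fun _ => (norm_phase _ _ _).le)

lemma integrable_phase_mul_bdd {c X : ℝ → ℂ} (hc : Integrable c volume) (hX : Measurable X) {M : ℝ}
    (hM : ∀ y, ‖X y‖ ≤ M) (κ x z : ℝ) :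
    Integrable (fun y => phase κ z (x - y) * c y * X y) volume :=
  integrable_mul_bdd (integrable_phase_mul hc κ x z) hX hM

/-- Plancherel bound for the oscillatory integral over a set. -/
lemma eLpNorm_setIntegral_phase_le {κ : ℝ} (hκ : |κ| = 2) (x : ℝ) {S : Set ℝ}
    (hS : MeasurableSet S) {c : ℝ → ℂ} (h1 : IntegrableOn c S volume)
    (h2 : MemLp c 2 (volume.restrict S)) :
    eLpNorm (fun z => ∫ y in S, phase κ z (x - y) * c y) 2 volume ≤
      2 * eLpNorm c 2 (volume.restrict S) := by
  rw [← eLpNorm_indicator_eq_eLpNorm_restrict hS]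
  refine le_trans (le_of_eq ?_) (eLpNorm_integral_phase_le hκ x
    (h1.integrable_indicator hS) ((memLp_indicator_iff_restrict hS).2 h2))
  congr 1; funext z
  rw [← integral_indicator hS]
  congr 1; funext y
  by_cases hy : y ∈ S
  · rw [indicator_of_mem hy, indicator_of_mem hy]
  · rw [indicator_of_notMem hy, indicator_of_notMem hy, mul_zero]

lemma eLpNorm_setIntegral_phase_coeff_le {κ : ℝ} (hκ : |κ| = 2) {x : ℝ} (hx : 0 ≤ x) {c : ℝ → ℂ}
    {R : ℝ≥0} (hc : IsCoeff R c) :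
    eLpNorm (fun z => ∫ y in Ioi x, phase κ z (x - y) * c y) 2 volume ≤
      2 * l21Norm c * invWeight x := by
  refine (eLpNorm_setIntegral_phase_le hκ x measurableSet_Ioi
    hc.integrable.integrableOn (hc.memL21.memLp.restrict _)).trans ?_
  rw [← eLpNorm_indicator_eq_eLpNorm_restrict measurableSet_Ioi, mul_assoc, mul_comm (l21Norm c)]
  gcongr
  exact eLpNorm_indicator_Ioi_le hx c

lemma setLIntegral_coeff_mul_le {c : ℝ → ℂ} {R : ℝ≥0} (hc : IsCoeff R c) {x : ℝ}
    {N : ℝ → ℝ≥0∞} {K : ℝ≥0∞} (hN : ∀ y > x, N y ≤ K) :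
    ∫⁻ y in Ioi x, ‖c y‖ₑ * N y ≤ 2 * l21Norm c * K := by
  calc ∫⁻ y in Ioi x, ‖c y‖ₑ * N y ≤ ∫⁻ y in Ioi x, ‖c y‖ₑ * K :=
        setLIntegral_mono_ae' measurableSet_Ioi (.of_forall fun y hy => by
          gcongr; exact hN y hy)
    _ ≤ ∫⁻ y, ‖c y‖ₑ * K := setLIntegral_le_lintegral _ _
    _ = (∫⁻ y, ‖c y‖ₑ) * K := lintegral_mul_const _ hc.meas.enorm
    _ ≤ 2 * l21Norm c * K := by
        gcongr
        exact lintegral_enorm_le hc.meas.aestronglyMeasurable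

variable {κ : ℝ} {a b a' b' : ℝ → ℂ} {A B A' B' : ℝ → ℝ → ℂ}

lemma IsJostPair.measA (h : IsJostPair κ a b A B) : Measurable (Function.uncurry A) :=
  h.contA.measurable

lemma IsJostPair.measB (h : IsJostPair κ a b A B) : Measurable (Function.uncurry B) :=
  h.contB.measurable

/-- The difference of two solutions, in `L²_z`, in terms of the difference of the coefficients. The
estimate depends on the second solution through the bound `C'` only. -/
lemma exists_diff_bound (R C' : ℝ≥0) : ∃ C : ℝ≥0, ∀ {κ : ℝ} {a b a' b' : ℝ → ℂ}
    {A B A' B' : ℝ → ℝ → ℂ}, |κ| = 2 → IsCoeff R a → IsCoeff R b → IsCoeff R a' → IsCoeff R b' →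
    IsJostPair κ a b A B → IsJostPair κ a' b' A' B' →
    (∀ x ≥ 0, eLpNorm (fun z => A' x z - 1) 2 volume + eLpNorm (B' x) 2 volume ≤
      C' * invWeight x) →
    ∀ x ≥ 0, eLpNorm (fun z => A x z - A' x z) 2 volume +
      eLpNorm (fun z => B x z - B' x z) 2 volume ≤
      C * (l21Norm (a - a') + l21Norm (b - b')) * invWeight x := by
  refine ⟨gronwallConst R * (2 * C' + 2), fun {κ a b a' b' A B A' B'} hκ ha hb ha' hb' hJ hJ' h'
    x₀ hx₀ => ?_⟩
  obtain ⟨M, hM⟩ := hJ.bdd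
  obtain ⟨M', hM'⟩ := hJ'.bdd
  have hda := ha.sub ha'
  have hdb := hb.sub hb'
  set δ := l21Norm (a - a') + l21Norm (b - b') with hδ
  have mA := hJ.measA
  have mB := hJ.measB
  have mA' := hJ'.measA
  have mB' := hJ'.measB
  have sec : ∀ {f : ℝ → ℝ → ℂ}, Measurable (Function.uncurry f) → ∀ z, Measurable fun y => f y z :=
    fun hf z => hf.comp measurable_prodMk_right
  have mD : Measurable (Function.uncurry fun y z => A y z - A' y z) := mA.sub mA'
  have mA1 : Measurable (Function.uncurry fun y z => A' y z - 1) := mA'.sub measurable_const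
  have m1 : Measurable (Function.uncurry fun y z => (a - a') y * B' y z) :=
    (hda.meas.comp measurable_fst).mul mB'
  have m2 : ∀ x, Measurable (Function.uncurry fun y z => phase κ z (x - y) * (b - b') y) :=
    fun x => (measurable_phase_comp κ x).mul (hdb.meas.comp measurable_fst)
  have m3 : ∀ x, Measurable (Function.uncurry fun y z =>
      phase κ z (x - y) * (b - b') y * (A' y z - 1)) := fun x => (m2 x).mul mA1
  have bA1 : ∀ x z, ‖A' x z - 1‖ ≤ M' + 1 := fun x z =>
    (norm_sub_le _ _).trans (by simpa using (hM' x z).1)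
  -- in `(b - b') A'` only `A' - 1` decays in `L²_z`, so `b - b'` is split off for Plancherel
  refine (eLpNorm_volterra_le (κ := κ) ha.meas hb.meas ha.integrable hb.integrable
    (A := fun x z => A x z - A' x z) (B := fun x z => B x z - B' x z) (M := M + M')
    (α := fun x z => ∫ y in Ioi x, (a - a') y * B' y z)
    (β := fun x z => (∫ y in Ioi x, phase κ z (x - y) * (b - b') y) +
      ∫ y in Ioi x, phase κ z (x - y) * (b - b') y * (A' y z - 1))
    (mA.sub mA') (mB.sub mB')
    (fun x z => (norm_sub_le _ _).trans (add_le_add (hM x z).1 (hM' x z).1))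
    (fun x z => (norm_sub_le _ _).trans (add_le_add (hM x z).2 (hM' x z).2))
    (G := (2 * C' + 2) * δ * invWeight x₀)
    (fun x => measurable_setIntegral m1)
    (fun x => (measurable_setIntegral (m2 x)).add (measurable_setIntegral (m3 x)))
    (fun x _ z => ?_) (fun x _ z => ?_) (fun x hx => ?_)).trans ?_
  · have i1 := integrable_mul_bdd hda.integrable (sec mB' z) fun y => (hM' y z).2
    have i2 := integrable_mul_bdd ha.integrable (sec mB z) fun y => (hM y z).2
    have i3 := integrable_mul_bdd ha.integrable (sec mB' z) fun y => (hM' y z).2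
    have i4 := integrable_mul_bdd ha'.integrable (sec mB' z) fun y => (hM' y z).2
    simp only [mul_sub]
    rw [hJ.eqA, hJ'.eqA, integral_sub i2.integrableOn i3.integrableOn]
    simp only [Pi.sub_apply, sub_mul]
    rw [integral_sub i3.integrableOn i4.integrableOn]
    ring
  · have i1 := integrable_phase_mul hdb.integrable κ x z
    have i2 := integrable_phase_mul_bdd hdb.integrable (sec mA1 z) (fun y => bA1 y z) κ x z
    have i3 := integrable_phase_mul_bdd hb.integrable (sec mD z)
      (fun y => (norm_sub_le _ _).trans (add_le_add (hM y z).1 (hM' y z).1)) κ x z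
    have i4 := integrable_phase_mul_bdd hb.integrable (sec mA z) (fun y => (hM y z).1) κ x z
    have i5 := integrable_phase_mul_bdd hb'.integrable (sec mA' z) (fun y => (hM' y z).1) κ x z
    rw [hJ.eqB, hJ'.eqB, ← integral_sub i4.integrableOn i5.integrableOn,
      ← integral_add i1.integrableOn i2.integrableOn,
      ← integral_add (i1.fun_add i2).integrableOn i3.integrableOn]
    congr 1; funext y
    simp only [Pi.sub_apply]; ring
  · have hx0 : 0 ≤ x := le_trans hx₀ hx
    have hw : ∀ y > x, invWeight y ≤ invWeight x₀ := fun y hy =>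
      invWeight_anti hx₀ (hx.trans hy.le)
    have e1 : eLpNorm (fun z => ∫ y in Ioi x, (a - a') y * B' y z) 2 volume ≤
        2 * l21Norm (a - a') * (C' * invWeight x₀) :=
      (eLpNorm_setIntegral_le_of_norm_le measurableSet_Ioi m1
        fun y _ z => by rw [norm_mul]).trans (setLIntegral_coeff_mul_le hda fun y hy =>
          (le_add_self.trans (h' y (hx0.trans hy.le))).trans (by gcongr; exact hw y hy))
    have e2 : eLpNorm (fun z => ∫ y in Ioi x, phase κ z (x - y) * (b - b') y) 2 volume ≤
        2 * l21Norm (b - b') * invWeight x₀ :=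
      (eLpNorm_setIntegral_phase_coeff_le hκ hx0 hdb).trans
        (by gcongr; exact invWeight_anti hx₀ hx)
    have e3 : eLpNorm (fun z => ∫ y in Ioi x, phase κ z (x - y) * (b - b') y * (A' y z - 1)) 2
        volume ≤ 2 * l21Norm (b - b') * (C' * invWeight x₀) :=
      (eLpNorm_setIntegral_le_of_norm_le (X := fun y z => A' y z - 1) measurableSet_Ioi (m3 x)
        fun y _ z => by rw [norm_mul, norm_mul, norm_phase, one_mul]).trans
          (setLIntegral_coeff_mul_le hdb fun y hy =>
          (le_self_add.trans (h' y (hx0.trans hy.le))).trans (by gcongr; exact hw y hy))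
    calc _ ≤ 2 * l21Norm (a - a') * (C' * invWeight x₀) + (2 * l21Norm (b - b') * invWeight x₀ +
          2 * l21Norm (b - b') * (C' * invWeight x₀)) :=
          add_le_add e1 ((eLpNorm_add_le (measurable_setIntegral (m2 x)).aestronglyMeasurable
            (measurable_setIntegral (m3 x)).aestronglyMeasurable one_le_two).trans
              (add_le_add e2 e3))
      _ = (2 * C' * (l21Norm (a - a') + l21Norm (b - b')) + 2 * l21Norm (b - b')) *
            invWeight x₀ := by ring
      _ ≤ (2 * C' * δ + 2 * δ) * invWeight x₀ := by
          gcongr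
          exact le_add_self
      _ = _ := by ring
  · calc _ ≤ (gronwallConst R : ℝ≥0∞) * ((2 * C' + 2) * δ * invWeight x₀) := by
          gcongr; exact gronwallConst_ge ha hb
      _ = _ := by push_cast; ring

/-- Decay of a solution, by comparison with the solution `(1, 0)` for vanishing coefficients. -/
lemma exists_decay_bound (R : ℝ≥0) : ∃ C : ℝ≥0, ∀ {κ : ℝ} {a b : ℝ → ℂ} {A B : ℝ → ℝ → ℂ},
    |κ| = 2 → IsCoeff R a → IsCoeff R b → IsJostPair κ a b A B →
    ∀ x ≥ 0, eLpNorm (fun z => A x z - 1) 2 volume + eLpNorm (B x) 2 volume ≤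
      C * invWeight x := by
  obtain ⟨C, hC⟩ := exists_diff_bound R 0
  refine ⟨C * (R + R), fun {κ a b A B} hκ ha hb hJ x hx => ?_⟩
  have := hC hκ ha hb (isCoeff_zero R) (isCoeff_zero R) hJ (isJostPair_zero κ)
    (fun x _ => by simp) x hx
  simp only [sub_zero] at this
  refine this.trans ?_
  push_cast
  gcongr
  exacts [ha.bound, hb.bound]

end Estimates

/-! ### Translations in the spectral parameter -/

section Shift

lemma eLpNorm_comp_add_right {f : ℝ → ℂ} (hf : Measurable f) (t : ℝ) :
    eLpNorm (fun z => f (z + t)) 2 volume = eLpNorm f 2 volume :=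
  eLpNorm_comp_measurePreserving hf.aestronglyMeasurable (measurePreserving_add_right volume t)

/-- The factor `e^{iκht}` by which the oscillating factor changes when `z` is translated by `h`,
minus one. -/
noncomputable def twist (κ h t : ℝ) : ℂ := Complex.exp ((κ * h * t : ℝ) * Complex.I) - 1

lemma measurable_twist (κ h x : ℝ) : Measurable fun y => twist κ h (x - y) := by
  unfold twist; fun_prop

lemma phase_add_left (κ z h t : ℝ) :
    phase κ (z + h) t = phase κ z t + phase κ z t * twist κ h t := by
  rw [twist, mul_sub, mul_one, add_sub_cancel, phase, phase, ← Complex.exp_add]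
  push_cast; ring_nf

lemma norm_twist_le {κ : ℝ} (hκ : |κ| = 2) (h : ℝ) {x y : ℝ} (hx : 0 ≤ x) (hxy : x < y) :
    ‖twist κ h (x - y)‖ ≤ 2 * |h| * |y| := by
  rw [twist, mul_comm]
  refine (Real.norm_exp_I_mul_ofReal_sub_one_le).trans ?_
  rw [Real.norm_eq_abs, abs_mul, abs_mul, hκ]
  gcongr 2 * |h| * ?_
  rw [abs_sub_comm, abs_of_pos (sub_pos.2 hxy), abs_of_pos (hx.trans_lt hxy)]
  linarith

lemma enorm_twist_le {κ : ℝ} (hκ : |κ| = 2) (h : ℝ) {x y : ℝ} (hx : 0 ≤ x) (hxy : x < y) :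
    ‖twist κ h (x - y)‖ₑ ≤ 2 * ‖h‖ₑ * ‖y‖ₑ := by
  have := norm_twist_le hκ h hx hxy
  rw [← ofReal_norm (twist κ h (x - y)), Real.enorm_eq_ofReal_abs, Real.enorm_eq_ofReal_abs,
    ← ENNReal.ofReal_ofNat 2, ← ENNReal.ofReal_mul two_pos.le, ← ENNReal.ofReal_mul (by positivity)]
  exact ENNReal.ofReal_le_ofReal this

lemma norm_twist_le_two (κ h t : ℝ) : ‖twist κ h t‖ ≤ 2 := by
  refine (norm_sub_le _ _).trans ?_
  rw [Complex.norm_exp_ofReal_mul_I, norm_one]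
  norm_num

lemma integrable_twist_mul {c : ℝ → ℂ} (hc : Integrable c volume) (κ h x : ℝ) :
    Integrable (fun y => twist κ h (x - y) * c y) volume :=
  hc.bdd_mul (c := 2) (measurable_twist κ h x).aestronglyMeasurable
    (.of_forall fun _ => norm_twist_le_two _ _ _)

lemma eLpNorm_setIntegral_phase_twist_le {κ : ℝ} (hκ : |κ| = 2) (h : ℝ) {x : ℝ} (hx : 0 ≤ x)
    {c : ℝ → ℂ} {R : ℝ≥0} (hc : IsCoeff R c) :
    eLpNorm (fun z => ∫ y in Ioi x, phase κ z (x - y) * (twist κ h (x - y) * c y)) 2 volume ≤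
      4 * l21Norm c * ‖h‖ₑ := by
  have hb : eLpNorm (fun y => twist κ h (x - y) * c y) 2 (volume.restrict (Ioi x)) ≤
      2 * ‖h‖ₑ * l21Norm c := by
    have e : ‖(2 * h : ℝ)‖ₑ = 2 * ‖h‖ₑ := by
      rw [enorm_mul]; congr 1
      rw [Real.enorm_of_nonneg two_pos.le, ENNReal.ofReal_ofNat]
    rw [l21Norm, ← e, ← eLpNorm_const_smul]
    refine le_trans ?_ (eLpNorm_mono_measure _ (Measure.restrict_le_self (s := Ioi x)))
    refine eLpNorm_mono_ae ?_
    filter_upwards [ae_restrict_mem measurableSet_Ioi] with y hy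
    rw [norm_mul, Pi.smul_apply, norm_smul, weighted, norm_smul, Real.norm_eq_abs,
      Real.norm_of_nonneg (Real.sqrt_nonneg _), abs_mul, abs_two, ← mul_assoc]
    gcongr
    refine (norm_twist_le hκ h hx hy).trans ?_
    gcongr
    exact abs_le_sqrt_one_add_sq y
  refine (eLpNorm_setIntegral_phase_le hκ x measurableSet_Ioi
    (integrable_twist_mul hc.integrable κ h x).integrableOn ?_).trans ?_
  · refine ⟨((measurable_twist κ h x).mul hc.meas).aestronglyMeasurable, hb.trans_lt ?_⟩
    exact ENNReal.mul_lt_top (by finiteness) hc.memL21.2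
  · calc _ ≤ 2 * (2 * ‖h‖ₑ * l21Norm c) := by gcongr
      _ = _ := by ring

lemma setLIntegral_twist_mul_le {κ : ℝ} (hκ : |κ| = 2) (h : ℝ) {x : ℝ} (hx : 0 ≤ x)
    {c : ℝ → ℂ} {R : ℝ≥0} (hc : IsCoeff R c) {N : ℝ → ℝ≥0∞} {K : ℝ≥0∞}
    (hN : ∀ y > x, N y ≤ K * invWeight y) :
    ∫⁻ y in Ioi x, ‖twist κ h (x - y) * c y‖ₑ * N y ≤ 4 * l21Norm c * K * ‖h‖ₑ := by
  calc ∫⁻ y in Ioi x, ‖twist κ h (x - y) * c y‖ₑ * N y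
      ≤ ∫⁻ y in Ioi x, ‖c y‖ₑ * (2 * ‖h‖ₑ * K) := by
        refine setLIntegral_mono_ae' measurableSet_Ioi (.of_forall fun y hy => ?_)
        rw [enorm_mul]
        calc _ ≤ 2 * ‖h‖ₑ * ‖y‖ₑ * ‖c y‖ₑ * (K * invWeight y) := by
              gcongr
              · exact enorm_twist_le hκ h hx hy
              · exact hN y hy
          _ = ‖c y‖ₑ * (2 * ‖h‖ₑ * K) * (‖y‖ₑ * invWeight y) := by ring
          _ ≤ ‖c y‖ₑ * (2 * ‖h‖ₑ * K) * 1 := by gcongr; exact enorm_mul_invWeight_le_one y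
          _ = _ := mul_one _
    _ ≤ 2 * l21Norm c * (2 * ‖h‖ₑ * K) := setLIntegral_coeff_mul_le hc fun _ _ => le_rfl
    _ = _ := by ring

/-- Translations in `z` of the difference of two solutions. The estimate depends on the second
solution through the bounds `C'` and `K'` only. -/
lemma exists_diff_shift_bound_aux (R C' K' : ℝ≥0) : ∃ C : ℝ≥0, ∀ {κ : ℝ} {a b a' b' : ℝ → ℂ}
    {A B A' B' : ℝ → ℝ → ℂ}, |κ| = 2 → IsCoeff R a → IsCoeff R b → IsCoeff R a' → IsCoeff R b' →
    IsJostPair κ a b A B → IsJostPair κ a' b' A' B' →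
    (∀ x ≥ 0, eLpNorm (fun z => A' x z - 1) 2 volume + eLpNorm (B' x) 2 volume ≤
      C' * invWeight x) →
    (∀ x ≥ 0, ∀ h : ℝ, eLpNorm (fun z => A' x (z + h) - A' x z) 2 volume +
      eLpNorm (fun z => B' x (z + h) - B' x z) 2 volume ≤ K' * ‖h‖ₑ) →
    ∀ x ≥ 0, ∀ h : ℝ,
      eLpNorm (fun z => (A x (z + h) - A' x (z + h)) - (A x z - A' x z)) 2 volume +
      eLpNorm (fun z => (B x (z + h) - B' x (z + h)) - (B x z - B' x z)) 2 volume ≤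
      C * (l21Norm (a - a') + l21Norm (b - b')) * ‖h‖ₑ := by
  obtain ⟨C₂, hC₂⟩ := exists_diff_bound R C'
  refine ⟨gronwallConst R * (2 * K' + 4 * R * C₂ + 4 + 4 * C'),
    fun {κ a b a' b' A B A' B'} hκ ha hb ha' hb' hJ hJ' h' hs' x₀ hx₀ h => ?_⟩
  have hD := hC₂ hκ ha hb ha' hb' hJ hJ' h'
  obtain ⟨M, hM⟩ := hJ.bdd
  obtain ⟨M', hM'⟩ := hJ'.bdd
  have hda := ha.sub ha'
  have hdb := hb.sub hb'
  set δ := l21Norm (a - a') + l21Norm (b - b') with hδ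
  have mA := hJ.measA
  have mB := hJ.measB
  have mA' := hJ'.measA
  have mB' := hJ'.measB
  have sec : ∀ {f : ℝ → ℝ → ℂ}, Measurable (Function.uncurry f) → ∀ z, Measurable fun y => f y z :=
    fun hf z => hf.comp measurable_prodMk_right
  have sec' : ∀ {f : ℝ → ℝ → ℂ}, Measurable (Function.uncurry f) → ∀ y, Measurable (f y) :=
    fun hf z => hf.comp measurable_prodMk_left
  have sh : ∀ {f : ℝ → ℝ → ℂ}, Measurable (Function.uncurry f) →
      Measurable (Function.uncurry fun y z => f y (z + h)) := fun hf =>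
    hf.comp (measurable_fst.prodMk (measurable_snd.add_const h))
  have mD : Measurable (Function.uncurry fun y z => A y z - A' y z) := mA.sub mA'
  have mE : Measurable (Function.uncurry fun y z => B y z - B' y z) := mB.sub mB'
  have mDs : Measurable (Function.uncurry fun y z => A y (z + h) - A' y (z + h)) := sh mD
  have mEs : Measurable (Function.uncurry fun y z => B y (z + h) - B' y (z + h)) := sh mE
  have mΔD : Measurable (Function.uncurry fun y z =>
      (A y (z + h) - A' y (z + h)) - (A y z - A' y z)) := mDs.sub mD
  have mΔE : Measurable (Function.uncurry fun y z =>
      (B y (z + h) - B' y (z + h)) - (B y z - B' y z)) := mEs.sub mE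
  have mA1 : Measurable (Function.uncurry fun y z => A' y z - 1) := mA'.sub measurable_const
  have mA1s : Measurable (Function.uncurry fun y z => A' y (z + h) - 1) := sh mA1
  have mΔA' : Measurable (Function.uncurry fun y z => A' y (z + h) - A' y z) := (sh mA').sub mA'
  have mΔB' : Measurable (Function.uncurry fun y z => B' y (z + h) - B' y z) := (sh mB').sub mB'
  have mph := measurable_phase_comp κ
  have fst' : ∀ {c : ℝ → ℂ}, Measurable c → Measurable (Function.uncurry fun y (_ : ℝ) => c y) :=
    fun hc => hc.comp measurable_fst
  have m1 : Measurable (Function.uncurry fun y z => (a - a') y * (B' y (z + h) - B' y z)) :=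
    (fst' hda.meas).mul mΔB'
  have m2 : ∀ x, Measurable (Function.uncurry fun y z =>
      phase κ z (x - y) * (twist κ h (x - y) * b y) * (A y (z + h) - A' y (z + h))) := fun x =>
    ((mph x).mul (fst' ((measurable_twist κ h x).mul hb.meas))).mul mDs
  have m3 : ∀ x, Measurable (Function.uncurry fun y z =>
      phase κ z (x - y) * (twist κ h (x - y) * (b - b') y)) := fun x =>
    (mph x).mul (fst' ((measurable_twist κ h x).mul hdb.meas))
  have m4 : ∀ x, Measurable (Function.uncurry fun y z =>
      phase κ z (x - y) * (twist κ h (x - y) * (b - b') y) * (A' y (z + h) - 1)) := fun x =>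
    (m3 x).mul mA1s
  have m5 : ∀ x, Measurable (Function.uncurry fun y z =>
      phase κ z (x - y) * (b - b') y * (A' y (z + h) - A' y z)) := fun x =>
    ((mph x).mul (fst' hdb.meas)).mul mΔA'
  have bD : ∀ y z, ‖A y z - A' y z‖ ≤ M + M' := fun y z =>
    (norm_sub_le _ _).trans (add_le_add (hM y z).1 (hM' y z).1)
  have bE : ∀ y z, ‖B y z - B' y z‖ ≤ M + M' := fun y z =>
    (norm_sub_le _ _).trans (add_le_add (hM y z).2 (hM' y z).2)
  have bA1 : ∀ x z, ‖A' x z - 1‖ ≤ M' + 1 := fun x z =>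
    (norm_sub_le _ _).trans (by simpa using (hM' x z).1)
  have bΔA' : ∀ y z, ‖A' y (z + h) - A' y z‖ ≤ M' + M' := fun y z =>
    (norm_sub_le _ _).trans (add_le_add (hM' y _).1 (hM' y z).1)
  -- the translated phase is `phase + phase * twist`, and `A'` is again split as `1 + (A' - 1)`
  refine (eLpNorm_volterra_le (κ := κ) ha.meas hb.meas ha.integrable hb.integrable
    (A := fun x z => (A x (z + h) - A' x (z + h)) - (A x z - A' x z))
    (B := fun x z => (B x (z + h) - B' x (z + h)) - (B x z - B' x z))
    (M := (M + M') + (M + M'))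
    (α := fun x z => ∫ y in Ioi x, (a - a') y * (B' y (z + h) - B' y z))
    (β := fun x z =>
      ((∫ y in Ioi x, phase κ z (x - y) * (twist κ h (x - y) * b y) *
        (A y (z + h) - A' y (z + h))) +
      (∫ y in Ioi x, phase κ z (x - y) * (twist κ h (x - y) * (b - b') y))) +
      ((∫ y in Ioi x, phase κ z (x - y) * (twist κ h (x - y) * (b - b') y) *
        (A' y (z + h) - 1)) +
      ∫ y in Ioi x, phase κ z (x - y) * (b - b') y * (A' y (z + h) - A' y z)))
    mΔD mΔE
    (fun x z => (norm_sub_le _ _).trans (add_le_add (bD x _) (bD x z)))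
    (fun x z => (norm_sub_le _ _).trans (add_le_add (bE x _) (bE x z)))
    (G := (2 * K' + 4 * R * C₂ + 4 + 4 * C') * δ * ‖h‖ₑ)
    (fun x => measurable_setIntegral m1)
    (fun x => ((measurable_setIntegral (m2 x)).add (measurable_setIntegral (m3 x))).add
      ((measurable_setIntegral (m4 x)).add (measurable_setIntegral (m5 x))))
    (fun x _ z => ?_) (fun x _ z => ?_) (fun x hx => ?_)).trans ?_
  · have iB := fun z => integrable_mul_bdd ha.integrable (sec mB z) fun y => (hM y z).2
    have iB' := fun z => integrable_mul_bdd ha'.integrable (sec mB' z) fun y => (hM' y z).2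
    have iBB : ∀ z, Integrable (fun y => a y * B y z - a' y * B' y z) volume :=
      fun z => (iB z).sub (iB' z)
    have i1 := integrable_mul_bdd hda.integrable (sec mΔB' z)
      (M := M' + M') fun y => (norm_sub_le _ _).trans (add_le_add (hM' y _).2 (hM' y z).2)
    have i2 := integrable_mul_bdd ha.integrable (sec mΔE z)
      fun y => (norm_sub_le _ _).trans (add_le_add (bE y _) (bE y z))
    rw [hJ.eqA, hJ'.eqA, hJ.eqA, hJ'.eqA, add_sub_add_left_eq_sub, add_sub_add_left_eq_sub,
      ← integral_sub (iB _).integrableOn (iB' _).integrableOn,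
      ← integral_sub (iB _).integrableOn (iB' _).integrableOn,
      ← integral_sub (iBB _).integrableOn (iBB _).integrableOn,
      ← integral_add i1.integrableOn i2.integrableOn]
    congr 1; funext y
    simp only [Pi.sub_apply]; ring
  · have iA := fun z => integrable_phase_mul_bdd hb.integrable (sec mA z)
      (fun y => (hM y z).1) κ x z
    have iA' := fun z => integrable_phase_mul_bdd hb'.integrable (sec mA' z)
      (fun y => (hM' y z).1) κ x z
    have iAA : ∀ z, Integrable (fun y => phase κ z (x - y) * b y * A y z -
      phase κ z (x - y) * b' y * A' y z) volume := fun z => (iA z).sub (iA' z)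
    have i2 := integrable_phase_mul_bdd (integrable_twist_mul hb.integrable κ h x) (sec mDs z)
      (fun y => bD y _) κ x z
    have i3 := integrable_phase_mul (integrable_twist_mul hdb.integrable κ h x) κ x z
    have i4 := integrable_phase_mul_bdd (integrable_twist_mul hdb.integrable κ h x) (sec mA1s z)
      (fun y => bA1 y _) κ x z
    have i5 := integrable_phase_mul_bdd hdb.integrable (sec mΔA' z) (fun y => bΔA' y z) κ x z
    have i6 := integrable_phase_mul_bdd hb.integrable (sec mΔD z)
      (fun y => (norm_sub_le _ _).trans (add_le_add (bD y _) (bD y z))) κ x z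
    rw [hJ.eqB, hJ'.eqB, hJ.eqB, hJ'.eqB,
      ← integral_sub (iA _).integrableOn (iA' _).integrableOn,
      ← integral_sub (iA _).integrableOn (iA' _).integrableOn,
      ← integral_sub (iAA _).integrableOn (iAA _).integrableOn,
      ← integral_add i2.integrableOn i3.integrableOn,
      ← integral_add i4.integrableOn i5.integrableOn,
      ← integral_add (i2.fun_add i3).integrableOn (i4.fun_add i5).integrableOn,
      ← integral_add ((i2.fun_add i3).fun_add (i4.fun_add i5)).integrableOn i6.integrableOn]
    congr 1; funext y
    simp only [Pi.sub_apply, phase_add_left]; ring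
  · have hx0 : 0 ≤ x := le_trans hx₀ hx
    have e1 : eLpNorm (fun z => ∫ y in Ioi x, (a - a') y * (B' y (z + h) - B' y z)) 2 volume ≤
        2 * l21Norm (a - a') * (K' * ‖h‖ₑ) :=
      (eLpNorm_setIntegral_le_of_norm_le (X := fun y z => B' y (z + h) - B' y z)
        measurableSet_Ioi m1 fun y _ z => by rw [norm_mul]).trans
        (setLIntegral_coeff_mul_le hda fun y hy => le_add_self.trans (hs' y (hx0.trans hy.le) h))
    have e2 : eLpNorm (fun z => ∫ y in Ioi x, phase κ z (x - y) * (twist κ h (x - y) * b y) *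
        (A y (z + h) - A' y (z + h))) 2 volume ≤ 4 * l21Norm b * (C₂ * δ) * ‖h‖ₑ :=
      (eLpNorm_setIntegral_le_of_norm_le (X := fun y z => A y (z + h) - A' y (z + h))
        (c := fun y => twist κ h (x - y) * b y) measurableSet_Ioi (m2 x) fun y _ z => by
          rw [norm_mul, norm_mul, norm_phase, one_mul]).trans
        (setLIntegral_twist_mul_le hκ h hx0 hb fun y hy => by
          rw [eLpNorm_comp_add_right (sec' mD y)]
          exact le_self_add.trans (hD y (hx0.trans hy.le)))
    have e3 := eLpNorm_setIntegral_phase_twist_le hκ h hx0 hdb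
    have e4 : eLpNorm (fun z => ∫ y in Ioi x, phase κ z (x - y) *
        (twist κ h (x - y) * (b - b') y) * (A' y (z + h) - 1)) 2 volume ≤
        4 * l21Norm (b - b') * C' * ‖h‖ₑ :=
      (eLpNorm_setIntegral_le_of_norm_le (X := fun y z => A' y (z + h) - 1)
        (c := fun y => twist κ h (x - y) * (b - b') y) measurableSet_Ioi (m4 x) fun y _ z => by
          rw [norm_mul, norm_mul, norm_phase, one_mul]).trans
        (setLIntegral_twist_mul_le hκ h hx0 hdb fun y hy => by
          rw [eLpNorm_comp_add_right (sec' mA1 y)]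
          exact le_self_add.trans (h' y (hx0.trans hy.le)))
    have e5 : eLpNorm (fun z => ∫ y in Ioi x, phase κ z (x - y) * (b - b') y *
        (A' y (z + h) - A' y z)) 2 volume ≤ 2 * l21Norm (b - b') * (K' * ‖h‖ₑ) :=
      (eLpNorm_setIntegral_le_of_norm_le (X := fun y z => A' y (z + h) - A' y z)
        measurableSet_Ioi (m5 x) fun y _ z => by
          rw [norm_mul, norm_mul, norm_phase, one_mul]).trans
        (setLIntegral_coeff_mul_le hdb fun y hy => le_self_add.trans (hs' y (hx0.trans hy.le) h))
    have sm := fun {f : ℝ → ℝ → ℂ} (hf : Measurable (Function.uncurry f)) =>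
      (measurable_setIntegral (S := Ioi x) hf).aestronglyMeasurable (μ := volume)
    calc _ ≤ 2 * l21Norm (a - a') * (K' * ‖h‖ₑ) +
          ((4 * l21Norm b * (C₂ * δ) * ‖h‖ₑ + 4 * l21Norm (b - b') * ‖h‖ₑ) +
          (4 * l21Norm (b - b') * C' * ‖h‖ₑ + 2 * l21Norm (b - b') * (K' * ‖h‖ₑ))) :=
          add_le_add e1 ((eLpNorm_add_le ((sm (m2 x)).add (sm (m3 x)))
            ((sm (m4 x)).add (sm (m5 x))) one_le_two).trans (add_le_add
              ((eLpNorm_add_le (sm (m2 x)) (sm (m3 x)) one_le_two).trans (add_le_add e2 e3))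
              ((eLpNorm_add_le (sm (m4 x)) (sm (m5 x)) one_le_two).trans (add_le_add e4 e5))))
      _ = (2 * K' * (l21Norm (a - a') + l21Norm (b - b')) + 4 * l21Norm b * C₂ * δ +
            4 * l21Norm (b - b') + 4 * C' * l21Norm (b - b')) * ‖h‖ₑ := by ring
      _ ≤ (2 * K' * δ + 4 * R * C₂ * δ + 4 * δ + 4 * C' * δ) * ‖h‖ₑ := by
          gcongr
          · exact hb.bound
          · exact le_add_self
          · exact le_add_self
      _ = _ := by ring
  · calc _ ≤ (gronwallConst R : ℝ≥0∞) *
          ((2 * K' + 4 * R * C₂ + 4 + 4 * C') * δ * ‖h‖ₑ) := by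
          gcongr; exact gronwallConst_ge ha hb
      _ = _ := by push_cast; ring

/-- Translations of a solution in `z`, by comparison with the solution `(1, 0)` for vanishing
coefficients. -/
lemma exists_shift_bound (R : ℝ≥0) : ∃ C : ℝ≥0, ∀ {κ : ℝ} {a b : ℝ → ℂ} {A B : ℝ → ℝ → ℂ},
    |κ| = 2 → IsCoeff R a → IsCoeff R b → IsJostPair κ a b A B →
    ∀ x ≥ 0, ∀ h : ℝ, eLpNorm (fun z => A x (z + h) - A x z) 2 volume +
      eLpNorm (fun z => B x (z + h) - B x z) 2 volume ≤ C * ‖h‖ₑ := by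
  obtain ⟨C, hC⟩ := exists_diff_shift_bound_aux R 0 0
  refine ⟨C * (R + R), fun {κ a b A B} hκ ha hb hJ x hx h => ?_⟩
  have := hC hκ ha hb (isCoeff_zero R) (isCoeff_zero R) hJ (isJostPair_zero κ)
    (fun x _ => by simp) (fun x _ h => by simp) x hx h
  simp only [sub_zero, sub_sub_sub_cancel_right] at this
  refine this.trans ?_
  push_cast
  gcongr
  exacts [ha.bound, hb.bound]

/-- Lipschitz dependence on the coefficients of the solutions and of their translations in `z`. -/
lemma exists_lipschitz_bound (R : ℝ≥0) : ∃ C : ℝ≥0, ∀ {κ : ℝ} {a b a' b' : ℝ → ℂ}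
    {A B A' B' : ℝ → ℝ → ℂ}, |κ| = 2 → IsCoeff R a → IsCoeff R b → IsCoeff R a' → IsCoeff R b' →
    IsJostPair κ a b A B → IsJostPair κ a' b' A' B' → ∀ x ≥ 0,
      (eLpNorm (fun z => A x z - A' x z) 2 volume +
        eLpNorm (fun z => B x z - B' x z) 2 volume ≤
        C * (l21Norm (a - a') + l21Norm (b - b')) * invWeight x) ∧
      ∀ h : ℝ, eLpNorm (fun z => (A x (z + h) - A' x (z + h)) - (A x z - A' x z)) 2 volume +
        eLpNorm (fun z => (B x (z + h) - B' x (z + h)) - (B x z - B' x z)) 2 volume ≤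
        C * (l21Norm (a - a') + l21Norm (b - b')) * ‖h‖ₑ := by
  obtain ⟨C₁, h₁⟩ := exists_decay_bound R
  obtain ⟨K₁, k₁⟩ := exists_shift_bound R
  obtain ⟨C, hC⟩ := exists_diff_bound R C₁
  obtain ⟨K, hK⟩ := exists_diff_shift_bound_aux R C₁ K₁
  refine ⟨max C K, fun hκ ha hb ha' hb' hJ hJ' x hx => ⟨?_, fun h => ?_⟩⟩
  · refine (hC hκ ha hb ha' hb' hJ hJ' (h₁ hκ ha' hb' hJ') x hx).trans ?_
    gcongr
    exact le_max_left _ _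
  · refine (hK hκ ha hb ha' hb' hJ hJ' (h₁ hκ ha' hb' hJ') (k₁ hκ ha' hb' hJ') x hx h).trans ?_
    gcongr
    exact le_max_right _ _

end Shift

/-! ### Second order terms of the large `z` expansion -/

section SecondOrder

open Filter Topology

/-- A coefficient in the weighted space which is the primitive of a function with `L²` norm at most
`R`. -/
structure IsSmoothCoeff (R : ℝ≥0) (b db : ℝ → ℂ) : Prop extends IsCoeff R b where
  prim : IsPrimitive b db
  meas_deriv : Measurable db
  deriv_bound : eLpNorm db 2 volume ≤ R

lemma IsSmoothCoeff.memLp_deriv {R : ℝ≥0} {b db : ℝ → ℂ} (h : IsSmoothCoeff R b db) :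
    MemLp db 2 volume :=
  ⟨h.meas_deriv.aestronglyMeasurable, h.deriv_bound.trans_lt ENNReal.coe_lt_top⟩

lemma isSmoothCoeff_zero (R : ℝ≥0) : IsSmoothCoeff R 0 0 :=
  { isCoeff_zero R with
    prim := ⟨continuous_const.locallyIntegrable, by simp⟩
    meas_deriv := measurable_zero
    deriv_bound := by simp }

lemma IsPrimitive.enorm_le_tail {b db : ℝ → ℂ} (h : IsPrimitive b db) (hdb : Measurable db)
    (x : ℝ) : ‖b x‖ₑ ≤ eLpNorm b 2 (volume.restrict (Ioi x)) +
      eLpNorm db 2 (volume.restrict (Ioi x)) := by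
  set μ := (volume : Measure ℝ).restrict (Ioc x (x + 1)) with hμ
  have hμ1 : μ univ = 1 := by simp [hμ]
  have hle : μ ≤ volume.restrict (Ioi x) := Measure.restrict_mono Ioc_subset_Ioi_self le_rfl
  have h1 : ∀ {f : ℝ → ℂ}, Measurable f → ∫⁻ y, ‖f y‖ₑ ∂μ ≤ eLpNorm f 2 (volume.restrict (Ioi x)) :=
    fun {f} hf => by
      rw [← eLpNorm_one_eq_lintegral_enorm]
      refine (eLpNorm_le_eLpNorm_mul_rpow_measure_univ one_le_two
        hf.aestronglyMeasurable).trans ?_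
      rw [hμ1, ENNReal.one_rpow, mul_one]
      exact eLpNorm_mono_measure _ hle
  have h2 : ∀ y ∈ Ioc x (x + 1), ‖b x‖ₑ ≤ ‖b y‖ₑ + ∫⁻ t, ‖db t‖ₑ ∂μ := fun y hy => by
    have e : b x = b y - ∫ t in x..y, db t := by rw [h.2]; abel
    rw [e]
    refine enorm_sub_le.trans ?_
    gcongr
    rw [intervalIntegral.integral_of_le hy.1.le]
    refine (enorm_integral_le_lintegral_enorm _).trans (lintegral_mono' ?_ le_rfl)
    exact Measure.restrict_mono (Ioc_subset_Ioc_right hy.2) le_rfl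
  calc ‖b x‖ₑ = ∫⁻ _, ‖b x‖ₑ ∂μ := by rw [lintegral_const, hμ1, mul_one]
    _ ≤ ∫⁻ y, (‖b y‖ₑ + ∫⁻ t, ‖db t‖ₑ ∂μ) ∂μ :=
        setLIntegral_mono_ae' measurableSet_Ioc (.of_forall h2)
    _ = ∫⁻ y, ‖b y‖ₑ ∂μ + ∫⁻ t, ‖db t‖ₑ ∂μ := by
        rw [lintegral_add_right _ measurable_const, lintegral_const, hμ1, mul_one]
    _ ≤ _ := add_le_add (h1 h.continuous.measurable) (h1 hdb)

lemma IsPrimitive.enorm_le {b db : ℝ → ℂ} (h : IsPrimitive b db) (hdb : Measurable db) (x : ℝ) :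
    ‖b x‖ₑ ≤ eLpNorm b 2 volume + eLpNorm db 2 volume :=
  (h.enorm_le_tail hdb x).trans (add_le_add (eLpNorm_mono_measure _ Measure.restrict_le_self)
    (eLpNorm_mono_measure _ Measure.restrict_le_self))

lemma tendsto_eLpNorm_restrict_Ioi {f : ℝ → ℂ} (hf : MemLp f 2 volume) :
    Tendsto (fun n : ℕ => eLpNorm f 2 (volume.restrict (Ioi (n : ℝ)))) atTop (𝓝 0) := by
  have hfin : ∫⁻ y, ‖f y‖ₑ ^ 2 ≠ ⊤ := by
    have := hf.2
    rw [eLpNorm_two_eq] at this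
    intro h
    rw [h, ENNReal.top_rpow_of_pos (by norm_num)] at this
    exact lt_irrefl _ this
  have h1 : Tendsto (fun n : ℕ => ∫⁻ y in Ioi (n : ℝ), ‖f y‖ₑ ^ 2) atTop (𝓝 0) := by
    have hm : ∀ n : ℕ, ∫⁻ y in Ioi (n : ℝ), ‖f y‖ₑ ^ 2 =
        (volume.withDensity fun y => ‖f y‖ₑ ^ 2) (Ioi (n : ℝ)) := fun n =>
      (withDensity_apply _ measurableSet_Ioi).symm
    simp_rw [hm]
    have hemp : (⋂ n : ℕ, Ioi (n : ℝ)) = ∅ := by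
      refine eq_empty_of_forall_notMem fun x hx => ?_
      obtain ⟨n, hn⟩ := exists_nat_gt x
      exact lt_asymm hn (mem_iInter.1 hx n)
    have := tendsto_measure_iInter_atTop (μ := volume.withDensity fun y => ‖f y‖ₑ ^ 2)
      (s := fun n : ℕ => Ioi (n : ℝ)) (fun n => measurableSet_Ioi.nullMeasurableSet)
      (fun m n hmn => Ioi_subset_Ioi (by exact_mod_cast hmn)) ⟨0, ?_⟩
    · rwa [hemp, measure_empty] at this
    · rw [← hm]
      exact ne_top_of_le_ne_top hfin (setLIntegral_le_lintegral _ _)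
  simp_rw [eLpNorm_two_eq]
  have := (ENNReal.continuous_rpow_const (y := (1 / 2 : ℝ))).continuousAt.tendsto.comp h1
  simpa [Function.comp_def] using this

lemma IsSmoothCoeff.tendsto_zero {R : ℝ≥0} {b db : ℝ → ℂ} (h : IsSmoothCoeff R b db) :
    Tendsto (fun n : ℕ => b n) atTop (𝓝 0) := by
  have h1 := (tendsto_eLpNorm_restrict_Ioi h.memL21.memLp).add
    (tendsto_eLpNorm_restrict_Ioi h.memLp_deriv)
  rw [add_zero] at h1
  have h2 : Tendsto (fun n : ℕ => ‖b n‖ₑ) atTop (𝓝 0) :=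
    tendsto_of_tendsto_of_tendsto_of_le_of_le tendsto_const_nhds h1 (fun _ => zero_le)
      fun n => h.prim.enorm_le_tail h.meas_deriv n
  exact tendsto_zero_iff_enorm_tendsto_zero.2 h2

variable {κ : ℝ} {a b db a' b' db' : ℝ → ℂ} {A B A' B' : ℝ → ℝ → ℂ} {R : ℝ≥0}

lemma isPrimitive_phase (κ z x : ℝ) :
    IsPrimitive (fun y => phase κ z (x - y))
      (fun y => -(Complex.I * κ * (z + 1)) * phase κ z (x - y)) := by
  refine .of_hasDerivAt (fun y => ?_) ?_
  · unfold phase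
    have h1 : HasDerivAt (fun y : ℝ => ((κ * (z + 1) * (x - y) : ℝ) : ℂ) * Complex.I)
        (((κ * (z + 1) * (-1) : ℝ) : ℂ) * Complex.I) y :=
      ((((hasDerivAt_id y).const_sub x).const_mul (κ * (z + 1))).ofReal_comp).mul_const _
    convert! h1.cexp using 1
    push_cast; ring
  · exact continuous_const.mul ((continuous_phase κ).comp
      (continuous_const.prodMk (continuous_const.sub continuous_id)))

lemma IsJostPair.isPrimitive (hJ : IsJostPair κ a b A B) (ha : Integrable a volume) (z : ℝ) :
    IsPrimitive (fun y => A y z) (fun y => -(a y * B y z)) := by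
  obtain ⟨M, hM⟩ := hJ.bdd
  have hi : Integrable (fun y => a y * B y z) volume :=
    integrable_mul_bdd ha (hJ.measB.comp measurable_prodMk_right) fun y => (hM y z).2
  refine ⟨hi.neg.locallyIntegrable, fun x y => ?_⟩
  beta_reduce
  rw [intervalIntegral.integral_neg, hJ.eqA, hJ.eqA, ← intervalIntegral.integral_interval_add_Ioi
    (a := x) (b := y) hi.integrableOn hi.integrableOn]
  ring

lemma IsJostPair.intervalIntegrable_phase (hJ : IsJostPair κ a b A B) (ha : Integrable a volume)
    (hb : IsPrimitive b db) (x T z : ℝ) :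
    IntervalIntegrable (fun y => phase κ z (x - y) * (db y * A y z - b y * a y * B y z))
      volume x T := by
  refine ((intervalIntegrable_of_locallyIntegrable (hb.mul (hJ.isPrimitive ha z)).1
    x T).continuousOn_mul (isPrimitive_phase κ z x).continuous.continuousOn).congr fun y _ => ?_
  ring

/-- Integration by parts in the Volterra integral for `B`, truncated at `T`. -/
lemma IsJostPair.integral_by_parts (hJ : IsJostPair κ a b A B) (ha : Integrable a volume)
    (hb : IsPrimitive b db) (x T z : ℝ) :
    ∫ y in x..T, phase κ z (x - y) * (db y * A y z - b y * a y * B y z) =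
      Complex.I * κ * (z + 1) * (∫ y in x..T, phase κ z (x - y) * b y * A y z) +
        phase κ z (x - T) * b T * A T z - b x * A x z := by
  have hP := hJ.isPrimitive ha z
  have hbA := hb.mul hP
  have h := (isPrimitive_phase κ z x).mul hbA
  have hph0 : phase κ z 0 = 1 := by simp [phase]
  have hph : Continuous fun y => phase κ z (x - y) := (isPrimitive_phase κ z x).continuous
  have i1 := hJ.intervalIntegrable_phase ha hb x T z
  have i2 : IntervalIntegrable (fun y => phase κ z (x - y) * b y * A y z) volume x T :=
    ((hph.mul hb.continuous).mul hP.continuous).intervalIntegrable _ _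
  have e := h.2 x T
  simp only [sub_self, hph0] at e
  have e1 : ∫ y in x..T, (phase κ z (x - y) * (b y * -(a y * B y z) + db y * A y z) +
        -(Complex.I * κ * (z + 1)) * phase κ z (x - y) * (b y * A y z)) =
      (∫ y in x..T, phase κ z (x - y) * (db y * A y z - b y * a y * B y z)) -
        Complex.I * κ * (z + 1) * ∫ y in x..T, phase κ z (x - y) * b y * A y z := by
    rw [← intervalIntegral.integral_const_mul,
      ← intervalIntegral.integral_sub i1 (i2.const_mul _)]
    congr 1; funext y; ring
  rw [e1] at e
  linear_combination e

/-- The derivative of `B` in `x`, written as an improper integral: the boundary term at `n`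
disappears in the limit because `b(n)` tends to zero. -/
lemma IsJostPair.tendsto_integral_deriv (hJ : IsJostPair κ a b A B) (ha : Integrable a volume)
    (hb : IsSmoothCoeff R b db) (x z : ℝ) :
    Tendsto (fun n : ℕ => ∫ y in x..n, phase κ z (x - y) * (db y * A y z - b y * a y * B y z))
      atTop (𝓝 (Complex.I * κ * (z + 1) * B x z - b x * A x z)) := by
  obtain ⟨M, hM⟩ := hJ.bdd
  simp_rw [hJ.integral_by_parts ha hb.prim]
  refine Tendsto.sub ?_ tendsto_const_nhds
  rw [← add_zero (Complex.I * κ * (z + 1) * B x z)]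
  refine Tendsto.add (Tendsto.const_mul _ ?_) ?_
  · rw [hJ.eqB]
    exact intervalIntegral_tendsto_integral_Ioi x
      (integrable_phase_mul_bdd hb.integrable (hJ.measA.comp measurable_prodMk_right)
        (fun y => (hM y z).1) κ x z).integrableOn tendsto_natCast_atTop_atTop
  · refine squeeze_zero_norm (a := fun n : ℕ => ‖b n‖ * M) (fun n => ?_) ?_
    · rw [norm_mul, norm_mul, norm_phase, one_mul]
      gcongr
      exact (hM _ _).1
    · simpa using hb.tendsto_zero.norm.mul_const M

lemma IsSmoothCoeff.enorm_le {R : ℝ≥0} (h : IsSmoothCoeff R b db) (x : ℝ) : ‖b x‖ₑ ≤ 2 * R := by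
  rw [two_mul]
  exact (h.prim.enorm_le h.meas_deriv x).trans
    (add_le_add ((eLpNorm_le_l21Norm b).trans h.bound) h.deriv_bound)

lemma IsSmoothCoeff.enorm_sub_le {R : ℝ≥0} (h : IsSmoothCoeff R b db)
    (h' : IsSmoothCoeff R b' db') (x : ℝ) :
    ‖(b - b') x‖ₑ ≤ l21Norm (b - b') + eLpNorm (db - db') 2 volume :=
  (IsPrimitive.enorm_le (h.prim.sub h'.prim) (h.meas_deriv.sub h'.meas_deriv) x).trans
    (add_le_add (eLpNorm_le_l21Norm _) le_rfl)

lemma setLIntegral_invWeight_mul_le {f : ℝ → ℂ} (hf : Measurable f) (S : Set ℝ) :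
    ∫⁻ y in S, ‖f y‖ₑ * invWeight y ≤ 2 * eLpNorm f 2 volume := by
  refine (setLIntegral_le_lintegral _ _).trans ?_
  simp_rw [mul_comm ‖f _‖ₑ]
  exact lintegral_invWeight_mul_enorm_le hf.aestronglyMeasurable

/-- Lipschitz bound for `iκ(z+1)B - bA`, where `db` is only in `L²`: in the integrand `db A` the
part `db (A - 1)` is controlled because `A - 1` decays like the inverse weight. -/
lemma exists_deriv_diff_bound (R : ℝ≥0) : ∃ C : ℝ≥0, ∀ {κ : ℝ} {a b db a' b' db' : ℝ → ℂ}
    {A B A' B' : ℝ → ℝ → ℂ}, |κ| = 2 → IsCoeff R a → IsSmoothCoeff R b db → IsCoeff R a' →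
    IsSmoothCoeff R b' db' → IsJostPair κ a b A B → IsJostPair κ a' b' A' B' → ∀ x ≥ 0,
      eLpNorm (fun z => (Complex.I * κ * (z + 1) * B x z - b x * A x z) -
        (Complex.I * κ * (z + 1) * B' x z - b' x * A' x z)) 2 volume ≤
      C * (l21Norm (a - a') + l21Norm (b - b') + eLpNorm (db - db') 2 volume) := by
  obtain ⟨C₁, h₁⟩ := exists_decay_bound R
  obtain ⟨C₂, h₂⟩ := exists_lipschitz_bound R
  refine ⟨2 + 2 * C₁ + 2 * R * C₂ + (6 * R * C₁ + 4 * R * R * C₂),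
    fun {κ a b db a' b' db' A B A' B'} hκ ha hb ha' hb' hJ hJ' x hx => ?_⟩
  have hA1 := h₁ hκ ha hb.toIsCoeff hJ
  have hD := fun y hy => (h₂ hκ ha hb.toIsCoeff ha' hb'.toIsCoeff hJ hJ' y hy).1
  set δ := l21Norm (a - a') + l21Norm (b - b') with hδ
  set η := eLpNorm (db - db') 2 volume with hη
  have mA := hJ.measA
  have mB := hJ.measB
  have mA' := hJ'.measA
  have mB' := hJ'.measB
  have mdb := hb.meas_deriv
  have mdb' := hb'.meas_deriv
  have fst' : ∀ {c : ℝ → ℂ}, Measurable c → Measurable (Function.uncurry fun y (_ : ℝ) => c y) :=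
    fun hc => hc.comp measurable_fst
  -- the difference of the integrands without the oscillating factor and the term `db - db'`,
  -- which is only square integrable and is left to Plancherel
  let g : ℝ → ℝ → ℂ := fun y z =>
    ((db - db') y * (A y z - 1) + db' y * (A y z - A' y z)) -
      ((b y * a y - b' y * a' y) * B y z + b' y * a' y * (B y z - B' y z))
  have mg1 : Measurable (Function.uncurry fun y z => (db - db') y * (A y z - 1)) :=
    (fst' (mdb.sub mdb')).mul (mA.sub measurable_const)
  have mg2 : Measurable (Function.uncurry fun y z => db' y * (A y z - A' y z)) :=
    (fst' mdb').mul (mA.sub mA')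
  have mg3 : Measurable (Function.uncurry fun y z => (b y * a y - b' y * a' y) * B y z) :=
    (fst' ((hb.meas.mul ha.meas).sub (hb'.meas.mul ha'.meas))).mul mB
  have mg4 : Measurable (Function.uncurry fun y z => b' y * a' y * (B y z - B' y z)) :=
    (fst' (hb'.meas.mul ha'.meas)).mul (mB.sub mB')
  have mg : Measurable (Function.uncurry g) := (mg1.add mg2).sub (mg3.add mg4)
  have mpg : Measurable (Function.uncurry fun y z => phase κ z (x - y) * g y z) :=
    (measurable_phase_comp κ x).mul mg
  have mp1 : Measurable (Function.uncurry fun y z => phase κ z (x - y) * (db - db') y) :=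
    (measurable_phase_comp κ x).mul (fst' (mdb.sub mdb'))
  have ml2 : MemLp (db - db') 2 volume := hb.memLp_deriv.sub hb'.memLp_deriv
  have hg : ∀ y ≥ 0, eLpNorm (g y) 2 volume ≤
      (‖(db - db') y‖ₑ * invWeight y * C₁ + ‖db' y‖ₑ * invWeight y * (C₂ * δ)) +
      ((‖(a - a') y‖ₑ * (2 * R) * C₁ + ‖a' y‖ₑ * ((δ + η) * C₁)) +
        ‖a' y‖ₑ * (2 * R * (C₂ * δ))) := by
    intro y hy
    have cm : ∀ (c : ℂ) (f : ℝ → ℂ), eLpNorm (fun z => c * f z) 2 volume =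
        ‖c‖ₑ * eLpNorm f 2 volume := fun c f => by
      rw [← eLpNorm_const_smul]; rfl
    have sec : ∀ {f : ℝ → ℝ → ℂ}, Measurable (Function.uncurry f) →
      AEStronglyMeasurable (f y) volume := fun hf =>
      (hf.comp measurable_prodMk_left).aestronglyMeasurable
    have w1 := invWeight_le_one y
    refine (eLpNorm_sub_le ((sec mg1).add (sec mg2)) ((sec mg3).add (sec mg4)) one_le_two).trans
      (add_le_add
      ((eLpNorm_add_le (sec mg1) (sec mg2) one_le_two).trans (add_le_add ?_ ?_))
      ((eLpNorm_add_le (sec mg3) (sec mg4) one_le_two).trans (add_le_add ?_ ?_)))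
    · rw [cm, mul_assoc, mul_comm (invWeight y)]
      gcongr
      exact le_self_add.trans (hA1 y hy)
    · rw [cm, mul_assoc, mul_comm (invWeight y)]
      gcongr
      exact le_self_add.trans (hD y hy)
    · rw [cm]
      have hB : eLpNorm (B y) 2 volume ≤ C₁ :=
        (le_add_self.trans (hA1 y hy)).trans (mul_le_of_le_one_right' w1)
      have hba : ‖b y * a y - b' y * a' y‖ₑ ≤ ‖(a - a') y‖ₑ * (2 * R) + ‖a' y‖ₑ * (δ + η) := by
        have e : b y * a y - b' y * a' y = (a - a') y * b y + a' y * (b - b') y := by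
          simp only [Pi.sub_apply]; ring
        rw [e]
        refine (enorm_add_le _ _).trans ?_
        rw [enorm_mul, enorm_mul]
        gcongr
        · exact hb.enorm_le y
        · refine (hb.enorm_sub_le hb' y).trans ?_
          gcongr
          exact le_add_self
      calc _ ≤ (‖(a - a') y‖ₑ * (2 * R) + ‖a' y‖ₑ * (δ + η)) * C₁ := mul_le_mul' hba hB
        _ = _ := by ring
    · rw [cm, enorm_mul, mul_comm ‖b' y‖ₑ, mul_assoc]
      gcongr
      · exact hb'.enorm_le y
      · exact (le_add_self.trans (hD y hy)).trans (mul_le_of_le_one_right' w1)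
  let F : ℕ → ℝ → ℂ := fun n z => (∫ y in Ioc x n, phase κ z (x - y) * (db - db') y) +
    ∫ y in Ioc x n, phase κ z (x - y) * g y z
  have hF : ∀ n, eLpNorm (F n) 2 volume ≤
      (2 + 2 * C₁ + 2 * R * C₂ + (6 * R * C₁ + 4 * R * R * C₂) : ℝ≥0) * (δ + η) := by
    intro n
    have f1 : eLpNorm (fun z => ∫ y in Ioc x n, phase κ z (x - y) * (db - db') y) 2 volume ≤
        2 * η := by
      refine (eLpNorm_setIntegral_phase_le hκ x measurableSet_Ioc ?_ (ml2.restrict _)).trans ?_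
      · exact (ml2.locallyIntegrable one_le_two).integrableOn_isCompact isCompact_Icc |>.mono_set
          Ioc_subset_Icc_self
      · gcongr
        exact eLpNorm_mono_measure _ Measure.restrict_le_self
    have f2 : eLpNorm (fun z => ∫ y in Ioc x n, phase κ z (x - y) * g y z) 2 volume ≤
        (2 * η * C₁ + 2 * R * (C₂ * δ)) + ((2 * δ * (2 * R) * C₁ + 2 * R * ((δ + η) * C₁)) +
          2 * R * (2 * R * (C₂ * δ))) := by
      refine (eLpNorm_setIntegral_le_of_norm_le (X := g) (c := fun _ => 1) measurableSet_Ioc mpg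
        fun y _ z => by rw [norm_mul, norm_phase, norm_one]).trans ?_
      have k1 : Measurable fun y => ‖(db - db') y‖ₑ * invWeight y :=
        (mdb.sub mdb').enorm.mul measurable_invWeight
      have k2 : Measurable fun y => ‖db' y‖ₑ * invWeight y := mdb'.enorm.mul measurable_invWeight
      have k3 : Measurable fun y => ‖(a - a') y‖ₑ * (2 * R) :=
        (ha.meas.sub ha'.meas).enorm.mul_const _
      have m1 : Measurable fun y => ‖(db - db') y‖ₑ * invWeight y * C₁ := k1.mul_const _
      have m2 : Measurable fun y => ‖db' y‖ₑ * invWeight y * (C₂ * δ) := k2.mul_const _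
      have m3 : Measurable fun y => ‖(a - a') y‖ₑ * (2 * R) * C₁ := k3.mul_const _
      have m4 : Measurable fun y => ‖a' y‖ₑ * ((δ + η) * C₁) := ha'.meas.enorm.mul_const _
      have m12 : Measurable fun y =>
          ‖(db - db') y‖ₑ * invWeight y * C₁ + ‖db' y‖ₑ * invWeight y * (C₂ * δ) := m1.add m2
      have m34 : Measurable fun y =>
          ‖(a - a') y‖ₑ * (2 * R) * C₁ + ‖a' y‖ₑ * ((δ + η) * C₁) := m3.add m4
      have hR : l21Norm a' ≤ R := ha'.bound
      have hi : ∀ {R' : ℝ≥0} {c : ℝ → ℂ}, IsCoeff R' c →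
          ∫⁻ y in Ioc x n, ‖c y‖ₑ ≤ 2 * l21Norm c := fun {R' c} hc =>
        (setLIntegral_le_lintegral _ _).trans (lintegral_enorm_le hc.meas.aestronglyMeasurable)
      calc ∫⁻ y in Ioc x n, ‖(1 : ℂ)‖ₑ * eLpNorm (g y) 2 volume
          ≤ ∫⁻ y in Ioc x n,
            ((‖(db - db') y‖ₑ * invWeight y * C₁ + ‖db' y‖ₑ * invWeight y * (C₂ * δ)) +
            ((‖(a - a') y‖ₑ * (2 * R) * C₁ + ‖a' y‖ₑ * ((δ + η) * C₁)) +
              ‖a' y‖ₑ * (2 * R * (C₂ * δ)))) := by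
            refine setLIntegral_mono_ae' measurableSet_Ioc (.of_forall fun y hy => ?_)
            rw [enorm_one, one_mul]
            exact hg y (hx.trans hy.1.le)
        _ = ((∫⁻ y in Ioc x n, ‖(db - db') y‖ₑ * invWeight y) * C₁ +
              (∫⁻ y in Ioc x n, ‖db' y‖ₑ * invWeight y) * (C₂ * δ)) +
            (((∫⁻ y in Ioc x n, ‖(a - a') y‖ₑ) * (2 * R) * C₁ +
              (∫⁻ y in Ioc x n, ‖a' y‖ₑ) * ((δ + η) * C₁)) +
              (∫⁻ y in Ioc x n, ‖a' y‖ₑ) * (2 * R * (C₂ * δ))) := by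
            rw [lintegral_add_left m12, lintegral_add_left m1,
              lintegral_add_left m34, lintegral_add_left m3,
              lintegral_mul_const _ k1, lintegral_mul_const _ k2, lintegral_mul_const _ k3,
              lintegral_mul_const _ (ha.meas.sub ha'.meas).enorm,
              lintegral_mul_const _ ha'.meas.enorm, lintegral_mul_const _ ha'.meas.enorm]
        _ ≤ _ := by
            gcongr
            · exact setLIntegral_invWeight_mul_le (mdb.sub mdb') _
            · exact (setLIntegral_invWeight_mul_le mdb' _).trans (by
                gcongr; exact hb'.deriv_bound)
            · exact (hi (ha.sub ha')).trans (by gcongr; exact le_self_add)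
            · exact (hi ha').trans (by gcongr)
            · exact (hi ha').trans (by gcongr)
    calc eLpNorm (F n) 2 volume ≤ 2 * η + ((2 * η * C₁ + 2 * R * (C₂ * δ)) +
          ((2 * δ * (2 * R) * C₁ + 2 * R * ((δ + η) * C₁)) + 2 * R * (2 * R * (C₂ * δ)))) :=
          (eLpNorm_add_le (measurable_setIntegral mp1).aestronglyMeasurable
            (measurable_setIntegral mpg).aestronglyMeasurable one_le_two).trans
            (add_le_add f1 f2)
      _ ≤ 2 * (δ + η) + ((2 * (δ + η) * C₁ + 2 * R * (C₂ * (δ + η))) +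
          ((2 * (δ + η) * (2 * R) * C₁ + 2 * R * ((δ + η) * C₁)) +
            2 * R * (2 * R * (C₂ * (δ + η))))) := by
          have k1 : η ≤ δ + η := le_add_self
          have k2 : δ ≤ δ + η := le_self_add
          gcongr
      _ = _ := by push_cast; ring
  -- Fatou's lemma, since the improper integral converges for each `z` only
  refine (Lp.eLpNorm_lim_le_liminf_eLpNorm (f := F) (fun n =>
    ((measurable_setIntegral mp1).add (measurable_setIntegral mpg)).aestronglyMeasurable) _
    (.of_forall fun z => ?_)).trans ?_
  · refine ((hJ.tendsto_integral_deriv ha.integrable hb x z).sub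
      (hJ'.tendsto_integral_deriv ha'.integrable hb' x z)).congr' ?_
    filter_upwards [eventually_ge_atTop ⌈x⌉₊] with n hn
    have hxn : x ≤ n := (Nat.le_ceil _).trans (by exact_mod_cast hn)
    have i1 := hJ.intervalIntegrable_phase ha.integrable hb.prim x n z
    have i2 := hJ'.intervalIntegrable_phase ha'.integrable hb'.prim x n z
    have i3 : IntervalIntegrable (fun y => phase κ z (x - y) * (db - db') y) volume x n :=
      (intervalIntegrable_of_locallyIntegrable (ml2.locallyIntegrable one_le_two)
        x n).continuousOn_mul (isPrimitive_phase κ z x).continuous.continuousOn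
    have i4 : IntervalIntegrable (fun y => phase κ z (x - y) * g y z) volume x n :=
      ((i1.sub i2).sub i3).congr fun y _ => by
        simp only [g, Pi.sub_apply]; ring
    simp only [F]
    rw [← intervalIntegral.integral_of_le hxn, ← intervalIntegral.integral_of_le hxn,
      ← intervalIntegral.integral_sub i1 i2, ← intervalIntegral.integral_add i3 i4]
    congr 1; funext y
    simp only [g, Pi.sub_apply]; ring
  · refine Filter.liminf_le_of_le (by isBoundedDefault) fun c hc => ?_
    obtain ⟨n, hn⟩ := hc.exists
    exact hn.trans (hF n)

end SecondOrder

section SecondOrderTerms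

/-- `iκz B(x; z) - b(x)`: the product of `iκz` with the remainder of `B` after its leading term
`b / (iκz)`. -/
noncomputable def secondB (κ : ℝ) (b : ℝ → ℂ) (B : ℝ → ℝ → ℂ) (x z : ℝ) : ℂ :=
  Complex.I * κ * z * B x z - b x

/-- `iκz (A(x; z) - 1) - ∫_x^∞ a b`. -/
noncomputable def secondA (κ : ℝ) (a b : ℝ → ℂ) (A : ℝ → ℝ → ℂ) (x z : ℝ) : ℂ :=
  Complex.I * κ * z * (A x z - 1) - ∫ y in Ioi x, a y * b y

lemma measurable_secondB {κ : ℝ} {b : ℝ → ℂ} {B : ℝ → ℝ → ℂ} (hb : Measurable b)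
    (hB : Measurable (Function.uncurry B)) : Measurable (Function.uncurry (secondB κ b B)) := by
  refine Measurable.sub (Measurable.mul ?_ hB) (hb.comp measurable_fst)
  fun_prop

lemma eLpNorm_const_mul (c : ℂ) (f : ℝ → ℂ) :
    eLpNorm (fun z => c * f z) 2 volume = ‖c‖ₑ * eLpNorm f 2 volume := by
  rw [← eLpNorm_const_smul]; rfl

lemma exists_secondB_bound (R : ℝ≥0) : ∃ C : ℝ≥0, ∀ {κ : ℝ} {a b db a' b' db' : ℝ → ℂ}
    {A B A' B' : ℝ → ℝ → ℂ}, |κ| = 2 → IsCoeff R a → IsSmoothCoeff R b db → IsCoeff R a' →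
    IsSmoothCoeff R b' db' → IsJostPair κ a b A B → IsJostPair κ a' b' A' B' → ∀ x ≥ 0,
      eLpNorm (fun z => secondB κ b B x z - secondB κ b' B' x z) 2 volume ≤
      C * (l21Norm (a - a') + l21Norm (b - b') + eLpNorm (db - db') 2 volume) := by
  obtain ⟨C₁, h₁⟩ := exists_decay_bound R
  obtain ⟨C₂, h₂⟩ := exists_lipschitz_bound R
  obtain ⟨C₃, h₃⟩ := exists_deriv_diff_bound R
  refine ⟨C₃ + 2 * C₂ + (2 * R * C₂ + C₁),
    fun {κ a b db a' b' db' A B A' B'} hκ ha hb ha' hb' hJ hJ' x hx => ?_⟩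
  have hA := h₁ hκ ha' hb'.toIsCoeff hJ' x hx
  have hD := (h₂ hκ ha hb.toIsCoeff ha' hb'.toIsCoeff hJ hJ' x hx).1
  have hP := h₃ hκ ha hb ha' hb' hJ hJ' x hx
  have hs := hb.enorm_sub_le hb' x
  have w1 := invWeight_le_one x
  set δ := l21Norm (a - a') + l21Norm (b - b') with hδ
  set η := eLpNorm (db - db') 2 volume with hη
  have hb2 : l21Norm (b - b') ≤ δ := le_add_self
  have sec : ∀ {f : ℝ → ℝ → ℂ}, Continuous (Function.uncurry f) → Measurable (f x) :=
    fun hf => hf.measurable.comp measurable_prodMk_left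
  have mA := sec hJ.contA
  have mB := sec hJ.contB
  have mA' := sec hJ'.contA
  have mB' := sec hJ'.contB
  have mz : Measurable fun z : ℝ => Complex.I * κ * ((z : ℂ) + 1) := by fun_prop
  have e : (fun z => secondB κ b B x z - secondB κ b' B' x z) = fun z =>
      (((Complex.I * κ * (z + 1) * B x z - b x * A x z) -
        (Complex.I * κ * (z + 1) * B' x z - b' x * A' x z)) -
        Complex.I * κ * (B x z - B' x z)) +
      (b x * (A x z - A' x z) + (b - b') x * (A' x z - 1)) := by
    funext z; simp only [secondB, Pi.sub_apply]; ring
  rw [e]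
  have m1 : Measurable fun z => (Complex.I * κ * (z + 1) * B x z - b x * A x z) -
      (Complex.I * κ * (z + 1) * B' x z - b' x * A' x z) :=
    ((mz.mul mB).sub (mA.const_mul _)).sub ((mz.mul mB').sub (mA'.const_mul _))
  have m2 : Measurable fun z => Complex.I * κ * (B x z - B' x z) := (mB.sub mB').const_mul _
  have m3 : Measurable fun z => b x * (A x z - A' x z) := (mA.sub mA').const_mul _
  have m4 : Measurable fun z => (b - b') x * (A' x z - 1) := (mA'.sub_const _).const_mul _
  have s1 : eLpNorm (fun z => Complex.I * κ * (B x z - B' x z)) 2 volume ≤ 2 * (C₂ * δ) := by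
    rw [eLpNorm_const_mul]
    have : ‖Complex.I * (κ : ℂ)‖ₑ = 2 := by
      rw [← ofReal_norm, norm_mul, Complex.norm_I, one_mul, Complex.norm_real, Real.norm_eq_abs,
        hκ, ENNReal.ofReal_ofNat]
    rw [this]
    gcongr
    exact (le_add_self.trans hD).trans (mul_le_of_le_one_right' w1)
  have s2 : eLpNorm (fun z => b x * (A x z - A' x z)) 2 volume ≤ 2 * R * (C₂ * δ) := by
    rw [eLpNorm_const_mul]
    gcongr
    · exact hb.enorm_le x
    · exact (le_self_add.trans hD).trans (mul_le_of_le_one_right' w1)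
  have s3 : eLpNorm (fun z => (b - b') x * (A' x z - 1)) 2 volume ≤ (δ + η) * C₁ := by
    rw [eLpNorm_const_mul]
    gcongr
    · exact hs.trans (by gcongr)
    · exact (le_self_add.trans hA).trans (mul_le_of_le_one_right' w1)
  calc _ ≤ (C₃ * (δ + η) + 2 * (C₂ * δ)) + (2 * R * (C₂ * δ) + (δ + η) * C₁) := by
        refine (eLpNorm_add_le (m1.sub m2).aestronglyMeasurable
          (m3.add m4).aestronglyMeasurable one_le_two).trans (add_le_add ?_ ?_)
        · exact (eLpNorm_sub_le m1.aestronglyMeasurable m2.aestronglyMeasurable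
            one_le_two).trans (add_le_add hP s1)
        · exact (eLpNorm_add_le m3.aestronglyMeasurable m4.aestronglyMeasurable
            one_le_two).trans (add_le_add s2 s3)
    _ ≤ (C₃ * (δ + η) + 2 * (C₂ * (δ + η))) + (2 * R * (C₂ * (δ + η)) + (δ + η) * C₁) := by
        have : δ ≤ δ + η := le_self_add
        gcongr
    _ = _ := by push_cast; ring

lemma IsSmoothCoeff.norm_le {b db : ℝ → ℂ} {R : ℝ≥0} (h : IsSmoothCoeff R b db) (y : ℝ) :
    ‖b y‖ ≤ 2 * R := by
  simpa using ENNReal.toReal_mono (by finiteness) (h.enorm_le y)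

lemma IsJostPair.integrable_mul_secondB {κ : ℝ} {a b db : ℝ → ℂ} {A B : ℝ → ℝ → ℂ} {R : ℝ≥0}
    (hJ : IsJostPair κ a b A B) {c : ℝ → ℂ} (hc : Integrable c volume)
    (hb : IsSmoothCoeff R b db) (z : ℝ) :
    Integrable (fun y => c y * secondB κ b B y z) volume := by
  obtain ⟨M, hM⟩ := hJ.bdd
  have m : Measurable fun y => secondB κ b B y z :=
    (measurable_secondB hb.meas hJ.measB).comp (g := Function.uncurry (secondB κ b B))
      (f := fun y => (y, z)) measurable_prodMk_right
  refine integrable_mul_bdd (M := ‖Complex.I * κ * z‖ * M + 2 * R) hc m fun y => ?_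
  calc ‖secondB κ b B y z‖ ≤ ‖Complex.I * κ * z * B y z‖ + ‖b y‖ := norm_sub_le _ _
    _ = ‖Complex.I * κ * z‖ * ‖B y z‖ + ‖b y‖ := by rw [norm_mul]
    _ ≤ ‖Complex.I * κ * z‖ * M + 2 * R := by
        gcongr
        · exact (hM y z).2
        · exact hb.norm_le y

lemma IsJostPair.secondA_eq {κ : ℝ} {a b db : ℝ → ℂ} {A B : ℝ → ℝ → ℂ} {R : ℝ≥0}
    (hJ : IsJostPair κ a b A B) (ha : Integrable a volume)
    (hb : IsSmoothCoeff R b db) (x z : ℝ) :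
    secondA κ a b A x z = ∫ y in Ioi x, a y * secondB κ b B y z := by
  obtain ⟨M, hM⟩ := hJ.bdd
  have i1 : Integrable (fun y => a y * B y z) volume :=
    integrable_mul_bdd ha (hJ.measB.comp measurable_prodMk_right) fun y => (hM y z).2
  have i2 : Integrable (fun y => a y * b y) volume := by
    refine ((i1.const_mul (Complex.I * κ * z)).sub (hJ.integrable_mul_secondB ha hb z)).congr
      (.of_forall fun y => ?_)
    simp only [Pi.sub_apply, secondB]; ring
  rw [secondA, hJ.eqA, add_sub_cancel_left, ← integral_const_mul,
    ← integral_sub (i1.const_mul _).integrableOn i2.integrableOn]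
  congr 1; funext y; simp only [secondB]; ring

/-- Lipschitz bound for the second order terms. -/
lemma exists_second_bound (R : ℝ≥0) : ∃ C : ℝ≥0, ∀ {κ : ℝ} {a b db a' b' db' : ℝ → ℂ}
    {A B A' B' : ℝ → ℝ → ℂ}, |κ| = 2 → IsCoeff R a → IsSmoothCoeff R b db → IsCoeff R a' →
    IsSmoothCoeff R b' db' → IsJostPair κ a b A B → IsJostPair κ a' b' A' B' → ∀ x ≥ 0,
      eLpNorm (fun z => secondA κ a b A x z - secondA κ a' b' A' x z) 2 volume +
        eLpNorm (fun z => secondB κ b B x z - secondB κ b' B' x z) 2 volume ≤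
      C * (l21Norm (a - a') + l21Norm (b - b') + eLpNorm (db - db') 2 volume) := by
  obtain ⟨C, hC⟩ := exists_secondB_bound R
  refine ⟨(2 * (C * (3 * R)) + 2 * R * C) + C,
    fun {κ a b db a' b' db' A B A' B'} hκ ha hb ha' hb' hJ hJ' x hx => ?_⟩
  have hB := hC hκ ha hb ha' hb' hJ hJ'
  -- comparison with vanishing coefficients
  have hB' : ∀ y ≥ 0, eLpNorm (secondB κ b' B' y) 2 volume ≤ C * (3 * R) := by
    intro y hy
    have h := hC hκ ha' hb' (isCoeff_zero R) (isSmoothCoeff_zero R) hJ' (isJostPair_zero κ) y hy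
    have e : (fun z => secondB κ b' B' y z - secondB κ 0 (fun _ _ => 0) y z) =
        secondB κ b' B' y := by
      funext z; simp [secondB]
    rw [e, sub_zero, sub_zero, sub_zero] at h
    refine h.trans ?_
    have e3 : (3 * R : ℝ≥0∞) = R + R + R := by ring
    rw [e3]
    gcongr
    · exact ha'.bound
    · exact hb'.bound
    · exact hb'.deriv_bound
  set δ := l21Norm (a - a') + l21Norm (b - b') + eLpNorm (db - db') 2 volume with hδ
  have hda : l21Norm (a - a') ≤ δ := le_self_add.trans le_self_add
  have fst' : ∀ {c : ℝ → ℂ}, Measurable c → Measurable (Function.uncurry fun y (_ : ℝ) => c y) :=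
    fun hc => hc.comp measurable_fst
  have mS := measurable_secondB (κ := κ) hb.meas hJ.measB
  have mS' := measurable_secondB (κ := κ) hb'.meas hJ'.measB
  have mf1 : Measurable (Function.uncurry fun y z => (a - a') y * secondB κ b' B' y z) :=
    (fst' (ha.meas.sub ha'.meas)).mul mS'
  have mf2 : Measurable (Function.uncurry fun y z =>
      a y * (secondB κ b B y z - secondB κ b' B' y z)) :=
    (fst' ha.meas).mul (mS.sub mS')
  have e : (fun z => secondA κ a b A x z - secondA κ a' b' A' x z) = fun z =>
      (∫ y in Ioi x, (a - a') y * secondB κ b' B' y z) +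
        ∫ y in Ioi x, a y * (secondB κ b B y z - secondB κ b' B' y z) := by
    funext z
    have i1 := hJ.integrable_mul_secondB ha.integrable hb z
    have i2 := hJ'.integrable_mul_secondB ha'.integrable hb' z
    have i3 := hJ'.integrable_mul_secondB ha.integrable hb' z
    have i4 : Integrable (fun y => (a - a') y * secondB κ b' B' y z) volume :=
      (i3.sub i2).congr (.of_forall fun y => by simp only [Pi.sub_apply]; ring)
    have i5 : Integrable (fun y => a y * (secondB κ b B y z - secondB κ b' B' y z)) volume :=
      (i1.sub i3).congr (.of_forall fun y => by simp only [Pi.sub_apply]; ring)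
    rw [hJ.secondA_eq ha.integrable hb, hJ'.secondA_eq ha'.integrable hb',
      ← integral_sub i1.integrableOn i2.integrableOn,
      ← integral_add i4.integrableOn i5.integrableOn]
    congr 1; funext y; simp only [Pi.sub_apply]; ring
  have s1 : eLpNorm (fun z => ∫ y in Ioi x, (a - a') y * secondB κ b' B' y z) 2 volume ≤
      2 * δ * (C * (3 * R)) := by
    refine (eLpNorm_setIntegral_le_of_norm_le (X := secondB κ b' B') (c := a - a')
      measurableSet_Ioi mf1 fun y _ z => (norm_mul _ _).le).trans ?_
    refine (setLIntegral_coeff_mul_le (ha.sub ha') fun y hy => hB' y (hx.trans hy.le)).trans ?_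
    gcongr
  have s2 : eLpNorm (fun z => ∫ y in Ioi x, a y * (secondB κ b B y z - secondB κ b' B' y z)) 2
      volume ≤ 2 * R * (C * δ) := by
    refine (eLpNorm_setIntegral_le_of_norm_le
      (X := fun y z => secondB κ b B y z - secondB κ b' B' y z) (c := a)
      measurableSet_Ioi mf2 fun y _ z => (norm_mul _ _).le).trans ?_
    refine (setLIntegral_coeff_mul_le ha fun y hy => hB y (hx.trans hy.le)).trans ?_
    gcongr
    exact ha.bound
  calc _ ≤ (2 * δ * (C * (3 * R)) + 2 * R * (C * δ)) + C * δ := by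
        refine add_le_add ?_ (hB x hx)
        rw [e]
        exact (eLpNorm_add_le (measurable_setIntegral mf1).aestronglyMeasurable
          (measurable_setIntegral mf2).aestronglyMeasurable one_le_two).trans (add_le_add s1 s2)
    _ = _ := by push_cast; ring

end SecondOrderTerms

/-! ### Potentials and coefficients -/

section Potentials

/-- `w` as a pointwise function of the values of `u` and of `u_x`. -/
noncomputable def wValue (u u₁ : ℂ) : ℂ :=
  - Complex.I * u₁ + 2 * u - (1 / 2) * (‖u‖ : ℂ) ^ 2 * u

lemma norm_sq_mul_sub_le {u v p r : ℂ} {K : ℝ} (hu : ‖u‖ ≤ K) (hv : ‖v‖ ≤ K) (hr : ‖r‖ ≤ K) :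
    ‖(‖u‖ : ℂ) ^ 2 * p - (‖v‖ : ℂ) ^ 2 * r‖ ≤ K ^ 2 * ‖p - r‖ + 2 * K ^ 2 * ‖u - v‖ := by
  have hK : 0 ≤ K := (norm_nonneg u).trans hu
  have e : (‖u‖ : ℂ) ^ 2 * p - (‖v‖ : ℂ) ^ 2 * r =
      (‖u‖ : ℂ) ^ 2 * (p - r) + ((‖u‖ + ‖v‖ : ℝ) : ℂ) * ((‖u‖ - ‖v‖ : ℝ) : ℂ) * r := by
    push_cast; ring
  rw [e]
  refine (norm_add_le _ _).trans (add_le_add ?_ ?_)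
  · rw [norm_mul, norm_pow, Complex.norm_real, norm_norm]
    gcongr
  · rw [norm_mul, norm_mul, Complex.norm_real, Complex.norm_real, Real.norm_eq_abs,
      Real.norm_eq_abs, abs_of_nonneg (by positivity)]
    calc (‖u‖ + ‖v‖) * |‖u‖ - ‖v‖| * ‖r‖ ≤ (K + K) * ‖u - v‖ * K := by
          gcongr
          exact abs_norm_sub_norm_le u v
      _ = _ := by ring

lemma norm_wValue_sub_le {u v u₁ v₁ : ℂ} {K : ℝ} (hu : ‖u‖ ≤ K) (hv : ‖v‖ ≤ K) :
    ‖wValue u u₁ - wValue v v₁‖ ≤ ‖u₁ - v₁‖ + (2 + 2 * K ^ 2) * ‖u - v‖ := by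
  have e : wValue u u₁ - wValue v v₁ = (-Complex.I * (u₁ - v₁) + 2 * (u - v)) -
      (1 / 2) * ((‖u‖ : ℂ) ^ 2 * u - (‖v‖ : ℂ) ^ 2 * v) := by
    unfold wValue; ring
  have h3 := norm_sq_mul_sub_le (p := u) hu hv hv
  rw [e]
  refine (norm_sub_le _ _).trans ((add_le_add_left (norm_add_le _ _) _).trans ?_)
  rw [norm_mul, norm_mul, norm_mul, norm_neg, Complex.norm_I, Complex.norm_ofNat, norm_div,
    norm_one, Complex.norm_ofNat]
  have : 0 ≤ K ^ 2 * ‖u - v‖ := by positivity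
  linarith

lemma l21Norm_le_of_norm_le {f g h : ℝ → ℂ} (hg : AEStronglyMeasurable g volume)
    (hh : AEStronglyMeasurable h volume) (c : ℝ≥0) (hle : ∀ x, ‖f x‖ ≤ ‖g x‖ + c * ‖h x‖) :
    l21Norm f ≤ l21Norm g + c * l21Norm h := by
  have hcast : ∀ {k : ℝ → ℂ}, AEStronglyMeasurable k volume →
      AEStronglyMeasurable (fun x => (‖k x‖ : ℂ)) volume := fun hk =>
    Complex.continuous_ofReal.comp_aestronglyMeasurable hk.norm
  have hmono : ∀ k : ℝ → ℂ, l21Norm (fun x => (‖k x‖ : ℂ)) ≤ l21Norm k := fun k =>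
    l21Norm_mono (.of_forall fun x => by simp)
  calc l21Norm f
      ≤ l21Norm ((fun x => (‖g x‖ : ℂ)) + fun x => ((c : ℝ) : ℂ) * (‖h x‖ : ℂ)) := by
        refine l21Norm_mono (.of_forall fun x => (hle x).trans (le_of_eq ?_))
        have e : (‖g x‖ : ℂ) + ((c : ℝ) : ℂ) * (‖h x‖ : ℂ) = ((‖g x‖ + c * ‖h x‖ : ℝ) : ℂ) := by
          push_cast; ring
        rw [Pi.add_apply, e, Complex.norm_real, Real.norm_of_nonneg (by positivity)]
    _ ≤ _ := (l21Norm_add_le (hcast hg) ((hcast hh).const_mul _)).trans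
        (add_le_add (hmono g) (by
          rw [l21Norm_const_mul]
          gcongr
          · simp [← ofReal_norm]
          · exact hmono h))

/-- `U` is the absolutely continuous representative of `u`, and `U₁` is a measurable representative
of the derivative. -/
structure IsRep (u U U₁ : ℝ → ℂ) : Prop where
  prim : IsPrimitive U U₁
  meas_deriv : Measurable U₁
  ae_eq : u =ᵐ[volume] U
  deriv_ae_eq : weakDeriv u =ᵐ[volume] U₁

lemma IsPrimitive.congr_deriv {f f' g : ℝ → ℂ} (h : IsPrimitive f f') (hg : f' =ᵐ[volume] g) :
    IsPrimitive f g :=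
  ⟨h.1.congr hg, fun x y => by
    rw [← h.2 x y]
    exact intervalIntegral.integral_congr_ae (hg.mono fun t ht _ => ht.symm)⟩

lemma IsWeakDeriv.exists_isRep {u g : ℝ → ℂ} (h : IsWeakDeriv u g) : ∃ U U₁, IsRep u U U₁ := by
  obtain ⟨U, hU, he⟩ := h.exists_isPrimitive
  have hm : AEStronglyMeasurable g volume := h.2.1.aestronglyMeasurable
  refine ⟨U, hm.mk g, hU.congr_deriv hm.ae_eq_mk, hm.stronglyMeasurable_mk.measurable, he,
    h.weakDeriv_ae_eq.trans hm.ae_eq_mk⟩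

variable {u v U U₁ V V₁ U₂ V₂ : ℝ → ℂ}

lemma IsRep.meas (h : IsRep u U U₁) : Measurable U := h.prim.continuous.measurable

lemma IsRep.weakDeriv_sub (hu : IsRep u U U₁) (hv : IsRep v V V₁) :
    weakDeriv (u - v) =ᵐ[volume] U₁ - V₁ := by
  have h := (hu.prim.sub hv.prim).isWeakDeriv
  refine (h.congr (f₁ := u - v) ?_ (g₁ := U₁ - V₁) (.of_forall fun x => rfl)).weakDeriv_ae_eq
  exact (hu.ae_eq.sub hv.ae_eq).symm

lemma IsRep.h11Norm_eq (hu : IsRep u U U₁) : h11Norm u = l21Norm U + l21Norm U₁ := by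
  rw [h11Norm, l21Norm_congr hu.ae_eq, l21Norm_congr hu.deriv_ae_eq]

lemma IsRep.h11Norm_sub_eq (hu : IsRep u U U₁) (hv : IsRep v V V₁) :
    h11Norm (u - v) = l21Norm (U - V) + l21Norm (U₁ - V₁) := by
  rw [h11Norm, l21Norm_congr (hu.ae_eq.sub hv.ae_eq), l21Norm_congr (hu.weakDeriv_sub hv)]

/-- The Sobolev bound. -/
lemma IsRep.norm_le (hu : IsRep u U U₁) {B : ℝ≥0} (h : h11Norm u ≤ B) (x : ℝ) : ‖U x‖ ≤ B := by
  have h1 : ‖U x‖ₑ ≤ B := (hu.prim.enorm_le hu.meas_deriv x).trans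
    ((add_le_add (eLpNorm_le_l21Norm _) (eLpNorm_le_l21Norm _)).trans (hu.h11Norm_eq ▸ h))
  simpa using ENNReal.toReal_mono ENNReal.coe_ne_top h1

lemma isRep_zero : IsRep 0 0 0 := by
  have h : IsPrimitive (0 : ℝ → ℂ) 0 := ⟨continuous_const.locallyIntegrable, by simp⟩
  exact ⟨h, measurable_zero, .rfl, h.isWeakDeriv.weakDeriv_ae_eq⟩

lemma IsRep.w_ae_eq (hu : IsRep u U U₁) : w u =ᵐ[volume] fun x => wValue (U x) (U₁ x) := by
  filter_upwards [hu.ae_eq, hu.deriv_ae_eq] with x h1 h2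
  rw [w, wValue, h1, h2]

lemma measurable_wValue (hU : Measurable U) (hU₁ : Measurable U₁) :
    Measurable fun x => wValue (U x) (U₁ x) := by
  unfold wValue; fun_prop

lemma IsRep.measurable_wValue (hu : IsRep u U U₁) : Measurable fun x => wValue (U x) (U₁ x) :=
  NLSGI.measurable_wValue hu.meas hu.meas_deriv

lemma IsRep.l21Norm_wValue_sub_le (hu : IsRep u U U₁) (hv : IsRep v V V₁) {B : ℝ≥0}
    (hB : ∀ x, ‖U x‖ ≤ B) (hB' : ∀ x, ‖V x‖ ≤ B) :
    l21Norm ((fun x => wValue (U x) (U₁ x)) - fun x => wValue (V x) (V₁ x)) ≤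
      (2 + 2 * B ^ 2 : ℝ≥0) * h11Norm (u - v) := by
  rw [hu.h11Norm_sub_eq hv]
  calc _ ≤ l21Norm (U₁ - V₁) + (2 + 2 * B ^ 2 : ℝ≥0) * l21Norm (U - V) := by
        refine l21Norm_le_of_norm_le (hu.meas_deriv.sub hv.meas_deriv).aestronglyMeasurable
          (hu.meas.sub hv.meas).aestronglyMeasurable _ fun x => ?_
        simpa using norm_wValue_sub_le (u₁ := U₁ x) (v₁ := V₁ x) (hB x) (hB' x)
    _ ≤ (2 + 2 * B ^ 2 : ℝ≥0) * l21Norm (U₁ - V₁) + (2 + 2 * B ^ 2 : ℝ≥0) * l21Norm (U - V) := by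
        gcongr
        refine le_mul_of_one_le_left' ?_
        rw [ENNReal.one_le_coe_iff]
        exact one_le_two.trans le_self_add
    _ = _ := by ring

lemma IsRep.l21Norm_wValue_le (hu : IsRep u U U₁) {B : ℝ≥0} (h : h11Norm u ≤ B) :
    l21Norm (fun x => wValue (U x) (U₁ x)) ≤ ((2 + 2 * B ^ 2) * B : ℝ≥0) := by
  have h0 : ((fun x => wValue (U x) (U₁ x)) - fun x => wValue ((0 : ℝ → ℂ) x) ((0 : ℝ → ℂ) x)) =
      fun x => wValue (U x) (U₁ x) := by funext x; simp [wValue]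
  have := hu.l21Norm_wValue_sub_le isRep_zero (B := B) (hu.norm_le h) fun x => by simp
  rw [h0, sub_zero] at this
  refine this.trans ?_
  rw [ENNReal.coe_mul]
  gcongr

/-- The derivative of `w` as a pointwise function of `u`, `u_x` and `u_xx`. -/
noncomputable def wDerivValue (u u₁ u₂ : ℂ) : ℂ :=
  - Complex.I * u₂ + 2 * u₁ - (1 / 2) * (2 * ((‖u‖ : ℂ) ^ 2 * u₁) + u ^ 2 * conj u₁)

lemma isPrimitive_wValue (h : IsPrimitive U U₁) (h₁ : IsPrimitive U₁ U₂) :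
    IsPrimitive (fun x => wValue (U x) (U₁ x)) (fun x => wDerivValue (U x) (U₁ x) (U₂ x)) := by
  have H := ((h₁.const_mul (-Complex.I)).add (h.const_mul 2)).sub
    (((h.mul h.conj).mul h).const_mul (1 / 2))
  beta_reduce at H
  convert! H using 2 with x x
  · rw [wValue, Complex.mul_conj']; ring
  · rw [wDerivValue, ← Complex.mul_conj']; ring

lemma norm_wDerivValue_sub_le {u v u₁ v₁ u₂ v₂ : ℂ} {K : ℝ} (hu : ‖u‖ ≤ K) (hv : ‖v‖ ≤ K)
    (hv₁ : ‖v₁‖ ≤ K) : ‖wDerivValue u u₁ u₂ - wDerivValue v v₁ v₂‖ ≤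
      ‖u₂ - v₂‖ + (2 + 2 * K ^ 2) * ‖u₁ - v₁‖ + 3 * K ^ 2 * ‖u - v‖ := by
  have hK : 0 ≤ K := (norm_nonneg u).trans hu
  have e : wDerivValue u u₁ u₂ - wDerivValue v v₁ v₂ =
      (-Complex.I * (u₂ - v₂) + 2 * (u₁ - v₁)) -
        (((‖u‖ : ℂ) ^ 2 * u₁ - (‖v‖ : ℂ) ^ 2 * v₁) +
          (1 / 2) * (u ^ 2 * conj (u₁ - v₁) + (u + v) * (u - v) * conj v₁)) := by
    unfold wDerivValue; rw [map_sub]; ring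
  have h1 := norm_sq_mul_sub_le (p := u₁) hu hv hv₁
  have h2 : ‖u ^ 2 * conj (u₁ - v₁)‖ ≤ K ^ 2 * ‖u₁ - v₁‖ := by
    rw [norm_mul, norm_pow, Complex.norm_conj]; gcongr
  have h3 : ‖(u + v) * (u - v) * conj v₁‖ ≤ 2 * K ^ 2 * ‖u - v‖ := by
    rw [norm_mul, norm_mul, Complex.norm_conj]
    calc ‖u + v‖ * ‖u - v‖ * ‖v₁‖ ≤ (K + K) * ‖u - v‖ * K := by
          gcongr
          exact (norm_add_le _ _).trans (add_le_add hu hv)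
      _ = _ := by ring
  have h4 : ‖-Complex.I * (u₂ - v₂) + 2 * (u₁ - v₁)‖ ≤ ‖u₂ - v₂‖ + 2 * ‖u₁ - v₁‖ := by
    refine (norm_add_le _ _).trans (le_of_eq ?_)
    rw [norm_mul, norm_mul, norm_neg, Complex.norm_I, Complex.norm_ofNat, one_mul]
  have h5 : ‖(1 / 2 : ℂ) * (u ^ 2 * conj (u₁ - v₁) + (u + v) * (u - v) * conj v₁)‖ ≤
      1 / 2 * (K ^ 2 * ‖u₁ - v₁‖ + 2 * K ^ 2 * ‖u - v‖) := by
    rw [norm_mul, norm_div, norm_one, Complex.norm_ofNat]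
    gcongr
    exact (norm_add_le _ _).trans (add_le_add h2 h3)
  rw [e]
  refine (norm_sub_le _ _).trans ((add_le_add h4 ((norm_add_le _ _).trans
    (add_le_add h1 h5))).trans ?_)
  have : 0 ≤ K ^ 2 * ‖u₁ - v₁‖ := by positivity
  linarith

lemma measurable_wDerivValue (hU : Measurable U) (hU₁ : Measurable U₁) (hU₂ : Measurable U₂) :
    Measurable fun x => wDerivValue (U x) (U₁ x) (U₂ x) := by
  have : Measurable fun x => conj (U₁ x) := Complex.continuous_conj.measurable.comp hU₁
  unfold wDerivValue; fun_prop

/-- For `u` in `H²` the representative of `u_x` is absolutely continuous as well. -/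
lemma MemH2.exists_isRep (h : MemH2 u) : ∃ U U₁ U₂, IsRep u U U₁ ∧ IsRep (weakDeriv u) U₁ U₂ := by
  obtain ⟨U₁, U₂, h₁⟩ := h.2.1.isWeakDeriv.exists_isRep
  obtain ⟨U, hU, he⟩ := h.1.isWeakDeriv.exists_isPrimitive
  exact ⟨U, U₁, U₂, ⟨hU.congr_deriv h₁.ae_eq, h₁.meas, he, h₁.ae_eq⟩, h₁⟩

lemma IsRep.h2Norm_eq (hu : IsRep u U U₁) (hu₁ : IsRep (weakDeriv u) U₁ U₂) :
    h2Norm u = eLpNorm U 2 volume + eLpNorm U₁ 2 volume + eLpNorm U₂ 2 volume := by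
  rw [h2Norm, eLpNorm_congr_ae hu.ae_eq, eLpNorm_congr_ae hu.deriv_ae_eq,
    eLpNorm_congr_ae hu₁.deriv_ae_eq]

lemma IsRep.sub (hu : IsRep u U U₁) (hv : IsRep v V V₁) : IsRep (u - v) (U - V) (U₁ - V₁) :=
  ⟨hu.prim.sub hv.prim, hu.meas_deriv.sub hv.meas_deriv, hu.ae_eq.sub hv.ae_eq,
    hu.weakDeriv_sub hv⟩

lemma IsRep.congr (hu : IsRep u U U₁) (h : u =ᵐ[volume] v) : IsRep v U U₁ :=
  ⟨hu.prim, hu.meas_deriv, h.symm.trans hu.ae_eq,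
    (hu.prim.isWeakDeriv.congr (hu.ae_eq.symm.trans h) .rfl).weakDeriv_ae_eq⟩

lemma IsRep.h2Norm_sub_eq (hu : IsRep u U U₁) (hu₁ : IsRep (weakDeriv u) U₁ U₂)
    (hv : IsRep v V V₁) (hv₁ : IsRep (weakDeriv v) V₁ V₂) :
    h2Norm (u - v) =
      eLpNorm (U - V) 2 volume + eLpNorm (U₁ - V₁) 2 volume + eLpNorm (U₂ - V₂) 2 volume :=
  (hu.sub hv).h2Norm_eq ((hu₁.sub hv₁).congr
    ((hu₁.ae_eq.sub hv₁.ae_eq).trans (hu.weakDeriv_sub hv).symm))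

/-- Sobolev bound for the derivative. -/
lemma IsRep.norm_deriv_le (hu : IsRep u U U₁) (hu₁ : IsRep (weakDeriv u) U₁ U₂) {B : ℝ≥0}
    (h : h2Norm u ≤ B) (x : ℝ) : ‖U₁ x‖ ≤ B := by
  rw [hu.h2Norm_eq hu₁] at h
  have h1 : ‖U₁ x‖ₑ ≤ B := (hu₁.prim.enorm_le hu₁.meas_deriv x).trans
    ((add_le_add_left le_add_self _).trans h)
  simpa using ENNReal.toReal_mono ENNReal.coe_ne_top h1

lemma eLpNorm_le_of_norm_le {f g h k : ℝ → ℂ} (hg : AEStronglyMeasurable g volume)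
    (hh : AEStronglyMeasurable h volume) (hk : AEStronglyMeasurable k volume) (c d : ℝ≥0)
    (hle : ∀ x, ‖f x‖ ≤ ‖g x‖ + c * ‖h x‖ + d * ‖k x‖) :
    eLpNorm f 2 volume ≤ eLpNorm g 2 volume + c * eLpNorm h 2 volume + d * eLpNorm k 2 volume := by
  have hc : ∀ (c : ℝ≥0) (f : ℝ → ℂ), eLpNorm (fun x => (c : ℝ) * ‖f x‖) 2 volume =
      c * eLpNorm f 2 volume := fun c f => by
    rw [← eLpNorm_norm f]
    refine (eLpNorm_const_smul (c : ℝ) (fun x => ‖f x‖) 2 volume).trans ?_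
    simp [← ofReal_norm]
  calc eLpNorm f 2 volume
      ≤ eLpNorm (((fun x => ‖g x‖) + fun x => (c : ℝ) * ‖h x‖) + fun x => (d : ℝ) * ‖k x‖) 2
        volume := by
        refine eLpNorm_mono_real hle
    _ ≤ _ := by
        refine (eLpNorm_add_le (hg.norm.add (hh.norm.const_mul _)) (hk.norm.const_mul _)
          one_le_two).trans (add_le_add ((eLpNorm_add_le hg.norm (hh.norm.const_mul _)
          one_le_two).trans (add_le_add (eLpNorm_norm g).le (hc c h).le)) (hc d k).le)

lemma IsRep.eLpNorm_wDerivValue_sub_le (hu : IsRep u U U₁) (hu₁ : IsRep (weakDeriv u) U₁ U₂)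
    (hv : IsRep v V V₁) (hv₁ : IsRep (weakDeriv v) V₁ V₂) {B : ℝ≥0}
    (hB : ∀ x, ‖U x‖ ≤ B) (hB' : ∀ x, ‖V x‖ ≤ B) (hB₁ : ∀ x, ‖V₁ x‖ ≤ B) :
    eLpNorm ((fun x => wDerivValue (U x) (U₁ x) (U₂ x)) -
      fun x => wDerivValue (V x) (V₁ x) (V₂ x)) 2 volume ≤
      (2 + 3 * B ^ 2 : ℝ≥0) * h2Norm (u - v) := by
  rw [hu.h2Norm_sub_eq hu₁ hv hv₁]
  set D : ℝ≥0 := 2 + 3 * B ^ 2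
  calc _ ≤ eLpNorm (U₂ - V₂) 2 volume + (2 + 2 * B ^ 2 : ℝ≥0) * eLpNorm (U₁ - V₁) 2 volume +
        (3 * B ^ 2 : ℝ≥0) * eLpNorm (U - V) 2 volume := by
        refine eLpNorm_le_of_norm_le (hu₁.meas_deriv.sub hv₁.meas_deriv).aestronglyMeasurable
          (hu₁.meas.sub hv₁.meas).aestronglyMeasurable
          (hu.meas.sub hv.meas).aestronglyMeasurable _ _ fun x => ?_
        simpa using norm_wDerivValue_sub_le (u₁ := U₁ x) (u₂ := U₂ x) (v₂ := V₂ x)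
          (hB x) (hB' x) (hB₁ x)
    _ ≤ D * eLpNorm (U₂ - V₂) 2 volume + D * eLpNorm (U₁ - V₁) 2 volume +
        D * eLpNorm (U - V) 2 volume := by
        gcongr
        · refine le_mul_of_one_le_left' ?_
          rw [ENNReal.one_le_coe_iff]
          exact one_le_two.trans le_self_add
        · simp only [D]; gcongr; norm_num
        · exact le_add_self
    _ = _ := by ring

lemma IsRep.eLpNorm_wDerivValue_le (hu : IsRep u U U₁) (hu₁ : IsRep (weakDeriv u) U₁ U₂)
    {B : ℝ≥0} (h : h11Norm u ≤ B) (h2 : h2Norm u ≤ B) :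
    eLpNorm (fun x => wDerivValue (U x) (U₁ x) (U₂ x)) 2 volume ≤ ((2 + 3 * B ^ 2) * B : ℝ≥0) := by
  have h0 : ((fun x => wDerivValue (U x) (U₁ x) (U₂ x)) -
      fun x => wDerivValue ((0 : ℝ → ℂ) x) ((0 : ℝ → ℂ) x) ((0 : ℝ → ℂ) x)) =
      fun x => wDerivValue (U x) (U₁ x) (U₂ x) := by funext x; simp [wDerivValue]
  have := hu.eLpNorm_wDerivValue_sub_le hu₁ isRep_zero
    (isRep_zero.congr isRep_zero.deriv_ae_eq.symm) (B := B) (hu.norm_le h) (fun x => by simp)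
    fun x => by simp
  rw [h0, sub_zero] at this
  refine this.trans ?_
  rw [ENNReal.coe_mul]
  gcongr

end Potentials

section Coefficients

/-- `x ↦ c f(εx)`. -/
noncomputable def reflect (ε : ℝ) (c : ℂ) (f : ℝ → ℂ) : ℝ → ℂ := fun x => c * f (ε * x)

variable {ε : ℝ} {f g u v a b db a' b' db' : ℝ → ℂ} {R : ℝ≥0}

lemma measurePreserving_mul_left (hε : |ε| = 1) :
    MeasurePreserving (fun x : ℝ => ε * x) volume volume := by
  rcases eq_or_eq_neg_of_abs_eq hε with rfl | rfl
  · simpa [Function.id_def] using MeasurePreserving.id (volume : Measure ℝ)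
  · simpa using Measure.measurePreserving_neg (volume : Measure ℝ)

lemma reflect_sub (c : ℂ) : reflect ε c f - reflect ε c g = reflect ε c (f - g) := by
  funext x; simp [reflect, mul_sub]

lemma measurable_reflect (hf : Measurable f) (c : ℂ) : Measurable (reflect ε c f) :=
  (hf.comp (measurable_const_mul ε)).const_mul c

lemma l21Norm_reflect_le (hε : |ε| = 1) {c : ℂ} (hc : ‖c‖ ≤ 1) :
    l21Norm (reflect ε c f) ≤ l21Norm f := by
  refine (l21Norm_mono (g := fun x => f (ε * x)) (.of_forall fun x => ?_)).trans
    (l21Norm_comp_mul_left hε f).le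
  rw [reflect, norm_mul]
  exact mul_le_of_le_one_left (norm_nonneg _) hc

lemma eLpNorm_reflect_le (hε : |ε| = 1) (hf : Measurable f) {c : ℂ} (hc : ‖c‖ ≤ 1) :
    eLpNorm (reflect ε c f) 2 volume ≤ eLpNorm f 2 volume := by
  refine (eLpNorm_mono (g := fun x => f (ε * x)) fun x => ?_).trans
    (eLpNorm_comp_measurePreserving hf.aestronglyMeasurable (measurePreserving_mul_left hε)).le
  rw [reflect, norm_mul]
  exact mul_le_of_le_one_left (norm_nonneg _) hc

lemma reflect_congr (hε : |ε| = 1) (c : ℂ) (h : f =ᵐ[volume] g) :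
    reflect ε c f =ᵐ[volume] reflect ε c g := by
  filter_upwards [(measurePreserving_mul_left hε).quasiMeasurePreserving.ae h] with x hx
  rw [reflect, reflect, hx]

lemma measurable_conj (hf : Measurable f) : Measurable fun x => conj (f x) :=
  Complex.continuous_conj.measurable.comp hf

lemma l21Norm_conj : l21Norm (fun x => conj (f x)) = l21Norm f :=
  le_antisymm (l21Norm_mono (.of_forall fun _ => (Complex.norm_conj _).le))
    (l21Norm_mono (.of_forall fun _ => (Complex.norm_conj _).ge))

lemma eLpNorm_conj : eLpNorm (fun x => conj (f x)) 2 volume = eLpNorm f 2 volume :=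
  eLpNorm_congr_norm_ae (.of_forall fun _ => Complex.norm_conj _)

lemma conj_sub_conj : ((fun x => conj (f x)) - fun x => conj (g x)) =
    fun x => conj ((f - g) x) := by
  funext x; simp

lemma IsCoeff.conj (h : IsCoeff R a) : IsCoeff R fun x => conj (a x) :=
  ⟨measurable_conj h.meas, l21Norm_conj.trans_le h.bound⟩

lemma IsSmoothCoeff.conj (h : IsSmoothCoeff R b db) :
    IsSmoothCoeff R (fun x => conj (b x)) fun x => conj (db x) :=
  { h.toIsCoeff.conj with
    prim := h.prim.conj
    meas_deriv := measurable_conj h.meas_deriv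
    deriv_bound := eLpNorm_conj.trans_le h.deriv_bound }

lemma IsCoeff.mono {R' : ℝ≥0} (h : IsCoeff R a) (hR : R ≤ R') : IsCoeff R' a :=
  ⟨h.meas, h.bound.trans (by exact_mod_cast hR)⟩

/-- `a` and `b` are the coefficients of the Volterra system for `m_±` of the potential `u`, where
`ε = ±1` and the line is reflected for `ε = -1`. Their conjugates are the coefficients for `n_±`. -/
structure IsJostCoeff (ε : ℝ) (u a b : ℝ → ℂ) : Prop where
  ae_fst : a =ᵐ[volume] reflect ε (-(ε / 2)) u
  ae_snd : b =ᵐ[volume] reflect ε (-ε) fun x => conj (w u x)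

variable {U U₁ U₂ V V₁ V₂ : ℝ → ℂ}

lemma norm_neg_half_le (hε : |ε| = 1) : ‖(-((ε : ℂ) / 2))‖ ≤ 1 := by
  rw [norm_neg, norm_div, Complex.norm_real, Real.norm_eq_abs, hε, Complex.norm_ofNat]
  norm_num

lemma norm_neg_sign_le (hε : |ε| = 1) : ‖(-(ε : ℂ))‖ ≤ 1 := by
  rw [norm_neg, Complex.norm_real, Real.norm_eq_abs, hε]

/-- The coefficient `a` belonging to a representative of the potential. -/
noncomputable def coeffA (ε : ℝ) (U : ℝ → ℂ) : ℝ → ℂ := reflect ε (-(ε / 2)) U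

/-- The coefficient `b` belonging to representatives of the potential and its derivative. -/
noncomputable def coeffB (ε : ℝ) (U U₁ : ℝ → ℂ) : ℝ → ℂ :=
  reflect ε (-ε) fun x => conj (wValue (U x) (U₁ x))

/-- The derivative of `coeffB`. -/
noncomputable def coeffBDeriv (ε : ℝ) (U U₁ U₂ : ℝ → ℂ) : ℝ → ℂ :=
  reflect ε (-1) fun x => conj (wDerivValue (U x) (U₁ x) (U₂ x))

lemma IsRep.isJostCoeff (hε : |ε| = 1) (hu : IsRep u U U₁) :
    IsJostCoeff ε u (coeffA ε U) (coeffB ε U U₁) where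
  ae_fst := reflect_congr hε _ hu.ae_eq.symm
  ae_snd := reflect_congr hε _ (by filter_upwards [hu.w_ae_eq] with x hx; rw [hx])

lemma IsRep.isCoeff_coeffA (hε : |ε| = 1) (hu : IsRep u U U₁) {B : ℝ≥0} (h : h11Norm u ≤ B) :
    IsCoeff B (coeffA ε U) :=
  ⟨measurable_reflect hu.meas _, (l21Norm_reflect_le hε (norm_neg_half_le hε)).trans
    (le_self_add.trans (hu.h11Norm_eq ▸ h))⟩

lemma IsRep.isCoeff_coeffB (hε : |ε| = 1) (hu : IsRep u U U₁) {B : ℝ≥0} (h : h11Norm u ≤ B) :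
    IsCoeff ((2 + 2 * B ^ 2) * B) (coeffB ε U U₁) :=
  ⟨measurable_reflect (measurable_conj hu.measurable_wValue) _,
    (l21Norm_reflect_le hε (norm_neg_sign_le hε)).trans
      (l21Norm_conj.trans_le (hu.l21Norm_wValue_le h))⟩

lemma IsRep.l21Norm_coeffA_sub_le (hε : |ε| = 1) (hu : IsRep u U U₁) (hv : IsRep v V V₁) :
    l21Norm (coeffA ε U - coeffA ε V) ≤ h11Norm (u - v) := by
  rw [coeffA, coeffA, reflect_sub, hu.h11Norm_sub_eq hv]
  exact (l21Norm_reflect_le hε (norm_neg_half_le hε)).trans le_self_add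

lemma IsRep.l21Norm_coeffB_sub_le (hε : |ε| = 1) (hu : IsRep u U U₁) (hv : IsRep v V V₁)
    {B : ℝ≥0} (h : h11Norm u ≤ B) (h' : h11Norm v ≤ B) :
    l21Norm (coeffB ε U U₁ - coeffB ε V V₁) ≤ (2 + 2 * B ^ 2 : ℝ≥0) * h11Norm (u - v) := by
  rw [coeffB, coeffB, reflect_sub, conj_sub_conj]
  exact (l21Norm_reflect_le hε (norm_neg_sign_le hε)).trans (l21Norm_conj.trans_le
    (hu.l21Norm_wValue_sub_le hv (hu.norm_le h) (hv.norm_le h')))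

/-- Coefficients of two potentials in a ball of `H^{1,1}`. -/
lemma exists_coeff (B : ℝ≥0) : ∃ R C : ℝ≥0, ∀ {ε : ℝ} {u v : ℝ → ℂ}, |ε| = 1 →
    MemH11 u → MemH11 v → h11Norm u ≤ B → h11Norm v ≤ B → ∃ a b a' b',
      IsJostCoeff ε u a b ∧ IsJostCoeff ε v a' b' ∧ IsCoeff R a ∧ IsCoeff R b ∧ IsCoeff R a' ∧
      IsCoeff R b' ∧ l21Norm (a - a') + l21Norm (b - b') ≤ C * h11Norm (u - v) := by
  have hB : B ≤ (2 + 2 * B ^ 2) * B := le_mul_of_one_le_left' (one_le_two.trans le_self_add)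
  refine ⟨(2 + 2 * B ^ 2) * B, 1 + (2 + 2 * B ^ 2), fun {ε u v} hε hu hv hu' hv' => ?_⟩
  obtain ⟨U, U₁, h⟩ := hu.1.isWeakDeriv.exists_isRep
  obtain ⟨V, V₁, h'⟩ := hv.1.isWeakDeriv.exists_isRep
  refine ⟨_, _, _, _, h.isJostCoeff hε, h'.isJostCoeff hε, (h.isCoeff_coeffA hε hu').mono hB,
    h.isCoeff_coeffB hε hu', (h'.isCoeff_coeffA hε hv').mono hB, h'.isCoeff_coeffB hε hv', ?_⟩
  rw [ENNReal.coe_add, add_mul, ENNReal.coe_one, one_mul]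
  exact add_le_add (h.l21Norm_coeffA_sub_le hε h') (h.l21Norm_coeffB_sub_le hε h' hu' hv')

lemma isPrimitive_coeffB (hε : |ε| = 1) (h : IsPrimitive U U₁) (h₁ : IsPrimitive U₁ U₂) :
    IsPrimitive (coeffB ε U U₁) (coeffBDeriv ε U U₁ U₂) := by
  have H := (((isPrimitive_wValue h h₁).conj).comp_mul_left hε).const_mul (-ε)
  beta_reduce at H
  convert! H using 2 with x
  have : (ε : ℂ) * ε = 1 := by
    rw [← Complex.ofReal_mul, ← sq, ← sq_abs, hε]; simp
  rw [Complex.real_smul, ← mul_assoc, neg_mul, this, coeffBDeriv, reflect]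

lemma IsRep.isSmoothCoeff_coeffB (hε : |ε| = 1) (hu : IsRep u U U₁)
    (hu₁ : IsRep (weakDeriv u) U₁ U₂) {B : ℝ≥0} (h : h11Norm u ≤ B) (h2 : h2Norm u ≤ B) :
    IsSmoothCoeff ((2 + 3 * B ^ 2) * B) (coeffB ε U U₁) (coeffBDeriv ε U U₁ U₂) :=
  { (hu.isCoeff_coeffB hε h).mono (by gcongr; norm_num) with
    prim := isPrimitive_coeffB hε hu.prim hu₁.prim
    meas_deriv := measurable_reflect
      (measurable_conj (measurable_wDerivValue hu.meas hu₁.meas hu₁.meas_deriv)) _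
    deriv_bound := (eLpNorm_reflect_le hε (measurable_conj
      (measurable_wDerivValue hu.meas hu₁.meas hu₁.meas_deriv)) (by simp)).trans
      (eLpNorm_conj.trans_le (hu.eLpNorm_wDerivValue_le hu₁ h h2)) }

lemma IsRep.eLpNorm_coeffBDeriv_sub_le (hε : |ε| = 1) (hu : IsRep u U U₁)
    (hu₁ : IsRep (weakDeriv u) U₁ U₂) (hv : IsRep v V V₁) (hv₁ : IsRep (weakDeriv v) V₁ V₂)
    {B : ℝ≥0} (h : h11Norm u ≤ B) (h' : h11Norm v ≤ B) (h2' : h2Norm v ≤ B) :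
    eLpNorm (coeffBDeriv ε U U₁ U₂ - coeffBDeriv ε V V₁ V₂) 2 volume ≤
      (2 + 3 * B ^ 2 : ℝ≥0) * h2Norm (u - v) := by
  rw [coeffBDeriv, coeffBDeriv, reflect_sub, conj_sub_conj]
  refine (eLpNorm_reflect_le hε (measurable_conj ((measurable_wDerivValue hu.meas hu₁.meas
    hu₁.meas_deriv).sub (measurable_wDerivValue hv.meas hv₁.meas hv₁.meas_deriv)))
    (by simp)).trans (eLpNorm_conj.trans_le
    (hu.eLpNorm_wDerivValue_sub_le hu₁ hv hv₁ (hu.norm_le h) (hv.norm_le h')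
      (hv.norm_deriv_le hv₁ h2')))

/-- Coefficients of two potentials in a ball of `H² ∩ H^{1,1}`. -/
lemma exists_smoothCoeff (B : ℝ≥0) : ∃ R C : ℝ≥0, ∀ {ε : ℝ} {u v : ℝ → ℂ}, |ε| = 1 →
    MemH2 u → MemH2 v → h2Norm u + h11Norm u ≤ B → h2Norm v + h11Norm v ≤ B →
    ∃ a b db a' b' db', IsJostCoeff ε u a b ∧ IsJostCoeff ε v a' b' ∧ IsCoeff R a ∧
      IsSmoothCoeff R b db ∧ IsCoeff R a' ∧ IsSmoothCoeff R b' db' ∧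
      l21Norm (a - a') + l21Norm (b - b') + eLpNorm (db - db') 2 volume ≤
        C * (h2Norm (u - v) + h11Norm (u - v)) := by
  have hB : B ≤ (2 + 3 * B ^ 2) * B := le_mul_of_one_le_left' (one_le_two.trans le_self_add)
  refine ⟨(2 + 3 * B ^ 2) * B, 1 + (2 + 2 * B ^ 2) + (2 + 3 * B ^ 2),
    fun {ε u v} hε hu hv hu' hv' => ?_⟩
  obtain ⟨U, U₁, U₂, h, h₁⟩ := hu.exists_isRep
  obtain ⟨V, V₁, V₂, h', h₁'⟩ := hv.exists_isRep
  have n2 : h2Norm u ≤ B := le_self_add.trans hu'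
  have n1 : h11Norm u ≤ B := le_add_self.trans hu'
  have n2' : h2Norm v ≤ B := le_self_add.trans hv'
  have n1' : h11Norm v ≤ B := le_add_self.trans hv'
  refine ⟨_, _, _, _, _, _, h.isJostCoeff hε, h'.isJostCoeff hε, (h.isCoeff_coeffA hε n1).mono hB,
    h.isSmoothCoeff_coeffB hε h₁ n1 n2, (h'.isCoeff_coeffA hε n1').mono hB,
    h'.isSmoothCoeff_coeffB hε h₁' n1' n2', ?_⟩
  have k1 := h.l21Norm_coeffA_sub_le hε h'
  have k2 := h.l21Norm_coeffB_sub_le hε h' n1 n1'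
  have k3 := h.eLpNorm_coeffBDeriv_sub_le hε h₁ h' h₁' n1 n1' n2'
  calc _ ≤ h11Norm (u - v) + (2 + 2 * B ^ 2 : ℝ≥0) * h11Norm (u - v) +
        (2 + 3 * B ^ 2 : ℝ≥0) * h2Norm (u - v) := add_le_add (add_le_add k1 k2) k3
    _ ≤ (h2Norm (u - v) + h11Norm (u - v)) +
        (2 + 2 * B ^ 2 : ℝ≥0) * (h2Norm (u - v) + h11Norm (u - v)) +
        (2 + 3 * B ^ 2 : ℝ≥0) * (h2Norm (u - v) + h11Norm (u - v)) := by
        gcongr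
        · exact le_add_self
        · exact le_add_self
        · exact le_self_add
    _ = _ := by push_cast; ring

end Coefficients

/-! ### Jost functions in terms of the Volterra system -/

section Transfer

/-- The sign `±1`. -/
def Sgn.sign : Sgn → ℝ
  | .plus => 1
  | .minus => -1

lemma Sgn.abs_sign (s : Sgn) : |s.sign| = 1 := by cases s <;> simp [Sgn.sign]

lemma Sgn.sign_mul_self (s : Sgn) : s.sign * s.sign = 1 := by cases s <;> simp [Sgn.sign]

lemma Sgn.sign_mul_sign_mul (s : Sgn) (x : ℝ) : s.sign * (s.sign * x) = x := by
  rw [← mul_assoc, s.sign_mul_self, one_mul]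

lemma Sgn.coe_sign_mul_self (s : Sgn) : (s.sign : ℂ) * s.sign = 1 := by
  exact_mod_cast s.sign_mul_self

lemma Sgn.sign_mul_nonneg {s : Sgn} {x : ℝ} (hx : x ∈ s.halfLine) : 0 ≤ s.sign * x := by
  cases s
  · simpa [Sgn.sign] using (show (0 : ℝ) < x from hx).le
  · simpa [Sgn.sign] using (show x < (0 : ℝ) from hx).le

lemma Sgn.measurableSet_halfLine (s : Sgn) : MeasurableSet s.halfLine := by
  cases s
  · exact measurableSet_Ioi
  · exact measurableSet_Iio

lemma Sgn.integralTo_eq (s : Sgn) (x : ℝ) (f : ℝ → ℂ) :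
    s.integralTo x f = ∫ y in Ioi (s.sign * x), -s.sign * f (s.sign * y) := by
  rw [integral_const_mul]
  cases s
  · simp [Sgn.integralTo, Sgn.sign]
  · have := integral_comp_neg_Ioi (-x) f
    simp only [neg_neg] at this
    simp [Sgn.integralTo, Sgn.sign, this]

/-- For fixed `z`, the functions `x ↦ f(εx)` and `x ↦ g(εx)` solve the Volterra system. -/
def SolvesVolterra (ε κ : ℝ) (a b : ℝ → ℂ) (z : ℝ) (f g : ℝ → ℂ) : Prop :=
  (∀ x, f (ε * x) = 1 + ∫ y in Ioi x, a y * g (ε * y)) ∧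
    ∀ x, g (ε * x) = ∫ y in Ioi x, phase κ z (x - y) * b y * f (ε * y)

variable {s : Sgn} {κ : ℝ} {a b : ℝ → ℂ} {A B : ℝ → ℝ → ℂ} {u : ℝ → ℂ}

lemma IsJostPair.solvesVolterra (hJ : IsJostPair κ a b A B) (s : Sgn) (z : ℝ) :
    SolvesVolterra s.sign κ a b z (fun x => A (s.sign * x) z) fun x => B (s.sign * x) z := by
  refine ⟨fun x => ?_, fun x => ?_⟩ <;> simp only [s.sign_mul_sign_mul]
  · exact hJ.eqA x z
  · exact hJ.eqB x z

lemma IsJostPair.eq_of_solvesVolterra (hJ : IsJostPair κ a b A B) (ha : Integrable a volume)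
    (hb : Integrable b volume) {z : ℝ} {f g : ℝ → ℂ} (hf : AEStronglyMeasurable f volume)
    (hg : AEStronglyMeasurable g volume) {M : ℝ} (hfM : ∀ x, ‖f x‖ ≤ M) (hgM : ∀ x, ‖g x‖ ≤ M)
    (h : SolvesVolterra s.sign κ a b z f g) (x : ℝ) :
    f x = A (s.sign * x) z ∧ g x = B (s.sign * x) z := by
  obtain ⟨M', hM'⟩ := hJ.bdd
  have hq := (measurePreserving_mul_left s.abs_sign).quasiMeasurePreserving
  have hph : ∀ x, Continuous fun y => phase κ z (x - y) := fun x =>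
    (continuous_phase κ).comp (continuous_const.prodMk (continuous_const.sub continuous_id))
  have key := volterra_unique ha hb (k := fun x y => phase κ z (x - y))
    (A := fun x => f (s.sign * x)) (B := fun x => g (s.sign * x)) (A' := fun x => A x z)
    (B' := fun x => B x z) (M := max M M') (fun _ _ => norm_phase _ _ _) hph
    (hf.comp_quasiMeasurePreserving hq) (hg.comp_quasiMeasurePreserving hq)
    (hJ.measA.comp measurable_prodMk_right).aestronglyMeasurable
    (hJ.measB.comp measurable_prodMk_right).aestronglyMeasurable
    (fun _ => (hfM _).trans (le_max_left _ _)) (fun _ => (hgM _).trans (le_max_left _ _))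
    (fun x => (hM' x z).1.trans (le_max_right _ _)) (fun x => (hM' x z).2.trans (le_max_right _ _))
    h.1 h.2 (fun x => hJ.eqA x z) fun x => hJ.eqB x z
  have h1 := congrFun key.1 (s.sign * x)
  have h2 := congrFun key.2 (s.sign * x)
  simp only [s.sign_mul_sign_mul] at h1 h2
  exact ⟨h1, h2⟩

lemma Sgn.forall_sign_mul (s : Sgn) {P : ℝ → Prop} : (∀ x, P (s.sign * x)) ↔ ∀ x, P x :=
  ⟨fun h x => s.sign_mul_sign_mul x ▸ h (s.sign * x), fun h _ => h _⟩

lemma ae_restrict_Ioi_of_ae {p : ℝ → Prop} (h : ∀ᵐ y, p y) (x : ℝ) :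
    ∀ᵐ y ∂volume.restrict (Ioi x), p y := ae_restrict_of_ae h

lemma phase_sign_mul (s : Sgn) (z x y : ℝ) :
    Complex.exp (2 * Complex.I * (z + 1) * ((s.sign * x - s.sign * y : ℝ) : ℂ)) =
      phase (2 * s.sign) z (x - y) := by
  rw [phase]; congr 1; push_cast; ring

lemma phase_neg_sign_mul (s : Sgn) (z x y : ℝ) :
    Complex.exp (-2 * Complex.I * (z + 1) * ((s.sign * x - s.sign * y : ℝ) : ℂ)) =
      phase (-(2 * s.sign)) z (x - y) := by
  rw [phase]; congr 1; push_cast; ring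

lemma volterra_m_iff (h : IsJostCoeff s.sign u a b) (z : ℝ) (f : ℝ → C2) :
    (∀ (x : ℝ) (i : Fin 2), f x i =
      e₁ i + s.integralTo x (fun y => ((D₁ z (x - y) * Q₁ u y).mulVec (f y)) i)) ↔
    SolvesVolterra s.sign (2 * s.sign) a b z (fun x => f x 0) fun x => f x 1 := by
  have h0 : ∀ x, s.integralTo (s.sign * x)
      (fun y => ((D₁ z (s.sign * x - y) * Q₁ u y).mulVec (f y)) 0) =
      ∫ y in Ioi x, a y * f (s.sign * y) 1 := fun x => by
    rw [s.integralTo_eq, s.sign_mul_sign_mul]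
    refine integral_congr_ae ?_
    filter_upwards [ae_restrict_Ioi_of_ae h.ae_fst x] with y hy
    rw [hy]
    simp [D₁, Q₁, Matrix.mulVec, dotProduct, Fin.sum_univ_two, Matrix.mul_apply, reflect]
    ring
  have h1 : ∀ x, s.integralTo (s.sign * x)
      (fun y => ((D₁ z (s.sign * x - y) * Q₁ u y).mulVec (f y)) 1) =
      ∫ y in Ioi x, phase (2 * s.sign) z (x - y) * b y * f (s.sign * y) 0 := fun x => by
    rw [s.integralTo_eq, s.sign_mul_sign_mul]
    refine integral_congr_ae ?_
    filter_upwards [ae_restrict_Ioi_of_ae h.ae_snd x] with y hy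
    rw [hy, ← phase_sign_mul]
    simp [D₁, Q₁, Matrix.mulVec, dotProduct, Fin.sum_univ_two, Matrix.mul_apply, reflect]
    ring
  rw [← s.forall_sign_mul]
  simp only [Fin.forall_fin_two, h0, h1, forall_and]
  simp [SolvesVolterra, e₁]

lemma volterra_n_iff (h : IsJostCoeff s.sign u a b) (z : ℝ) (f : ℝ → C2) :
    (∀ (x : ℝ) (i : Fin 2), f x i =
      e₂ i + s.integralTo x (fun y => ((D₂ z (x - y) * Q₂ u y).mulVec (f y)) i)) ↔
    SolvesVolterra s.sign (-(2 * s.sign)) (fun x => conj (a x)) (fun x => conj (b x)) z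
      (fun x => f x 1) fun x => f x 0 := by
  have h0 : ∀ x, s.integralTo (s.sign * x)
      (fun y => ((D₂ z (s.sign * x - y) * Q₂ u y).mulVec (f y)) 1) =
      ∫ y in Ioi x, conj (a y) * f (s.sign * y) 0 := fun x => by
    rw [s.integralTo_eq, s.sign_mul_sign_mul]
    refine integral_congr_ae ?_
    filter_upwards [ae_restrict_Ioi_of_ae h.ae_fst x] with y hy
    rw [hy]
    simp [D₂, Q₂, Matrix.mulVec, dotProduct, Fin.sum_univ_two, Matrix.mul_apply, reflect,
      Complex.conj_ofNat]
    ring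
  have h1 : ∀ x, s.integralTo (s.sign * x)
      (fun y => ((D₂ z (s.sign * x - y) * Q₂ u y).mulVec (f y)) 0) =
      ∫ y in Ioi x, phase (-(2 * s.sign)) z (x - y) * conj (b y) * f (s.sign * y) 1 := fun x => by
    rw [s.integralTo_eq, s.sign_mul_sign_mul]
    refine integral_congr_ae ?_
    filter_upwards [ae_restrict_Ioi_of_ae h.ae_snd x] with y hy
    rw [hy, ← phase_neg_sign_mul]
    simp [D₂, Q₂, Matrix.mulVec, dotProduct, Fin.sum_univ_two, Matrix.mul_apply, reflect]
    ring
  rw [← s.forall_sign_mul]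
  simp only [Fin.forall_fin_two, h0, h1, forall_and]
  simp [SolvesVolterra, e₂, and_comm]

lemma C2.norm_le (v : C2) : ‖v‖ ≤ ‖v 0‖ + ‖v 1‖ := by
  rw [EuclideanSpace.norm_eq, Fin.sum_univ_two]
  refine Real.sqrt_le_iff.2 ⟨by positivity, ?_⟩
  nlinarith [norm_nonneg (v 0), norm_nonneg (v 1)]

lemma C2.norm_apply_le (v : C2) (i : Fin 2) : ‖v i‖ ≤ ‖v‖ := PiLp.norm_apply_le v i

lemma C2.measurable_of_apply {X : Type*} [MeasurableSpace X] {μ : Measure X} {f : X → C2}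
    (h0 : AEStronglyMeasurable (fun p => f p 0) μ) (h1 : AEStronglyMeasurable (fun p => f p 1) μ) :
    AEStronglyMeasurable f μ := by
  have e : f = fun p => f p 0 • e₁ + f p 1 • e₂ := by
    funext p; ext i; fin_cases i <;> simp [e₁, e₂]
  rw [e]
  exact (h0.smul_const _).add (h1.smul_const _)

lemma C2.aestronglyMeasurable_apply {X : Type*} [MeasurableSpace X] {μ : Measure X} {f : X → C2}
    (h : AEStronglyMeasurable f μ) (i : Fin 2) : AEStronglyMeasurable (fun p => f p i) μ :=
  (PiLp.continuous_apply 2 _ i).comp_aestronglyMeasurable h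

/-- The solution of the Volterra system, as a function of the original variable; the permutation
of the components distinguishes the two kinds of Jost functions. -/
noncomputable def jostVector (s : Sgn) (A B : ℝ → ℝ → ℂ) : ℝ → ℝ → C2 :=
  fun x z => !₂[A (s.sign * x) z, B (s.sign * x) z]

lemma continuous_comp_sign (hA : Continuous (Function.uncurry A)) (s : Sgn) :
    Continuous (Function.uncurry fun x z => A (s.sign * x) z) :=
  hA.comp ((continuous_const.mul continuous_fst).prodMk continuous_snd)

lemma IsJostPair.isJostM (hJ : IsJostPair (2 * s.sign) a b A B) (h : IsJostCoeff s.sign u a b) :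
    IsJostM s u (jostVector s A B) := by
  obtain ⟨M, hM⟩ := hJ.bdd
  intro z
  have mA := (continuous_comp_sign hJ.contA s).comp (.prodMk_left z)
  have mB := (continuous_comp_sign hJ.contB s).comp (.prodMk_left z)
  exact ⟨C2.measurable_of_apply mA.aestronglyMeasurable mB.aestronglyMeasurable,
    ⟨M + M, fun x => (C2.norm_le _).trans (add_le_add (hM _ z).1 (hM _ z).2)⟩,
    (volterra_m_iff h z _).2 (hJ.solvesVolterra s z)⟩

lemma IsJostPair.eq_of_isJostM (hJ : IsJostPair (2 * s.sign) a b A B)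
    (h : IsJostCoeff s.sign u a b) (ha : Integrable a volume) (hb : Integrable b volume)
    {m : ℝ → ℝ → C2} (hm : IsJostM s u m) : m = jostVector s A B := by
  funext x z
  obtain ⟨h1, ⟨M, hM⟩, h2⟩ := hm z
  have := hJ.eq_of_solvesVolterra ha hb (C2.aestronglyMeasurable_apply h1 0)
    (C2.aestronglyMeasurable_apply h1 1) (fun x => (C2.norm_apply_le _ 0).trans (hM x))
    (fun x => (C2.norm_apply_le _ 1).trans (hM x)) ((volterra_m_iff h z _).1 h2) x
  ext i; fin_cases i
  · exact this.1
  · exact this.2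

lemma IsJostPair.isJostN (hJ : IsJostPair (-(2 * s.sign)) (fun x => conj (a x))
    (fun x => conj (b x)) A B) (h : IsJostCoeff s.sign u a b) : IsJostN s u (jostVector s B A) := by
  obtain ⟨M, hM⟩ := hJ.bdd
  intro z
  have mA := (continuous_comp_sign hJ.contA s).comp (.prodMk_left z)
  have mB := (continuous_comp_sign hJ.contB s).comp (.prodMk_left z)
  exact ⟨C2.measurable_of_apply mB.aestronglyMeasurable mA.aestronglyMeasurable,
    ⟨M + M, fun x => (C2.norm_le _).trans (add_le_add (hM _ z).2 (hM _ z).1)⟩,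
    (volterra_n_iff h z _).2 (hJ.solvesVolterra s z)⟩

lemma IsJostPair.eq_of_isJostN (hJ : IsJostPair (-(2 * s.sign)) (fun x => conj (a x))
    (fun x => conj (b x)) A B) (h : IsJostCoeff s.sign u a b) (ha : Integrable a volume)
    (hb : Integrable b volume) {n : ℝ → ℝ → C2} (hn : IsJostN s u n) : n = jostVector s B A := by
  funext x z
  obtain ⟨h1, ⟨M, hM⟩, h2⟩ := hn z
  have hc : ∀ {c : ℝ → ℂ}, Integrable c volume → Integrable (fun x => conj (c x)) volume :=
    fun hc => Complex.conjCLE.toContinuousLinearMap.integrable_comp hc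
  have := hJ.eq_of_solvesVolterra (hc ha) (hc hb) (C2.aestronglyMeasurable_apply h1 1)
    (C2.aestronglyMeasurable_apply h1 0) (fun x => (C2.norm_apply_le _ 1).trans (hM x))
    (fun x => (C2.norm_apply_le _ 0).trans (hM x)) ((volterra_n_iff h z _).1 h2) x
  ext i; fin_cases i
  · exact this.2
  · exact this.1

lemma IsJostPair.jostM_eq (hJ : IsJostPair (2 * s.sign) a b A B)
    (h : IsJostCoeff s.sign u a b) (ha : Integrable a volume) (hb : Integrable b volume) :
    jostM s u = jostVector s A B := by
  have hex : ∃ m, IsJostM s u m := ⟨_, hJ.isJostM h⟩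
  rw [jostM, dif_pos hex]
  exact hJ.eq_of_isJostM h ha hb hex.choose_spec

lemma IsJostPair.jostN_eq (hJ : IsJostPair (-(2 * s.sign)) (fun x => conj (a x))
    (fun x => conj (b x)) A B) (h : IsJostCoeff s.sign u a b) (ha : Integrable a volume)
    (hb : Integrable b volume) : jostN s u = jostVector s B A := by
  have hex : ∃ n, IsJostN s u n := ⟨_, hJ.isJostN h⟩
  rw [jostN, dif_pos hex]
  exact hJ.eq_of_isJostN h ha hb hex.choose_spec

end Transfer

/-! ### Lipschitz dependence of the Jost functions on the potential -/

section Conclusion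

variable {s : Sgn} {κ : ℝ} {a b a' b' : ℝ → ℂ} {A B A' B' : ℝ → ℝ → ℂ} {u v : ℝ → ℂ}

lemma C2.eLpNorm_le {f : ℝ → C2} (hf : AEStronglyMeasurable f volume) :
    eLpNorm f 2 volume ≤
      eLpNorm (fun z => f z 0) 2 volume + eLpNorm (fun z => f z 1) 2 volume := by
  refine (eLpNorm_mono_real (g := (fun z => ‖f z 0‖) + fun z => ‖f z 1‖)
    fun z => C2.norm_le _).trans ?_
  refine (eLpNorm_add_le (C2.aestronglyMeasurable_apply hf 0).norm
    (C2.aestronglyMeasurable_apply hf 1).norm one_le_two).trans (le_of_eq ?_)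
  rw [eLpNorm_norm, eLpNorm_norm]

/-- The norm of `H¹` in terms of `L²` moduli of continuity of the components. -/
lemma C2.h1Norm_le {f : ℝ → C2} (hf : Continuous f) {K : ℝ≥0}
    (h : eLpNorm (fun z => f z 0) 2 volume + eLpNorm (fun z => f z 1) 2 volume ≤ K)
    (ht : ∀ t : ℝ, eLpNorm (fun z => f (z + t) 0 - f z 0) 2 volume +
      eLpNorm (fun z => f (z + t) 1 - f z 1) 2 volume ≤ K * ‖t‖ₑ) : h1Norm f ≤ 2 * K := by
  have h2 : eLpNorm f 2 volume ≤ K := (C2.eLpNorm_le hf.aestronglyMeasurable).trans h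
  obtain ⟨g, hg, hgK⟩ := exists_isWeakDeriv_of_eLpNorm_translate_le
    ⟨hf.aestronglyMeasurable, h2.trans_lt ENNReal.coe_lt_top⟩ K fun t =>
      (C2.eLpNorm_le ((hf.comp (continuous_add_const t)).sub hf).aestronglyMeasurable).trans (ht t)
  rw [h1Norm, if_pos ⟨g, hg⟩, eLpNorm_congr_ae hg.weakDeriv_ae_eq, two_mul]
  exact add_le_add h2 hgK

lemma linftyH1Norm_le {f : ℝ → ℝ → C2} {K : ℝ≥0∞} (h : ∀ x, 0 ≤ s.sign * x → h1Norm (f x) ≤ K) :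
    linftyH1Norm s f ≤ K :=
  essSup_le_of_ae_le _ (by
    filter_upwards [ae_restrict_mem s.measurableSet_halfLine] with x hx
    exact h x (Sgn.sign_mul_nonneg hx))

lemma linftyL2Norm_le {f : ℝ → ℝ → C2} {K : ℝ≥0∞}
    (h : ∀ᵐ x, 0 ≤ s.sign * x → eLpNorm (f x) 2 volume ≤ K) : linftyL2Norm s f ≤ K :=
  essSup_le_of_ae_le _ (by
    filter_upwards [ae_restrict_mem s.measurableSet_halfLine, ae_restrict_of_ae h] with x hx hK
    exact hK (Sgn.sign_mul_nonneg hx))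

/-- Coefficients and solutions of the Volterra systems which represent both Jost functions. -/
structure IsJostData (s : Sgn) (u a b : ℝ → ℂ) (A B A' B' : ℝ → ℝ → ℂ) : Prop where
  coeff : IsJostCoeff s.sign u a b
  pairM : IsJostPair (2 * s.sign) a b A B
  pairN : IsJostPair (-(2 * s.sign)) (fun x => conj (a x)) (fun x => conj (b x)) A' B'
  integrable_fst : Integrable a volume
  integrable_snd : Integrable b volume

lemma IsJostCoeff.exists_isJostData (h : IsJostCoeff s.sign u a b) (ha : Integrable a volume)
    (hb : Integrable b volume) : ∃ A B A' B', IsJostData s u a b A B A' B' := by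
  have hc : ∀ {c : ℝ → ℂ}, Integrable c volume → Integrable (fun x => conj (c x)) volume :=
    fun hc => Complex.conjCLE.toContinuousLinearMap.integrable_comp hc
  obtain ⟨A, B, h1⟩ := exists_isJostPair (2 * s.sign) ha hb
  obtain ⟨A', B', h2⟩ := exists_isJostPair (-(2 * s.sign)) (hc ha) (hc hb)
  exact ⟨A, B, A', B', h, h1, h2, ha, hb⟩

lemma IsJostData.jostM_eq (h : IsJostData s u a b A B A' B') : jostM s u = jostVector s A B :=
  h.pairM.jostM_eq h.coeff h.integrable_fst h.integrable_snd

lemma IsJostData.jostN_eq (h : IsJostData s u a b A B A' B') : jostN s u = jostVector s B' A' :=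
  h.pairN.jostN_eq h.coeff h.integrable_fst h.integrable_snd

lemma abs_two_mul_sign (s : Sgn) : |2 * s.sign| = 2 := by
  rw [abs_mul, s.abs_sign, abs_two, mul_one]

lemma abs_neg_two_mul_sign (s : Sgn) : |-(2 * s.sign)| = 2 := by
  rw [abs_neg, abs_two_mul_sign]

lemma continuous_jostVector (hA : Continuous (Function.uncurry A))
    (hB : Continuous (Function.uncurry B)) (s : Sgn) : Continuous (Function.uncurry (jostVector s A B)) := by
  have e : Function.uncurry (jostVector s A B) = fun p =>
      Function.uncurry (fun x z => A (s.sign * x) z) p • e₁ +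
        Function.uncurry (fun x z => B (s.sign * x) z) p • e₂ := by
    funext p; ext i; fin_cases i <;> simp [e₁, e₂, jostVector, Function.uncurry]
  rw [e]
  exact ((continuous_comp_sign hA s).smul continuous_const).add
    ((continuous_comp_sign hB s).smul continuous_const)

lemma continuous_jostVector_apply (hA : Continuous (Function.uncurry A))
    (hB : Continuous (Function.uncurry B)) (s : Sgn) (x : ℝ) : Continuous (jostVector s A B x) :=
  (continuous_jostVector hA hB s).comp (.prodMk_right x)

lemma exists_jostVector_bound (R : ℝ≥0) : ∃ C : ℝ≥0, ∀ {s : Sgn} {κ : ℝ} {a b : ℝ → ℂ}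
    {A B : ℝ → ℝ → ℂ}, |κ| = 2 → IsCoeff R a → IsCoeff R b → IsJostPair κ a b A B →
    linftyH1Norm s (fun x z => jostVector s A B x z - e₁) ≤ C ∧
      linftyH1Norm s (fun x z => jostVector s B A x z - e₂) ≤ C := by
  obtain ⟨C₁, h₁⟩ := exists_decay_bound R
  obtain ⟨C₂, h₂⟩ := exists_shift_bound R
  refine ⟨2 * (C₁ + C₂), fun {s κ a b A B} hκ ha hb hJ => ⟨?_, ?_⟩⟩ <;>
    rw [ENNReal.coe_mul, ENNReal.coe_ofNat] <;> refine linftyH1Norm_le fun x hx => ?_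
  · refine C2.h1Norm_le ((continuous_jostVector_apply hJ.contA hJ.contB s x).sub continuous_const)
      ?_ fun t => ?_
    · refine (le_of_eq ?_).trans ((h₁ hκ ha hb hJ _ hx).trans
        ((mul_le_of_le_one_right' (invWeight_le_one _)).trans (by gcongr; exact le_self_add)))
      simp [jostVector, e₁]
    · refine (le_of_eq ?_).trans ((h₂ hκ ha hb hJ _ hx t).trans (by gcongr; exact le_add_self))
      simp [jostVector, e₁]
  · refine C2.h1Norm_le ((continuous_jostVector_apply hJ.contB hJ.contA s x).sub continuous_const)
      ?_ fun t => ?_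
    · refine (le_of_eq ?_).trans ((h₁ hκ ha hb hJ _ hx).trans
        ((mul_le_of_le_one_right' (invWeight_le_one _)).trans (by gcongr; exact le_self_add)))
      simp [jostVector, e₂, add_comm]
    · refine (le_of_eq ?_).trans ((h₂ hκ ha hb hJ _ hx t).trans (by gcongr; exact le_add_self))
      simp [jostVector, e₂, add_comm]

lemma exists_jostVector_lipschitz (R : ℝ≥0) : ∃ C : ℝ≥0, ∀ {s : Sgn} {κ : ℝ} {a b a' b' : ℝ → ℂ}
    {A B A' B' : ℝ → ℝ → ℂ}, |κ| = 2 → IsCoeff R a → IsCoeff R b → IsCoeff R a' → IsCoeff R b' →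
    IsJostPair κ a b A B → IsJostPair κ a' b' A' B' →
    linftyH1Norm s (jostVector s A B - jostVector s A' B') ≤
        C * (l21Norm (a - a') + l21Norm (b - b')) ∧
      linftyH1Norm s (jostVector s B A - jostVector s B' A') ≤
        C * (l21Norm (a - a') + l21Norm (b - b')) := by
  obtain ⟨C, hC⟩ := exists_lipschitz_bound R
  refine ⟨2 * C, fun {s κ a b a' b' A B A' B'} hκ ha hb ha' hb' hJ hJ' => ?_⟩
  have hfin : C * (l21Norm (a - a') + l21Norm (b - b')) ≠ ⊤ := by
    have h1 := (ha.sub ha').memL21.2.ne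
    have h2 := (hb.sub hb').memL21.2.ne
    change l21Norm _ ≠ ⊤ at h1 h2
    finiteness
  have h := hC hκ ha hb ha' hb' hJ hJ'
  rw [ENNReal.coe_mul, ENNReal.coe_ofNat, mul_assoc]
  lift C * (l21Norm (a - a') + l21Norm (b - b')) to ℝ≥0 using hfin with K
  have cA := continuous_jostVector_apply hJ.contA hJ.contB s
  have cA' := continuous_jostVector_apply hJ'.contA hJ'.contB s
  have cB := continuous_jostVector_apply hJ.contB hJ.contA s
  have cB' := continuous_jostVector_apply hJ'.contB hJ'.contA s
  constructor <;> refine linftyH1Norm_le fun x hx => ?_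
  · refine C2.h1Norm_le ((cA x).sub (cA' x)) ?_ fun t => ?_
    · refine (le_of_eq ?_).trans ((h _ hx).1.trans (mul_le_of_le_one_right' (invWeight_le_one _)))
      simp [jostVector]
    · refine (le_of_eq ?_).trans ((h _ hx).2 t)
      simp [jostVector]
  · refine C2.h1Norm_le ((cB x).sub (cB' x)) ?_ fun t => ?_
    · refine (le_of_eq ?_).trans ((h _ hx).1.trans (mul_le_of_le_one_right' (invWeight_le_one _)))
      simp [jostVector, add_comm]
    · refine (le_of_eq ?_).trans ((h _ hx).2 t)
      simp [jostVector, add_comm]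

lemma l21Norm_conj_sub (a a' : ℝ → ℂ) :
    l21Norm ((fun x => conj (a x)) - fun x => conj (a' x)) = l21Norm (a - a') := by
  rw [conj_sub_conj]; exact l21Norm_conj

lemma eLpNorm_conj_sub (a a' : ℝ → ℂ) :
    eLpNorm ((fun x => conj (a x)) - fun x => conj (a' x)) 2 volume =
      eLpNorm (a - a') 2 volume := by
  rw [conj_sub_conj]; exact eLpNorm_conj

/-- Existence and uniqueness of the Jost functions, and their membership in `L^∞ H¹`. -/
lemma MemH11.jost (hu : MemH11 u) (s : Sgn) :
    (∃! m, IsJostM s u m) ∧ (∃! n, IsJostN s u n) ∧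
      MemLinftyH1 s (mDiff s u) ∧ MemLinftyH1 s (nDiff s u) := by
  have hfin : h11Norm u ≠ ⊤ := by
    have h1 : l21Norm u ≠ ⊤ := hu.2.1.2.ne
    have h2 : l21Norm (weakDeriv u) ≠ ⊤ := hu.2.2.2.ne
    rw [h11Norm]
    finiteness
  have hB : h11Norm u ≤ (h11Norm u).toNNReal := (ENNReal.coe_toNNReal hfin).ge
  obtain ⟨R, _, h⟩ := exists_coeff (h11Norm u).toNNReal
  obtain ⟨a, b, _, _, hc, -, ha, hb, -⟩ := h s.abs_sign hu hu hB hB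
  obtain ⟨A, B, A', B', hD⟩ := hc.exists_isJostData ha.integrable hb.integrable
  obtain ⟨C, hC⟩ := exists_jostVector_bound R
  have em : mDiff s u = fun x z => jostVector s A B x z - e₁ := by
    funext x z; simp only [mDiff, hD.jostM_eq]
  have en : nDiff s u = fun x z => jostVector s B' A' x z - e₂ := by
    funext x z; simp only [nDiff, hD.jostN_eq]
  refine ⟨⟨_, hD.pairM.isJostM hc, fun m hm => hD.pairM.eq_of_isJostM hc ha.integrable
    hb.integrable hm⟩, ⟨_, hD.pairN.isJostN hc, fun n hn => hD.pairN.eq_of_isJostN hc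
    ha.integrable hb.integrable hn⟩, ⟨?_, ?_⟩, ⟨?_, ?_⟩⟩
  · rw [em]
    exact ((continuous_jostVector hD.pairM.contA hD.pairM.contB s).sub
      continuous_const).aestronglyMeasurable
  · rw [em]
    exact (hC (abs_two_mul_sign s) ha hb hD.pairM).1.trans_lt ENNReal.coe_lt_top
  · rw [en]
    exact ((continuous_jostVector hD.pairN.contB hD.pairN.contA s).sub
      continuous_const).aestronglyMeasurable
  · rw [en]
    exact (hC (abs_neg_two_mul_sign s) ha.conj hb.conj hD.pairN).2.trans_lt ENNReal.coe_lt_top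

/-- Lipschitz continuity of the Jost functions in `L^∞ H¹`. -/
lemma exists_jost_lipschitz (s : Sgn) (r : ℝ≥0) : ∃ C : ℝ≥0, ∀ u v : ℝ → ℂ, MemH11 u → MemH11 v →
    h11Norm u ≤ r → h11Norm v ≤ r →
    linftyH1Norm s (mDiff s u - mDiff s v) + linftyH1Norm s (nDiff s u - nDiff s v) ≤
      C * h11Norm (u - v) := by
  obtain ⟨R, C, h⟩ := exists_coeff r
  obtain ⟨C', hC'⟩ := exists_jostVector_lipschitz R
  refine ⟨2 * C' * C, fun u v hu hv hur hvr => ?_⟩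
  obtain ⟨a, b, a', b', hc, hc', ha, hb, ha', hb', hle⟩ := h s.abs_sign hu hv hur hvr
  obtain ⟨A, B, An, Bn, hD⟩ := hc.exists_isJostData ha.integrable hb.integrable
  obtain ⟨A', B', An', Bn', hD'⟩ := hc'.exists_isJostData ha'.integrable hb'.integrable
  have em : mDiff s u - mDiff s v = jostVector s A B - jostVector s A' B' := by
    funext x z
    simp only [mDiff, Pi.sub_apply, hD.jostM_eq, hD'.jostM_eq, sub_sub_sub_cancel_right]
  have en : nDiff s u - nDiff s v = jostVector s Bn An - jostVector s Bn' An' := by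
    funext x z
    simp only [nDiff, Pi.sub_apply, hD.jostN_eq, hD'.jostN_eq, sub_sub_sub_cancel_right]
  have k1 := (hC' (s := s) (abs_two_mul_sign s) ha hb ha' hb' hD.pairM hD'.pairM).1
  have k2 := (hC' (s := s) (abs_neg_two_mul_sign s) ha.conj hb.conj ha'.conj hb'.conj hD.pairN
    hD'.pairN).2
  rw [l21Norm_conj_sub, l21Norm_conj_sub] at k2
  rw [em, en]
  calc _ ≤ C' * (C * h11Norm (u - v)) + C' * (C * h11Norm (u - v)) :=
        add_le_add (k1.trans (by gcongr)) (k2.trans (by gcongr))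
    _ = _ := by push_cast; ring

end Conclusion

/-! ### The second order terms of the Jost functions -/

section SecondOrderConclusion

variable {s : Sgn} {κ : ℝ} {a b db a' b' db' : ℝ → ℂ} {A B A' B' : ℝ → ℝ → ℂ} {u v : ℝ → ℂ}

lemma Sgn.reflect_sign_mul (s : Sgn) (c : ℂ) (f : ℝ → ℂ) (x : ℝ) :
    reflect s.sign c f (s.sign * x) = c * f x := by
  rw [reflect, s.sign_mul_sign_mul]

lemma IsJostCoeff.q_eq (h : IsJostCoeff s.sign u a b) (x : ℝ) :
    q s u x = -s.sign * ∫ y in Ioi (s.sign * x), a y * b y := by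
  rw [q, s.integralTo_eq, ← integral_const_mul, ← integral_const_mul]
  refine integral_congr_ae ?_
  filter_upwards [ae_restrict_Ioi_of_ae h.ae_fst _, ae_restrict_Ioi_of_ae h.ae_snd _] with y h1 h2
  rw [h1, h2, reflect, reflect]
  linear_combination (1 / 2 * (s.sign : ℂ) * (u (s.sign * y) * conj (w u (s.sign * y)))) *
    s.coe_sign_mul_self

lemma IsJostCoeff.ae_conj_w (h : IsJostCoeff s.sign u a b) :
    ∀ᵐ x, conj (w u x) = -s.sign * b (s.sign * x) := by
  filter_upwards [(measurePreserving_mul_left s.abs_sign).quasiMeasurePreserving.ae h.ae_snd]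
    with x hx
  rw [hx, s.reflect_sign_mul]
  linear_combination (-conj (w u x)) * s.coe_sign_mul_self

lemma IsJostData.ae_mTwo_eq (h : IsJostData s u a b A B A' B') : ∀ᵐ x, ∀ z,
    mTwo s u x z = (s.sign : ℂ) • jostVector s (secondA (2 * s.sign) a b A)
      (secondB (2 * s.sign) b B) x z := by
  filter_upwards [h.coeff.ae_conj_w] with x hx z
  rw [mTwo, h.jostM_eq, h.coeff.q_eq, hx]
  ext i; fin_cases i
  · simp [jostVector, secondA, e₁, e₂]
    linear_combination (-(2 * Complex.I * z * (A (s.sign * x) z - 1))) * s.coe_sign_mul_self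
  · simp [jostVector, secondB, e₁, e₂]
    linear_combination (-(2 * Complex.I * z * B (s.sign * x) z)) * s.coe_sign_mul_self

lemma IsJostData.ae_nTwo_eq (h : IsJostData s u a b A B A' B') : ∀ᵐ x, ∀ z,
    nTwo s u x z = (-s.sign : ℂ) • jostVector s
      (secondB (-(2 * s.sign)) (fun y => conj (b y)) B')
      (secondA (-(2 * s.sign)) (fun y => conj (a y)) (fun y => conj (b y)) A') x z := by
  filter_upwards [h.coeff.ae_conj_w] with x hx z
  have hw : w u x = -s.sign * conj (b (s.sign * x)) := by
    rw [← Complex.conj_conj (w u x), hx]; simp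
  have hq : conj (q s u x) = -s.sign * ∫ y in Ioi (s.sign * x), conj (a y) * conj (b y) := by
    rw [h.coeff.q_eq, map_mul, ← integral_conj]; simp
  rw [nTwo, h.jostN_eq, hq, hw]
  ext i; fin_cases i
  · simp [jostVector, secondB, e₁, e₂]
    linear_combination (-(2 * Complex.I * z * B' (s.sign * x) z)) * s.coe_sign_mul_self
  · simp [jostVector, secondA, e₁, e₂]
    linear_combination (-(2 * Complex.I * z * (A' (s.sign * x) z - 1))) * s.coe_sign_mul_self

lemma measurable_secondA (ha : Integrable a volume) {R : ℝ≥0} (hb : IsSmoothCoeff R b db)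
    (hJ : IsJostPair κ a b A B) : Measurable (Function.uncurry (secondA κ a b A)) := by
  have hab : Integrable (fun y => a y * b y) volume :=
    ha.mul_bdd (c := 2 * R) hb.meas.aestronglyMeasurable (.of_forall hb.norm_le)
  have hc : Continuous fun p : ℝ × ℝ => ∫ y in Ioi p.1, a y * b y :=
    continuous_setIntegral_Ioi (f := fun y _ => a y * b y) (fun _ => hab.1)
      (fun _ => continuous_const) (fun _ _ => le_rfl) hab.norm
  refine Measurable.sub (Measurable.mul ?_ (hJ.measA.sub_const 1)) hc.measurable
  fun_prop

lemma measurable_jostVector (hA : Measurable (Function.uncurry A))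
    (hB : Measurable (Function.uncurry B)) (s : Sgn) {μ : Measure (ℝ × ℝ)} :
    AEStronglyMeasurable (Function.uncurry (jostVector s A B)) μ := by
  have hm : Measurable fun p : ℝ × ℝ => (s.sign * p.1, p.2) := by fun_prop
  exact C2.measurable_of_apply (hA.comp hm).aestronglyMeasurable (hB.comp hm).aestronglyMeasurable

/-- The identity for `f` is assumed for almost every `x` only, because `w` determines the coefficient
`b` up to a null set. -/
lemma linftyL2Norm_le_of_ae_eq {f : ℝ → ℝ → C2} {c : ℂ} (hc : ‖c‖ = 1) {K : ℝ≥0∞}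
    (hf : ∀ᵐ x, ∀ z, f x z = c • (jostVector s A B x z - jostVector s A' B' x z))
    (hA : Measurable (Function.uncurry A)) (hB : Measurable (Function.uncurry B))
    (hA' : Measurable (Function.uncurry A')) (hB' : Measurable (Function.uncurry B'))
    (h : ∀ x ≥ 0, eLpNorm (fun z => A x z - A' x z) 2 volume +
      eLpNorm (fun z => B x z - B' x z) 2 volume ≤ K) : linftyL2Norm s f ≤ K := by
  refine linftyL2Norm_le ?_
  filter_upwards [hf] with x hx h0
  have sec : ∀ {g : ℝ → ℝ → ℂ}, Measurable (Function.uncurry g) → ∀ x, Measurable (g x) :=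
    fun hg x => hg.comp measurable_prodMk_left
  refine le_trans ?_ (h _ h0)
  rw [eLpNorm_congr_norm_ae (g := fun z => jostVector s A B x z - jostVector s A' B' x z)
    (.of_forall fun z => by rw [hx, norm_smul, hc, one_mul])]
  refine (C2.eLpNorm_le (C2.measurable_of_apply ?_ ?_)).trans (le_of_eq (by simp [jostVector]))
  · exact ((sec hA _).sub (sec hA' _)).aestronglyMeasurable
  · exact ((sec hB _).sub (sec hB' _)).aestronglyMeasurable

lemma measurableOn_of_ae_eq {f g : ℝ → ℝ → C2} {c : ℂ} (h : ∀ᵐ x, ∀ z, f x z = c • g x z)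
    (hg : ∀ μ : Measure (ℝ × ℝ), AEStronglyMeasurable (Function.uncurry g) μ) :
    MeasurableOn s f := by
  refine ((hg _).const_smul c).congr ?_
  have h' : ∀ᵐ x ∂volume.restrict s.halfLine, ∀ z, f x z = c • g x z := ae_restrict_of_ae h
  filter_upwards [Measure.quasiMeasurePreserving_fst.ae h'] with p hp
  exact (hp p.2).symm

lemma Sgn.norm_sign (s : Sgn) : ‖(s.sign : ℂ)‖ = 1 := by
  rw [Complex.norm_real, Real.norm_eq_abs, s.abs_sign]

/-- Membership of the second order terms in `L^∞ L²`, by comparison with the zero potential. -/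
lemma MemH2.memLinftyL2 (hu : MemH2 u) (hu' : MemH11 u) (s : Sgn) :
    MemLinftyL2 s (mTwo s u) ∧ MemLinftyL2 s (nTwo s u) := by
  have hfin : h2Norm u + h11Norm u ≠ ⊤ := by
    have h1 : l21Norm u ≠ ⊤ := hu'.2.1.2.ne
    have h2 : l21Norm (weakDeriv u) ≠ ⊤ := hu'.2.2.2.ne
    have h3 := hu.2.2.1.2.ne
    have h4 := hu.2.2.2.1.2.ne
    have h5 := hu.2.2.2.2.2.ne
    rw [h11Norm, h2Norm]
    finiteness
  have hB := (ENNReal.coe_toNNReal hfin).ge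
  obtain ⟨R, _, h⟩ := exists_smoothCoeff (h2Norm u + h11Norm u).toNNReal
  obtain ⟨a, b, db, _, _, _, hc, -, ha, hb, -⟩ := h s.abs_sign hu hu hB hB
  obtain ⟨A, B, A', B', hD⟩ := hc.exists_isJostData ha.integrable hb.integrable
  obtain ⟨C, hC⟩ := exists_second_bound R
  have k1 := hC (abs_two_mul_sign s) ha hb (isCoeff_zero R) (isSmoothCoeff_zero R) hD.pairM
    (isJostPair_zero _)
  have k2 := hC (abs_neg_two_mul_sign s) ha.conj hb.conj (isCoeff_zero R) (isSmoothCoeff_zero R)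
    hD.pairN (isJostPair_zero _)
  have z1 : ∀ κ x z, secondA κ 0 0 (fun _ _ => 1) x z = 0 := fun κ x z => by simp [secondA]
  have z2 : ∀ κ x z, secondB κ 0 (fun _ _ => 0) x z = 0 := fun κ x z => by simp [secondB]
  simp only [z1, z2, sub_zero] at k1 k2
  have mA := measurable_secondA ha.integrable hb hD.pairM
  have mB := measurable_secondB (κ := 2 * s.sign) hb.meas hD.pairM.measB
  have mA' := measurable_secondA ha.conj.integrable hb.conj hD.pairN
  have mB' := measurable_secondB (κ := -(2 * s.sign)) hb.conj.meas hD.pairN.measB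
  have m0 : Measurable (Function.uncurry fun (_ _ : ℝ) => (0 : ℂ)) := measurable_const
  have v0 : ∀ x z, jostVector s (fun _ _ => 0) (fun _ _ => 0) x z = 0 := fun x z => by
    ext i; fin_cases i <;> simp [jostVector]
  refine ⟨⟨measurableOn_of_ae_eq hD.ae_mTwo_eq fun _ => measurable_jostVector mA mB s, ?_⟩,
    ⟨measurableOn_of_ae_eq hD.ae_nTwo_eq fun _ => measurable_jostVector mB' mA' s, ?_⟩⟩
  · refine lt_of_le_of_lt (linftyL2Norm_le_of_ae_eq s.norm_sign ?_ mA mB m0 m0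
      fun x hx => ?_) (b := C * (l21Norm a + l21Norm b + eLpNorm db 2 volume)) ?_
    · filter_upwards [hD.ae_mTwo_eq] with x hx z
      rw [hx, v0, sub_zero]
    · simpa using k1 x hx
    · have h1 : l21Norm a ≠ ⊤ := ha.memL21.2.ne
      have h2 : l21Norm b ≠ ⊤ := hb.memL21.2.ne
      have h3 := hb.memLp_deriv.2.ne
      finiteness
  · refine lt_of_le_of_lt (linftyL2Norm_le_of_ae_eq (c := -s.sign)
      (by rw [norm_neg, s.norm_sign]) ?_ mB' mA' m0 m0 fun x hx => ?_)
      (b := C * (l21Norm (fun x => conj (a x)) + l21Norm (fun x => conj (b x)) +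
        eLpNorm (fun x => conj (db x)) 2 volume)) ?_
    · filter_upwards [hD.ae_nTwo_eq] with x hx z
      rw [hx, v0, sub_zero]
    · rw [add_comm]
      simpa using k2 x hx
    · have h1 : l21Norm (fun x => conj (a x)) ≠ ⊤ := ha.conj.memL21.2.ne
      have h2 : l21Norm (fun x => conj (b x)) ≠ ⊤ := hb.conj.memL21.2.ne
      have h3 := hb.conj.memLp_deriv.2.ne
      finiteness

/-- Lipschitz continuity of the second order terms in `L^∞ L²`. -/
lemma exists_second_lipschitz (s : Sgn) (r : ℝ≥0) : ∃ C : ℝ≥0, ∀ u v : ℝ → ℂ,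
    MemH2 u → MemH2 v → h2Norm u + h11Norm u ≤ r → h2Norm v + h11Norm v ≤ r →
    linftyL2Norm s (mTwo s u - mTwo s v) + linftyL2Norm s (nTwo s u - nTwo s v) ≤
      C * (h2Norm (u - v) + h11Norm (u - v)) := by
  obtain ⟨R, C, h⟩ := exists_smoothCoeff r
  obtain ⟨C', hC'⟩ := exists_second_bound R
  refine ⟨2 * C' * C, fun u v hu hv hur hvr => ?_⟩
  obtain ⟨a, b, db, a', b', db', hc, hc', ha, hb, ha', hb', hle⟩ := h s.abs_sign hu hv hur hvr
  obtain ⟨A, B, An, Bn, hD⟩ := hc.exists_isJostData ha.integrable hb.integrable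
  obtain ⟨A', B', An', Bn', hD'⟩ := hc'.exists_isJostData ha'.integrable hb'.integrable
  have k1 := hC' (abs_two_mul_sign s) ha hb ha' hb' hD.pairM hD'.pairM
  have k2 := hC' (abs_neg_two_mul_sign s) ha.conj hb.conj ha'.conj hb'.conj hD.pairN hD'.pairN
  rw [l21Norm_conj_sub, l21Norm_conj_sub, eLpNorm_conj_sub] at k2
  have e1 : linftyL2Norm s (mTwo s u - mTwo s v) ≤
      C' * (C * (h2Norm (u - v) + h11Norm (u - v))) := by
    refine linftyL2Norm_le_of_ae_eq s.norm_sign ?_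
      (measurable_secondA ha.integrable hb hD.pairM)
      (measurable_secondB (κ := 2 * s.sign) hb.meas hD.pairM.measB)
      (measurable_secondA ha'.integrable hb' hD'.pairM)
      (measurable_secondB (κ := 2 * s.sign) hb'.meas hD'.pairM.measB)
      fun x hx => (k1 x hx).trans (by gcongr)
    filter_upwards [hD.ae_mTwo_eq, hD'.ae_mTwo_eq] with x hx hx' z
    rw [Pi.sub_apply, Pi.sub_apply, hx, hx', smul_sub]
  have e2 : linftyL2Norm s (nTwo s u - nTwo s v) ≤
      C' * (C * (h2Norm (u - v) + h11Norm (u - v))) := by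
    refine linftyL2Norm_le_of_ae_eq (c := -s.sign) (by rw [norm_neg, s.norm_sign]) ?_
      (measurable_secondB (κ := -(2 * s.sign)) hb.conj.meas hD.pairN.measB)
      (measurable_secondA ha.conj.integrable hb.conj hD.pairN)
      (measurable_secondB (κ := -(2 * s.sign)) hb'.conj.meas hD'.pairN.measB)
      (measurable_secondA ha'.conj.integrable hb'.conj hD'.pairN)
      fun x hx => (add_comm _ _).trans_le ((k2 x hx).trans (by gcongr))
    filter_upwards [hD.ae_nTwo_eq, hD'.ae_nTwo_eq] with x hx hx' z
    rw [Pi.sub_apply, Pi.sub_apply, hx, hx', smul_sub]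
  calc _ ≤ C' * (C * (h2Norm (u - v) + h11Norm (u - v))) +
        C' * (C * (h2Norm (u - v) + h11Norm (u - v))) := add_le_add e1 e2
    _ = _ := by push_cast; ring

end SecondOrderConclusion

end NLSGI

theorem lemma3 (s : NLSGI.Sgn) :
    -- the Jost functions of a potential in `H^{1,1}` exist and are unique, and
    -- `m_± - e₁`, `n_± - e₂` belong to `L^∞(ℝ^±; H¹_z)`
    (∀ u : ℝ → ℂ, NLSGI.MemH11 u →
      (∃! m, NLSGI.IsJostM s u m) ∧ (∃! n, NLSGI.IsJostN s u n) ∧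
      NLSGI.MemLinftyH1 s (NLSGI.mDiff s u) ∧ NLSGI.MemLinftyH1 s (NLSGI.nDiff s u)) ∧
    -- `u ↦ (m_± - e₁, n_± - e₂)` is Lipschitz continuous on bounded subsets of `H^{1,1}`
    (∀ B : ℝ≥0, ∃ C : ℝ≥0, ∀ u v : ℝ → ℂ, NLSGI.MemH11 u → NLSGI.MemH11 v →
      NLSGI.h11Norm u ≤ B → NLSGI.h11Norm v ≤ B →
      NLSGI.linftyH1Norm s (NLSGI.mDiff s u - NLSGI.mDiff s v) +
        NLSGI.linftyH1Norm s (NLSGI.nDiff s u - NLSGI.nDiff s v) ≤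
          C * NLSGI.h11Norm (u - v)) ∧
    -- `m_±^{⟨2⟩}`, `n_±^{⟨2⟩}` belong to `L^∞(ℝ^±; L²_z)` for `u` in `H² ∩ H^{1,1}`
    (∀ u : ℝ → ℂ, NLSGI.MemH2 u → NLSGI.MemH11 u →
      NLSGI.MemLinftyL2 s (NLSGI.mTwo s u) ∧ NLSGI.MemLinftyL2 s (NLSGI.nTwo s u)) ∧
    -- `u ↦ (m_±^{⟨2⟩}, n_±^{⟨2⟩})` is Lipschitz continuous on bounded subsets of `H² ∩ H^{1,1}`
    (∀ B : ℝ≥0, ∃ C : ℝ≥0, ∀ u v : ℝ → ℂ, NLSGI.MemH2 u → NLSGI.MemH11 u →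
      NLSGI.MemH2 v → NLSGI.MemH11 v →
      NLSGI.h2Norm u + NLSGI.h11Norm u ≤ B → NLSGI.h2Norm v + NLSGI.h11Norm v ≤ B →
      NLSGI.linftyL2Norm s (NLSGI.mTwo s u - NLSGI.mTwo s v) +
        NLSGI.linftyL2Norm s (NLSGI.nTwo s u - NLSGI.nTwo s v) ≤
          C * (NLSGI.h2Norm (u - v) + NLSGI.h11Norm (u - v))) := by
  exact ⟨fun u hu => hu.jost s, NLSGI.exists_jost_lipschitz s, fun u hu hu' =>
    hu.memLinftyL2 hu' s, fun B => (NLSGI.exists_second_lipschitz s B).imp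
    fun C h u v hu _ hv _ => h u v hu hv⟩
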